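/- Theorem B. Let $\mathbb{R}^m_s$ denote $\mathbb{R}^m$ with the scalar product $\langle x,x\rangle=\sum_{i\le m-s}x_i^2-\sum_{i>m-s}x_i^2$, and let $Q^3_1=\{[x]\in\mathbb{R}P^4 : x\in\mathbb{R}^5_2\setminus\{0\},\ \langle x,x\rangle=0\}$ be the projectivized light cone, on which $O(3,2)$ acts by conformal transformations. Put $S^3_1=\{x\in\mathbb{R}^4_1:\langle x,x\rangle=1\}$ and $H^3_1=\{x\in\mathbb{R}^4_2:\langle x,x\rangle=-1\}$, and embed the three Lorentzian space forms conformally in $Q^3_1$ by $$\varphi_0(x)=\Big[\Big(\tfrac{-1+\langle x,x\rangle}{2},x,\tfrac{1+\langle x,x\rangle}{2}\Big)\Big]\ (x\in\mathbb{R}^3_1),\quad \varphi_+(x)=[(x,1)]\ (x\in S^3_1),\quad \varphi_-(x)=[(1,x)]\ (x\in H^3_1).$$ Let $M$ be a connected smooth surface and $y:M\to Q^3_1$ a smooth timelike immersion. For asymptotic coordinates $(u,v)$ on an open set of $M$ and a canonical local lift $Y$ of $y$ to the light cone, i.e. $\langle Y_u,Y_u\rangle=\langle Y_v,Y_v\rangle=0$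 and $\langle Y_u,Y_v\rangle=\frac12$, put $V=\mathrm{Span}\{Y,Y_u,Y_v,Y_{uv}\}$, and let the conformal Hopf differentials $\kappa_1,\kappa_2$ be the $V^\perp$-components of $Y_{uu}$ and $Y_{vv}$. The surface $y$ is called isothermic if it has no umbilic points (points where $\kappa_1=\kappa_2=0$) and, for a fixed choice of the sign, there are around each point of $M$ such $(u,v)$ and $Y$ with $\kappa_1=\pm\kappa_2$. It is called Willmore if it is a critical point of $W(y)=2\int_M\langle\kappa_1,\kappa_2\rangle\,du\,dv$ with respect to all compactly supported smooth timelike variations of $y$ (the integral being taken over the compact set that contains the support of the variation). If $y$ is both isothermic and Willmore, then it is conformally equivalent to a timelike minimal surface in one of the three Lorentzian space forms: there are $T\in O(3,2)$ and a smooth timelike immersion $x$ of $M$ with vanishing mean curvature into $\mathbb{R}^3_1$, $S^3_1$ or $H^3_1$ such that $T\circ y=\varphi\circ x$, where $\varphi$ is $\varphi_0$, $\varphi_+$ or $\varphi_-$ respectively. -/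

import Mathlib

open scoped Manifold ContDiff LinearAlgebra.Projectivization Topology
open MeasureTheory

noncomputable section

namespace TimelikeSurface

/-! ### Pseudo-Euclidean spaces and the conformal space -/

/-- The scalar product of `ℝ^m_s`: the first `m - s` coordinates are positive, the last `s`
coordinates are negative. -/
def pinner (m s : ℕ) (x y : Fin m → ℝ) : ℝ :=
  ∑ i : Fin m, if (i : ℕ) + s < m then x i * y i else -(x i * y i)

theorem pinner_smul_smul (m s : ℕ) (a : ℝ) (x : Fin m → ℝ) :
    pinner m s (a • x) (a • x) = a ^ 2 * pinner m s x x := by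
  unfold pinner
  rw [Finset.mul_sum]
  refine Finset.sum_congr rfl fun i _ => ?_
  simp only [Pi.smul_apply, smul_eq_mul]
  split_ifs <;> ring

/-- The conformal space `Q^3_1`: the projectivized light cone of `ℝ^5_2`. -/
def Q31 : Type :=
  {q : ℙ ℝ (Fin 5 → ℝ) // ∀ v ∈ q.submodule, pinner 5 2 v v = 0}

/-- The point `[v]` of `Q^3_1` for a nonzero lightlike vector `v`. -/
def Q31.mk (v : Fin 5 → ℝ) (hv : v ≠ 0) (h : pinner 5 2 v v = 0) : Q31 :=
  ⟨Projectivization.mk ℝ v hv, by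
    intro w hw
    rw [Projectivization.submodule_mk, Submodule.mem_span_singleton] at hw
    obtain ⟨a, rfl⟩ := hw
    rw [pinner_smul_smul, h, mul_zero]⟩

/-- The orthogonal group `O(3,2)` of `ℝ^5_2`. -/
structure O32 where
  toEquiv : (Fin 5 → ℝ) ≃ₗ[ℝ] (Fin 5 → ℝ)
  pinner_map : ∀ v w, pinner 5 2 (toEquiv v) (toEquiv w) = pinner 5 2 v w

/-- The conformal transformation `[v] ↦ [T v]` of `Q^3_1` induced by `T ∈ O(3,2)`. -/
def O32.act (T : O32) (q : Q31) : Q31 :=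
  ⟨Projectivization.map T.toEquiv.toLinearMap T.toEquiv.injective q.1, by
    obtain ⟨q, hq⟩ := q
    induction q using Projectivization.ind with
    | h v hv =>
      intro w hw
      rw [Projectivization.map_mk, Projectivization.submodule_mk,
        Submodule.mem_span_singleton] at hw
      obtain ⟨a, rfl⟩ := hw
      rw [pinner_smul_smul]
      have h0 : pinner 5 2 v v = 0 := hq v (by
        rw [Projectivization.submodule_mk]; exact Submodule.mem_span_singleton_self v)
      have h1 := T.pinner_map v v
      simp only [LinearEquiv.coe_coe]
      rw [h1, h0, mul_zero]⟩

/-! ### The three Lorentzian space forms and their conformal embeddings -/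

/-- Minkowski space `ℝ^3_1`, as a set with the scalar product `pinner 3 1`. -/
abbrev R31 : Type := Fin 3 → ℝ

/-- De Sitter space `S^3_1 = {x ∈ ℝ^4_1 : ⟨x, x⟩ = 1}`. -/
def S31 : Set (Fin 4 → ℝ) := {x | pinner 4 1 x x = 1}

/-- Anti-de Sitter space `H^3_1 = {x ∈ ℝ^4_2 : ⟨x, x⟩ = -1}`. -/
def H31 : Set (Fin 4 → ℝ) := {x | pinner 4 2 x x = -1}

/-- `x ↦ [((-1 + ⟨x, x⟩) / 2, x, (1 + ⟨x, x⟩) / 2)]`. -/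
def phiR (x : R31) : Q31 :=
  Q31.mk ![(-1 + pinner 3 1 x x) / 2, x 0, x 1, x 2, (1 + pinner 3 1 x x) / 2]
    (by
      intro h
      have h0 := congrFun h 0
      have h4 := congrFun h 4
      simp at h0 h4
      linarith)
    (by simp [pinner, Fin.sum_univ_succ]; ring)

/-- `x ↦ [(x, 1)]`. -/
def phiS (x : S31) : Q31 :=
  Q31.mk ![x.1 0, x.1 1, x.1 2, x.1 3, 1]
    (by
      intro h
      have h4 := congrFun h 4
      simp at h4)
    (by
      have hx : pinner 4 1 x.1 x.1 = 1 := x.2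
      simp [pinner, Fin.sum_univ_succ] at hx ⊢
      linarith)

/-- `x ↦ [(1, x)]`. -/
def phiH (x : H31) : Q31 :=
  Q31.mk ![1, x.1 0, x.1 1, x.1 2, x.1 3]
    (by
      intro h
      have h0 := congrFun h 0
      simp at h0)
    (by
      have hx : pinner 4 2 x.1 x.1 = -1 := x.2
      simp [pinner, Fin.sum_univ_succ] at hx ⊢
      linarith)

/-! ### Coordinates on surfaces -/

/-- The coordinate plane. -/
abbrev E2 : Type := EuclideanSpace ℝ (Fin 2)

/-- The coordinate vector `∂/∂u`. -/
def ex : E2 := EuclideanSpace.single 0 1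

/-- The coordinate vector `∂/∂v`. -/
def ey : E2 := EuclideanSpace.single 1 1

/-- The derivative of `Y` in the constant direction `ξ`. -/
def pd {m : ℕ} (ξ : E2) (Y : E2 → Fin m → ℝ) (x : E2) : Fin m → ℝ := fderiv ℝ Y x ξ

/-- The determinant `⟨Y_u, Y_u⟩⟨Y_v, Y_v⟩ - ⟨Y_u, Y_v⟩²` of the metric induced by `Y`. It is
negative exactly if the metric has signature `(1,1)` (and then `Y` is an immersion). -/
def metricDet {m : ℕ} (s : ℕ) (Y : E2 → Fin m → ℝ) (x : E2) : ℝ :=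
  pinner m s (pd ex Y x) (pd ex Y x) * pinner m s (pd ey Y x) (pd ey Y x)
    - pinner m s (pd ex Y x) (pd ey Y x) ^ 2

variable {M : Type*} [TopologicalSpace M]

/-- `Y` is a smooth lift to the light cone, over the set `O` of coordinates, of the map `y`
written in the chart `e`. -/
def IsLift (y : M → Q31) (e : OpenPartialHomeomorph M E2) (O : Set E2)
    (Y : E2 → Fin 5 → ℝ) : Prop :=
  ContDiffOn ℝ ∞ Y O ∧
    ∀ x ∈ O, ∃ h : Y x ≠ 0, (y (e.symm x)).1 = Projectivization.mk ℝ (Y x) h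

/-- The bundle `V = Span {Y, Y_ξ, Y_η, Y_ξη}` at `x`. -/
def gaussSpace (Y : E2 → Fin 5 → ℝ) (x ξ η : E2) : Submodule ℝ (Fin 5 → ℝ) :=
  Submodule.span ℝ {Y x, pd ξ Y x, pd η Y x, pd η (pd ξ Y) x}

/-- `(ξ, η)` is an asymptotic frame at `x` with `⟨Y_ξ, Y_η⟩ = 1/2`, and `κ₁`, `κ₂` are the
conformal Hopf differentials in this frame: the components of `Y_ξξ` and `Y_ηη` in the orthogonal
complement of `V`. For a lift `Y`, these are tensorial in the frame: they depend only on the values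
of `ξ` and `η` at the point, and not on the coordinates in which they are constant. -/
def IsHopfPair (Y : E2 → Fin 5 → ℝ) (x ξ η : E2) (κ₁ κ₂ : Fin 5 → ℝ) : Prop :=
  pinner 5 2 (pd ξ Y x) (pd ξ Y x) = 0 ∧
  pinner 5 2 (pd η Y x) (pd η Y x) = 0 ∧
  pinner 5 2 (pd ξ Y x) (pd η Y x) = 1 / 2 ∧
  (∀ v ∈ gaussSpace Y x ξ η, pinner 5 2 κ₁ v = 0) ∧
  (∀ v ∈ gaussSpace Y x ξ η, pinner 5 2 κ₂ v = 0) ∧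
  pd ξ (pd ξ Y) x - κ₁ ∈ gaussSpace Y x ξ η ∧
  pd η (pd η Y) x - κ₂ ∈ gaussSpace Y x ξ η

variable [ChartedSpace E2 M]

/-- `y : M → Q^3_1` is a smooth immersed timelike surface. -/
def IsTimelike (y : M → Q31) : Prop :=
  ∀ p : M, ∃ e ∈ IsManifold.maximalAtlas (𝓡 2) ∞ M, p ∈ e.source ∧
    ∃ Y : E2 → Fin 5 → ℝ, IsLift y e e.target Y ∧ ∀ x ∈ e.target, metricDet 2 Y x < 0

/-! ### The Willmore functional -/

/-- `w` is the value, in the coordinates `e` at the point `x`, of the density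
`2 ⟨κ₁, κ₂⟩ du dv`, where `(u, v)` are asymptotic coordinates with coordinate vectors
`ξ` and `η` at that point, so that `du dv` is `1 / |det (ξ, η)|` times Lebesgue measure. -/
def IsWillmoreDensityAt (y : M → Q31) (e : OpenPartialHomeomorph M E2) (x : E2) (w : ℝ) : Prop :=
  ∃ O : Set E2, IsOpen O ∧ x ∈ O ∧ O ⊆ e.target ∧ ∃ Y : E2 → Fin 5 → ℝ, IsLift y e O Y ∧
    ∃ (ξ η : E2) (κ₁ κ₂ : Fin 5 → ℝ), IsHopfPair Y x ξ η κ₁ κ₂ ∧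
      w = 2 * pinner 5 2 κ₁ κ₂ / |ξ 0 * η 1 - ξ 1 * η 0|

/-- `W = 2 ∫_K ⟨κ₁, κ₂⟩ du dv`: the integral of the Willmore density over `K ⊆ M`, computed by
cutting `K` into finitely many disjoint measurable pieces that lie in charts. -/
def HasWillmoreEnergy (y : M → Q31) (K : Set M) (W : ℝ) : Prop :=
  ∃ (N : ℕ) (e : Fin N → OpenPartialHomeomorph M E2) (A : Fin N → Set M) (w : Fin N → E2 → ℝ),
    (∀ i, e i ∈ IsManifold.maximalAtlas (𝓡 2) ∞ M ∧ A i ⊆ (e i).source ∧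
      MeasurableSet (e i '' A i) ∧
      (∀ x ∈ e i '' A i, IsWillmoreDensityAt y (e i) x (w i x)) ∧
      IntegrableOn (w i) (e i '' A i) volume) ∧
    (∀ i j, i ≠ j → Disjoint (A i) (A j)) ∧
    (⋃ i, A i) = K ∧
    W = ∑ i, ∫ x in e i '' A i, w i x

/-- `z` is a smooth timelike variation of `y`, for times `t ∈ (-ε, ε)`, which moves `y` only inside
the set `K`. -/
def IsTimelikeVariation (y : M → Q31) (K : Set M) (ε : ℝ) (z : ℝ → M → Q31) : Prop :=
  z 0 = y ∧
  (∀ t ∈ Set.Ioo (-ε) ε, IsTimelike (z t)) ∧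
  (∀ t ∈ Set.Ioo (-ε) ε, ∀ p ∉ K, z t p = y p) ∧
  (∀ t₀ ∈ Set.Ioo (-ε) ε, ∀ p : M, ∃ e ∈ IsManifold.maximalAtlas (𝓡 2) ∞ M, p ∈ e.source ∧
    ∃ (I : Set ℝ) (Y : ℝ × E2 → Fin 5 → ℝ), IsOpen I ∧ t₀ ∈ I ∧
      ContDiffOn ℝ ∞ Y (I ×ˢ e.target) ∧
      ∀ t ∈ I, ∀ x ∈ e.target, ∃ h : Y (t, x) ≠ 0,
        (z t (e.symm x)).1 = Projectivization.mk ℝ (Y (t, x)) h)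

/-- `y` is a timelike Willmore surface: a critical point of the Willmore functional for all
compactly supported timelike variations. -/
def IsWillmore (y : M → Q31) : Prop :=
  IsTimelike y ∧
    ∀ (K : Set M) (ε : ℝ) (z : ℝ → M → Q31), IsCompact K → 0 < ε →
      IsTimelikeVariation y K ε z →
      ∀ W : ℝ → ℝ, (∀ᶠ t in 𝓝 (0 : ℝ), HasWillmoreEnergy (z t) K (W t)) → HasDerivAt W 0 0

/-! ### Isothermic surfaces -/

/-- `p` is an umbilic point of `y`: both conformal Hopf differentials vanish there. -/
def IsUmbilic (y : M → Q31) (p : M) : Prop :=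
  ∃ e ∈ IsManifold.maximalAtlas (𝓡 2) ∞ M, p ∈ e.source ∧
    ∃ Y : E2 → Fin 5 → ℝ, IsLift y e e.target Y ∧ ∃ ξ η : E2, IsHopfPair Y (e p) ξ η 0 0

/-- `y` is a timelike surface without umbilic points and around each point there are asymptotic
coordinates and a canonical lift with `κ₁ = σ κ₂`. -/
def IsSignedIsothermic (σ : ℝ) (y : M → Q31) : Prop :=
  IsTimelike y ∧ (∀ p, ¬ IsUmbilic y p) ∧
    ∀ p : M, ∃ e ∈ IsManifold.maximalAtlas (𝓡 2) ∞ M, p ∈ e.source ∧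
      ∃ Y : E2 → Fin 5 → ℝ, IsLift y e e.target Y ∧
        ∀ x ∈ e.target, ∃ κ₁ κ₂ : Fin 5 → ℝ, IsHopfPair Y x ex ey κ₁ κ₂ ∧ κ₁ = σ • κ₂

/-- `y` is a timelike isothermic surface, i.e. `(+)`-isothermic or `(-)`-isothermic. -/
def IsIsothermic (y : M → Q31) : Prop :=
  IsSignedIsothermic 1 y ∨ IsSignedIsothermic (-1) y

/-! ### Minimal surfaces in the space forms -/

/-- The mean curvature, i.e. half the trace of the second fundamental form with respect to the
induced metric, of the surface `X` in the direction of the normal vector `ν`. -/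
def meanCurvature {m : ℕ} (s : ℕ) (X : E2 → Fin m → ℝ) (x : E2) (ν : Fin m → ℝ) : ℝ :=
  (pinner m s (pd ey X x) (pd ey X x) * pinner m s (pd ex (pd ex X) x) ν
    - 2 * pinner m s (pd ex X x) (pd ey X x) * pinner m s (pd ey (pd ex X) x) ν
    + pinner m s (pd ex X x) (pd ex X x) * pinner m s (pd ey (pd ey X) x) ν)
    / (2 * metricDet s X x)

/-- `X : M → ℝ^m_s` is a smooth timelike immersion whose mean curvature vanishes for all unit
vectors `ν` that are normal to the surface and tangent to the ambient space form, where `T a` is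
the tangent space of this space form at its point `a`. -/
def IsTimelikeMinimal {m : ℕ} (s : ℕ) (T : (Fin m → ℝ) → Set (Fin m → ℝ))
    (X : M → Fin m → ℝ) : Prop :=
  ContMDiff (𝓡 2) 𝓘(ℝ, Fin m → ℝ) ∞ X ∧
    ∀ e ∈ IsManifold.maximalAtlas (𝓡 2) ∞ M, ∀ x ∈ e.target,
      metricDet s (X ∘ e.symm) x < 0 ∧
      ∀ ν ∈ T (X (e.symm x)), pinner m s ν ν = 1 →
        pinner m s ν (pd ex (X ∘ e.symm) x) = 0 → pinner m s ν (pd ey (X ∘ e.symm) x) = 0 →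
        meanCurvature s (X ∘ e.symm) x ν = 0

/-- `x` is a timelike minimal surface in `ℝ^3_1`. -/
def IsMinimalR (x : M → R31) : Prop :=
  IsTimelikeMinimal 1 (fun _ => Set.univ) x

/-- `x` is a timelike minimal surface in `S^3_1 ⊆ ℝ^4_1`. -/
def IsMinimalS (x : M → S31) : Prop :=
  IsTimelikeMinimal 1 (fun a => {ν | pinner 4 1 a ν = 0}) (fun p => (x p : Fin 4 → ℝ))

/-- `x` is a timelike minimal surface in `H^3_1 ⊆ ℝ^4_2`. -/
def IsMinimalH (x : M → H31) : Prop :=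
  IsTimelikeMinimal 2 (fun a => {ν | pinner 4 2 a ν = 0}) (fun p => (x p : Fin 4 → ℝ))

end TimelikeSurface

end

/-!
In asymptotic coordinates with coordinate fields `a`, `b`, complete a canonical lift `Y` to a null
frame `(Y, N, Y_a, Y_b, E)`, with `E` the unit normal to `V`, and put `k_ξ = ⟨Y_ξξ, E⟩` and
`s_ξ = ⟨Y_ξξ, N⟩`. The variations `Y + t f E + (t² f² / 2) N` of the lift stay in the light cone;
integrating their first variation by parts, and using the Codazzi equation, turns criticality into
the Willmore equation `(k_a)_bb + s_b k_a = 0`.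

If moreover the Hopf differentials agree up to a constant factor, `k_a = α k` and `k_b = β k`, then
the Willmore equations say that a certain vector `c ⟂ E` with `⟨c, Y⟩ = k` is constant. A constant
vector orthogonal to `E` is determined up to a factor, so the lines `ℝ c` fit together over the
connected surface. An isometry moves `c` to a normal form, which depends on the sign of `⟨c, c⟩`.
Then `Y / ⟨c, Y⟩` lies in the section of the light cone by `⟨c, ·⟩ = 1`, which is a space form. Its
normal there is `E` because `c ⟂ E`, and its second fundamental form in the direction of `E` is
trace free because `E ⟂ Y_ab`.
-/

noncomputable section

namespace TimelikeSurface

local notation "⟪" x ", " y "⟫" => pinner 5 2 x y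

/-! ### Algebra of the scalar product -/

section Pinner

variable {m s : ℕ}

/-- The sign of the `i`-th coordinate in the scalar product of `ℝ^m_s`. -/
def pinnerSign (m s : ℕ) (i : Fin m) : ℝ := if (i : ℕ) + s < m then 1 else -1

theorem pinnerSign_mul_self (i : Fin m) : pinnerSign m s i * pinnerSign m s i = 1 := by
  unfold pinnerSign
  split_ifs <;> norm_num

theorem pinner_eq_sum (x y : Fin m → ℝ) :
    pinner m s x y = ∑ i, pinnerSign m s i * (x i * y i) := by
  unfold pinner pinnerSign
  exact Finset.sum_congr rfl fun i _ => by split_ifs <;> ring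

theorem pinner_comm (x y : Fin m → ℝ) : pinner m s x y = pinner m s y x := by
  simp only [pinner_eq_sum, mul_comm (x _)]

@[simp] theorem pinner_add_left (x y z : Fin m → ℝ) :
    pinner m s (x + y) z = pinner m s x z + pinner m s y z := by
  simp only [pinner_eq_sum, Pi.add_apply, add_mul, mul_add, Finset.sum_add_distrib]

@[simp] theorem pinner_smul_left (a : ℝ) (x z : Fin m → ℝ) :
    pinner m s (a • x) z = a * pinner m s x z := by
  simp only [pinner_eq_sum, Pi.smul_apply, smul_eq_mul, Finset.mul_sum]
  exact Finset.sum_congr rfl fun i _ => by ring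

@[simp] theorem pinner_add_right (z x y : Fin m → ℝ) :
    pinner m s z (x + y) = pinner m s z x + pinner m s z y := by
  rw [pinner_comm, pinner_add_left, pinner_comm x, pinner_comm y]

@[simp] theorem pinner_smul_right (a : ℝ) (z x : Fin m → ℝ) :
    pinner m s z (a • x) = a * pinner m s z x := by
  rw [pinner_comm, pinner_smul_left, pinner_comm x]

/-- The scalar product of `ℝ^m_s` as a bilinear form. -/
def pinnerForm (m s : ℕ) : LinearMap.BilinForm ℝ (Fin m → ℝ) :=
  LinearMap.mk₂ ℝ (pinner m s) pinner_add_left pinner_smul_left pinner_add_right pinner_smul_right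

@[simp] theorem pinnerForm_apply (x y : Fin m → ℝ) : pinnerForm m s x y = pinner m s x y := rfl

@[simp] theorem pinner_neg_left (x z : Fin m → ℝ) : pinner m s (-x) z = -pinner m s x z :=
  (pinnerForm m s).map_neg₂ x z

@[simp] theorem pinner_neg_right (z x : Fin m → ℝ) : pinner m s z (-x) = -pinner m s z x :=
  (pinnerForm m s z).map_neg x

@[simp] theorem pinner_sub_left (x y z : Fin m → ℝ) :
    pinner m s (x - y) z = pinner m s x z - pinner m s y z :=
  (pinnerForm m s).map_sub₂ x y z

@[simp] theorem pinner_sub_right (z x y : Fin m → ℝ) :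
    pinner m s z (x - y) = pinner m s z x - pinner m s z y :=
  (pinnerForm m s z).map_sub x y

@[simp] theorem pinner_zero_left (z : Fin m → ℝ) : pinner m s 0 z = 0 :=
  (pinnerForm m s).map_zero₂ z

theorem pinner_eq_zero_of_mem_span {S : Set (Fin m → ℝ)} {x v : Fin m → ℝ}
    (h : ∀ w ∈ S, pinner m s x w = 0) (hv : v ∈ Submodule.span ℝ S) : pinner m s x v = 0 :=
  (Submodule.span_le (p := LinearMap.ker (pinnerForm m s x))).2 h hv

/-- The matrix of the scalar products of the vectors of two families. -/
def gram (s : ℕ) {ι : Type*} (u v : ι → Fin m → ℝ) : Matrix ι ι ℝ :=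
  Matrix.of fun i j => pinner m s (u i) (v j)

@[simp] theorem gram_apply {ι : Type*} (u v : ι → Fin m → ℝ) (i j : ι) :
    gram s u v i j = pinner m s (u i) (v j) := rfl

theorem det_gram (u v : Fin m → Fin m → ℝ) :
    (gram s u v).det = (Matrix.of u).det * (∏ i, pinnerSign m s i) * (Matrix.of v).det := by
  have h : gram s u v
      = Matrix.of u * Matrix.diagonal (pinnerSign m s) * (Matrix.of v).transpose := by
    ext i j
    rw [Matrix.mul_apply]
    simp only [gram_apply, Matrix.mul_diagonal, Matrix.transpose_apply, Matrix.of_apply,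
      pinner_eq_sum]
    exact Finset.sum_congr rfl fun l _ => by ring
  rw [h, Matrix.det_mul, Matrix.det_mul, Matrix.det_transpose, Matrix.det_diagonal]

theorem eq_zero_of_det_gram_ne_zero {v : Fin m → Fin m → ℝ} (hv : (gram s v v).det ≠ 0)
    {w : Fin m → ℝ} (hw : ∀ i, pinner m s w (v i) = 0) : w = 0 := by
  rw [det_gram] at hv
  have h0 : (fun i => pinnerSign m s i * w i) = 0 := by
    refine Matrix.eq_zero_of_mulVec_eq_zero (right_ne_zero_of_mul hv) (funext fun i => ?_)
    rw [Pi.zero_apply, ← hw i, pinner_eq_sum, Matrix.mulVec, dotProduct]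
    exact Finset.sum_congr rfl fun j _ => by rw [Matrix.of_apply]; ring
  funext i
  have := congrArg (pinnerSign m s i * ·) (congrFun h0 i)
  simpa [← mul_assoc, pinnerSign_mul_self] using this

theorem det_gram_eq_zero_of_not_linearIndependent {n : ℕ} {v : Fin n → Fin m → ℝ}
    (hv : ¬ LinearIndependent ℝ v) : (gram s v v).det = 0 := by
  obtain ⟨g, hg, i, hi⟩ := Fintype.not_linearIndependent_iff.1 hv
  refine Matrix.exists_vecMul_eq_zero_iff.1 ⟨g, fun h => hi (congrFun h i), funext fun j => ?_⟩
  have h := congrArg (pinnerForm m s · (v j)) hg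
  simpa [Matrix.vecMul, dotProduct, LinearMap.sum_apply] using h

end Pinner

section Cross

variable {n s : ℕ} (v : Fin n → Fin (n + 1) → ℝ)

/-- The vector product of `n` vectors of `ℝ^(n+1)_s`. It represents the linear form
`w ↦ det (w, v₁, …, vₙ)`. -/
def cross (s : ℕ) : Fin (n + 1) → ℝ := fun i =>
  pinnerSign (n + 1) s i * ((-1) ^ (i : ℕ) * ((Matrix.of v).submatrix id i.succAbove).det)

theorem pinner_cross (w : Fin (n + 1) → ℝ) :
    pinner (n + 1) s (cross v s) w = (Matrix.of (Matrix.vecCons w v)).det := by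
  rw [Matrix.det_succ_row_zero, pinner_eq_sum]
  refine Finset.sum_congr rfl fun i _ => ?_
  calc pinnerSign (n + 1) s i * (cross v s i * w i)
      = pinnerSign (n + 1) s i * pinnerSign (n + 1) s i
        * ((-1) ^ (i : ℕ) * w i * ((Matrix.of v).submatrix id i.succAbove).det) := by
          unfold cross; ring
    _ = _ := by rw [pinnerSign_mul_self, one_mul]; rfl

theorem pinner_cross_apply (i : Fin n) : pinner (n + 1) s (cross v s) (v i) = 0 := by
  rw [pinner_cross]
  exact Matrix.det_zero_of_row_eq (Fin.succ_ne_zero i).symm rfl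

variable {v} in
theorem exists_pinner_cross_ne_zero (hv : LinearIndependent ℝ v) :
    ∃ w, pinner (n + 1) s (cross v s) w ≠ 0 := by
  obtain ⟨w, hw⟩ : ∃ w, w ∉ Submodule.span ℝ (Set.range v) := by
    by_contra! h
    have h1 := finrank_span_eq_card hv
    rw [Submodule.eq_top_iff'.2 h, finrank_top] at h1
    simp at h1
  refine ⟨w, fun h => ?_⟩
  rw [pinner_cross] at h
  exact (Matrix.linearIndependent_rows_iff_isUnit.1
    (linearIndependent_finCons.2 ⟨hv, hw⟩ : LinearIndependent ℝ (Matrix.vecCons w v))).map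
    Matrix.detMonoidHom |>.ne_zero h

theorem pinner_cross_self : pinner (n + 1) s (cross v s) (cross v s)
    = (∏ i, pinnerSign (n + 1) s i) * (gram s v v).det := by
  by_cases hv : LinearIndependent ℝ v
  · obtain ⟨w, hw⟩ := exists_pinner_cross_ne_zero (s := s) hv
    -- The Gram matrix of `(w, v)` and `(cross v, v)` is block triangular.
    have hblock : (gram s (Matrix.vecCons w v) (Matrix.vecCons (cross v s) v)).det
        = pinner (n + 1) s (cross v s) w * (gram s v v).det := by
      rw [Matrix.det_succ_column_zero, Fin.sum_univ_succ, Finset.sum_eq_zero fun i _ => by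
        simp [pinner_comm (v i), pinner_cross_apply]]
      simp only [gram_apply, Matrix.cons_val_zero, pinner_comm w, Fin.val_zero, pow_zero, one_mul,
        add_zero]
      rfl
    rw [det_gram, ← pinner_cross (s := s), ← pinner_cross (s := s)] at hblock
    refine mul_left_cancel₀ hw ?_
    have hsign : (∏ i, pinnerSign (n + 1) s i) * (∏ i, pinnerSign (n + 1) s i) = 1 := by
      rw [← Finset.prod_mul_distrib]
      exact Finset.prod_eq_one fun i _ => pinnerSign_mul_self i
    linear_combination (∏ i, pinnerSign (n + 1) s i) * hblock
      - pinner (n + 1) s (cross v s) w * pinner (n + 1) s (cross v s) (cross v s) * hsign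
  · rw [det_gram_eq_zero_of_not_linearIndependent hv, mul_zero, pinner_cross]
    refine Matrix.det_eq_zero_of_not_linearIndependent_rows fun h => hv ?_
    exact (linearIndependent_finCons.1 h).1

end Cross

/-! ### Frames of `ℝ^5_2` -/

/-- The Gram matrix of the vectors `a, b, c, d, e` of `ℝ^5_2` is nondegenerate because it consists,
up to `⟨b, c⟩` and `⟨b, d⟩`, of the blocks of `(a, b)` with `⟨a, a⟩ = 0`, of `(c, d)` and of the
unit vector `e`. -/
structure IsBlockFrame (a b c d e : Fin 5 → ℝ) : Prop where
  aa : ⟪a, a⟫ = 0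
  ab : ⟪a, b⟫ ≠ 0
  ac : ⟪a, c⟫ = 0
  ad : ⟪a, d⟫ = 0
  cd : ⟪c, c⟫ * ⟪d, d⟫ - ⟪c, d⟫ ^ 2 ≠ 0
  ee : ⟪e, e⟫ = 1
  ea : ⟪e, a⟫ = 0
  eb : ⟪e, b⟫ = 0
  ec : ⟪e, c⟫ = 0
  ed : ⟪e, d⟫ = 0

theorem det_gram_four {a b c d : Fin 5 → ℝ} (aa : ⟪a, a⟫ = 0) (ac : ⟪a, c⟫ = 0)
    (ad : ⟪a, d⟫ = 0) : (gram 2 ![a, b, c, d] ![a, b, c, d]).det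
      = -⟪a, b⟫ ^ 2 * (⟪c, c⟫ * ⟪d, d⟫ - ⟪c, d⟫ ^ 2) := by
  simp [Matrix.det_succ_row_zero, Fin.sum_univ_succ, Fin.succAbove, aa, ac, ad, pinner_comm b a,
    pinner_comm c a, pinner_comm d a, pinner_comm d c]
  ring

theorem pinner_cross_self_four {a b c d : Fin 5 → ℝ} (aa : ⟪a, a⟫ = 0) (ac : ⟪a, c⟫ = 0)
    (ad : ⟪a, d⟫ = 0) : ⟪cross ![a, b, c, d] 2, cross ![a, b, c, d] 2⟫
      = -⟪a, b⟫ ^ 2 * (⟪c, c⟫ * ⟪d, d⟫ - ⟪c, d⟫ ^ 2) := by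
  rw [pinner_cross_self, det_gram_four aa ac ad]
  norm_num [Fin.prod_univ_succ, pinnerSign]

namespace IsBlockFrame

variable {a b c d e w : Fin 5 → ℝ}

theorem det_gram_ne_zero (h : IsBlockFrame a b c d e) :
    (gram 2 ![e, a, b, c, d] ![e, a, b, c, d]).det ≠ 0 := by
  have hdet : (gram 2 ![e, a, b, c, d] ![e, a, b, c, d]).det
      = (gram 2 ![a, b, c, d] ![a, b, c, d]).det := by
    rw [Matrix.det_succ_row_zero, Fin.sum_univ_succ, Finset.sum_eq_zero fun i _ => by
      fin_cases i <;> simp [h.ea, h.eb, h.ec, h.ed]]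
    simp only [gram_apply, Matrix.cons_val_zero, h.ee, Fin.val_zero, pow_zero, one_mul, add_zero]
    rfl
  rw [hdet, det_gram_four h.aa h.ac h.ad]
  exact mul_ne_zero (neg_ne_zero.2 (pow_ne_zero 2 h.ab)) h.cd

theorem eq_zero (h : IsBlockFrame a b c d e) (wa : ⟪w, a⟫ = 0) (wb : ⟪w, b⟫ = 0)
    (wc : ⟪w, c⟫ = 0) (wd : ⟪w, d⟫ = 0) (we : ⟪w, e⟫ = 0) : w = 0 :=
  eq_zero_of_det_gram_ne_zero h.det_gram_ne_zero fun i => by fin_cases i <;> assumption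

theorem eq_smul (h : IsBlockFrame a b c d e) (wa : ⟪w, a⟫ = 0) (wb : ⟪w, b⟫ = 0)
    (wc : ⟪w, c⟫ = 0) (wd : ⟪w, d⟫ = 0) : w = ⟪w, e⟫ • e := by
  rw [← sub_eq_zero]
  apply h.eq_zero <;> simp [wa, wb, wc, wd, h.ea, h.eb, h.ec, h.ed, h.ee]

theorem mem_span (h : IsBlockFrame a b c d e) (hw : ⟪e, w⟫ = 0) :
    w ∈ Submodule.span ℝ {a, c, d, b} := by
  have hli : LinearIndependent ℝ ![e, a, b, c, d] := by
    by_contra hli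
    exact h.det_gram_ne_zero (det_gram_eq_zero_of_not_linearIndependent hli)
  have hrange : Set.range ![e, a, b, c, d] = insert e {a, c, d, b} := by
    simp only [Matrix.range_cons, Matrix.range_empty, Set.union_empty, Set.singleton_union]
    rw [Set.insert_comm b c, Set.pair_comm b d]
  have hw' : w ∈ Submodule.span ℝ (insert e {a, c, d, b}) := by
    rw [← hrange, hli.span_eq_top_of_card_eq_finrank (by simp)]
    trivial
  obtain ⟨r, z, hz, rfl⟩ := Submodule.mem_span_insert.1 hw'
  have hez : ⟪e, z⟫ = 0 := pinner_eq_zero_of_mem_span (by simp [h.ea, h.eb, h.ec, h.ed]) hz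
  have hr : r = 0 := by simpa [h.ee, hez] using hw
  simpa [hr] using hz

end IsBlockFrame

/-- A basis of `ℝ^5_2` that consists of the lightlike vectors `Y, N` with `⟨Y, N⟩ = -1` and `A, B`
with `⟨A, B⟩ = 1/2` and of the unit vector `E`. -/
structure IsNullBasis (Y N A B E : Fin 5 → ℝ) : Prop where
  YY : ⟪Y, Y⟫ = 0
  NN : ⟪N, N⟫ = 0
  YN : ⟪Y, N⟫ = -1
  YA : ⟪Y, A⟫ = 0
  YB : ⟪Y, B⟫ = 0
  NA : ⟪N, A⟫ = 0
  NB : ⟪N, B⟫ = 0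
  AA : ⟪A, A⟫ = 0
  BB : ⟪B, B⟫ = 0
  AB : ⟪A, B⟫ = 1 / 2
  EE : ⟪E, E⟫ = 1
  EY : ⟪E, Y⟫ = 0
  EN : ⟪E, N⟫ = 0
  EA : ⟪E, A⟫ = 0
  EB : ⟪E, B⟫ = 0

namespace IsNullBasis

variable {Y N A B E : Fin 5 → ℝ}

theorem isBlockFrame (h : IsNullBasis Y N A B E) : IsBlockFrame Y N A B E :=
  ⟨h.YY, by rw [h.YN]; norm_num, h.YA, h.YB, by rw [h.AA, h.AB]; norm_num, h.EE, h.EY, h.EN, h.EA,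
    h.EB⟩

theorem swap (h : IsNullBasis Y N A B E) : IsNullBasis Y N B A E :=
  ⟨h.YY, h.NN, h.YN, h.YB, h.YA, h.NB, h.NA, h.BB, h.AA, (pinner_comm B A).trans h.AB, h.EE, h.EY,
    h.EN, h.EB, h.EA⟩

theorem expand (h : IsNullBasis Y N A B E) (w : Fin 5 → ℝ) :
    w = (-⟪w, N⟫) • Y + (-⟪w, Y⟫) • N + (2 * ⟪w, B⟫) • A + (2 * ⟪w, A⟫) • B + ⟪w, E⟫ • E := by
  rw [← sub_eq_zero]
  apply h.isBlockFrame.eq_zero <;>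
    simp only [pinner_sub_left, pinner_add_left, pinner_smul_left, h.YY, h.NN, h.YN, h.YA, h.YB,
      h.NA, h.NB, h.AA, h.BB, h.AB, h.EE, h.EY, h.EN, h.EA, h.EB, pinner_comm N Y,
      pinner_comm A Y, pinner_comm B Y, pinner_comm A N, pinner_comm B N, pinner_comm B A,
      pinner_comm Y E, pinner_comm N E, pinner_comm A E, pinner_comm B E] <;> ring

end IsNullBasis

/-! ### Directional derivatives -/

/-- The derivative of `f` in the constant direction `ξ`. -/
def dirDeriv {P F : Type*} [NormedAddCommGroup P] [NormedSpace ℝ P] [NormedAddCommGroup F]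
    [NormedSpace ℝ F] (ξ : P) (f : P → F) (x : P) : F := fderiv ℝ f x ξ

local notation:max "∂[" ξ "]" => dirDeriv ξ

section Derivatives

variable {P F : Type*} [NormedAddCommGroup P] [NormedSpace ℝ P] [NormedAddCommGroup F]
  [NormedSpace ℝ F]

/-- `f` is smooth on the open set `O`. -/
structure SmoothOn (O : Set P) (f : P → F) : Prop where
  isOpen : IsOpen O
  contDiffOn : ContDiffOn ℝ ∞ f O

variable {O : Set P} {f g : P → F} {c d : P → ℝ} {x : P} {ξ η : P}

theorem SmoothOn.contDiffAt (hf : SmoothOn O f) (hx : x ∈ O) : ContDiffAt ℝ ∞ f x :=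
  hf.contDiffOn.contDiffAt (hf.isOpen.mem_nhds hx)

theorem SmoothOn.differentiableAt (hf : SmoothOn O f) (hx : x ∈ O) : DifferentiableAt ℝ f x :=
  (hf.contDiffAt hx).differentiableAt (by simp)

theorem SmoothOn.continuousOn (hf : SmoothOn O f) : ContinuousOn f O := hf.contDiffOn.continuousOn

theorem SmoothOn.mono (hf : SmoothOn O f) {O' : Set P} (hO' : IsOpen O') (h : O' ⊆ O) :
    SmoothOn O' f :=
  ⟨hO', hf.contDiffOn.mono h⟩

theorem SmoothOn.congr (hf : SmoothOn O f) (h : ∀ x ∈ O, g x = f x) : SmoothOn O g :=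
  ⟨hf.isOpen, hf.contDiffOn.congr h⟩

theorem SmoothOn.dirDeriv (hf : SmoothOn O f) : SmoothOn O (∂[ξ] f) :=
  ⟨hf.isOpen, (hf.contDiffOn.fderiv_of_isOpen hf.isOpen (by simp)).clm_apply contDiffOn_const⟩

theorem SmoothOn.const (hO : IsOpen O) (v : F) : SmoothOn O (fun _ => v) := ⟨hO, contDiffOn_const⟩

theorem SmoothOn.add (hf : SmoothOn O f) (hg : SmoothOn O g) : SmoothOn O (fun x => f x + g x) :=
  ⟨hf.isOpen, hf.contDiffOn.add hg.contDiffOn⟩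

theorem SmoothOn.sub (hf : SmoothOn O f) (hg : SmoothOn O g) : SmoothOn O (fun x => f x - g x) :=
  ⟨hf.isOpen, hf.contDiffOn.sub hg.contDiffOn⟩

theorem SmoothOn.neg (hf : SmoothOn O f) : SmoothOn O (fun x => -f x) :=
  ⟨hf.isOpen, hf.contDiffOn.neg⟩

theorem SmoothOn.smul (hc : SmoothOn O c) (hf : SmoothOn O f) : SmoothOn O (fun x => c x • f x) :=
  ⟨hf.isOpen, hc.contDiffOn.smul hf.contDiffOn⟩

theorem SmoothOn.const_smul (hf : SmoothOn O f) (r : ℝ) : SmoothOn O (fun x => r • f x) :=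
  ⟨hf.isOpen, contDiffOn_const.smul hf.contDiffOn⟩

theorem SmoothOn.mul (hc : SmoothOn O c) (hd : SmoothOn O d) : SmoothOn O (fun x => c x * d x) :=
  ⟨hc.isOpen, hc.contDiffOn.mul hd.contDiffOn⟩

theorem SmoothOn.const_mul (hc : SmoothOn O c) (r : ℝ) : SmoothOn O (fun x => r * c x) :=
  ⟨hc.isOpen, contDiffOn_const.mul hc.contDiffOn⟩

theorem SmoothOn.pow (hc : SmoothOn O c) (n : ℕ) : SmoothOn O (fun x => c x ^ n) :=
  ⟨hc.isOpen, hc.contDiffOn.pow n⟩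

theorem SmoothOn.div (hc : SmoothOn O c) (hd : SmoothOn O d) (h : ∀ x ∈ O, d x ≠ 0) :
    SmoothOn O (fun x => c x / d x) := ⟨hc.isOpen, hc.contDiffOn.div hd.contDiffOn h⟩

theorem SmoothOn.sqrt (hc : SmoothOn O c) (h : ∀ x ∈ O, c x ≠ 0) : SmoothOn O (fun x => √(c x)) :=
  ⟨hc.isOpen, hc.contDiffOn.sqrt h⟩

theorem SmoothOn.clm {G : Type*} [NormedAddCommGroup G] [NormedSpace ℝ G] (L : F →L[ℝ] G)
    (hf : SmoothOn O f) : SmoothOn O (fun x => L (f x)) :=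
  ⟨hf.isOpen, L.contDiff.comp_contDiffOn hf.contDiffOn⟩

theorem dirDeriv_congr (hO : IsOpen O) (h : ∀ x ∈ O, f x = g x) (hx : x ∈ O) :
    ∂[ξ] f x = ∂[ξ] g x := by
  have : f =ᶠ[𝓝 x] g := Filter.eventuallyEq_of_mem (hO.mem_nhds hx) h
  unfold dirDeriv
  rw [this.fderiv_eq]

@[simp] theorem dirDeriv_const (v : F) : ∂[ξ] (fun _ : P => v) x = 0 := by
  simp [dirDeriv]

theorem dirDeriv_eq_zero (hO : IsOpen O) {v : F} (h : ∀ x ∈ O, f x = v) (hx : x ∈ O) :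
    ∂[ξ] f x = 0 := by
  rw [dirDeriv_congr hO h hx, dirDeriv_const]

theorem dirDeriv_add (hf : DifferentiableAt ℝ f x) (hg : DifferentiableAt ℝ g x) :
    ∂[ξ] (fun x => f x + g x) x = ∂[ξ] f x + ∂[ξ] g x := by
  unfold dirDeriv
  rw [fderiv_fun_add hf hg]
  rfl

theorem dirDeriv_sub (hf : DifferentiableAt ℝ f x) (hg : DifferentiableAt ℝ g x) :
    ∂[ξ] (fun x => f x - g x) x = ∂[ξ] f x - ∂[ξ] g x := by
  unfold dirDeriv
  rw [fderiv_fun_sub hf hg]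
  rfl

theorem dirDeriv_neg : ∂[ξ] (fun x => -f x) x = -∂[ξ] f x := by
  unfold dirDeriv
  rw [fderiv_fun_neg]
  rfl

theorem dirDeriv_smul (hc : DifferentiableAt ℝ c x) (hf : DifferentiableAt ℝ f x) :
    ∂[ξ] (fun x => c x • f x) x = c x • ∂[ξ] f x + ∂[ξ] c x • f x := by
  unfold dirDeriv
  rw [fderiv_fun_smul hc hf]
  rfl

theorem dirDeriv_const_smul (hf : DifferentiableAt ℝ f x) (r : ℝ) :
    ∂[ξ] (fun x => r • f x) x = r • ∂[ξ] f x := by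
  unfold dirDeriv
  rw [fderiv_fun_const_smul hf]
  rfl

theorem dirDeriv_mul (hc : DifferentiableAt ℝ c x) (hd : DifferentiableAt ℝ d x) :
    ∂[ξ] (fun x => c x * d x) x = c x * ∂[ξ] d x + ∂[ξ] c x * d x :=
  dirDeriv_smul hc hd

theorem dirDeriv_const_mul (hc : DifferentiableAt ℝ c x) (r : ℝ) :
    ∂[ξ] (fun x => r * c x) x = r * ∂[ξ] c x :=
  dirDeriv_const_smul hc r

theorem dirDeriv_pow (hc : DifferentiableAt ℝ c x) (n : ℕ) :
    ∂[ξ] (fun x => c x ^ n) x = n * c x ^ (n - 1) * ∂[ξ] c x := by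
  unfold dirDeriv
  rw [fderiv_fun_pow n hc]
  simp [mul_assoc]

theorem dirDeriv_clm {G : Type*} [NormedAddCommGroup G] [NormedSpace ℝ G] (L : F →L[ℝ] G)
    (hf : DifferentiableAt ℝ f x) : ∂[ξ] (fun x => L (f x)) x = L (∂[ξ] f x) := by
  unfold dirDeriv
  have := (L.hasFDerivAt.comp x hf.hasFDerivAt).fderiv
  rw [show (fun x => L (f x)) = L ∘ f from rfl, this]
  rfl

theorem dirDeriv_dirDeriv_apply (hf : SmoothOn O f) (hx : x ∈ O) :
    ∂[ξ] (∂[η] f) x = fderiv ℝ (fderiv ℝ f) x ξ η := by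
  have h : DifferentiableAt ℝ (fderiv ℝ f) x :=
    ((hf.contDiffOn.fderiv_of_isOpen hf.isOpen (m := ∞) (by simp)).contDiffAt
      (hf.isOpen.mem_nhds hx)).differentiableAt (by simp)
  exact dirDeriv_clm (ContinuousLinearMap.apply ℝ F η) h

theorem dirDeriv_dir_smul_add_smul (p q : ℝ) :
    ∂[p • ξ + q • η] f x = p • ∂[ξ] f x + q • ∂[η] f x := by
  simp [dirDeriv]

theorem dirDeriv_comm (hf : SmoothOn O f) (hx : x ∈ O) : ∂[ξ] (∂[η] f) x = ∂[η] (∂[ξ] f) x := by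
  rw [dirDeriv_dirDeriv_apply hf hx, dirDeriv_dirDeriv_apply hf hx]
  exact ((hf.contDiffAt hx).isSymmSndFDerivAt (by
    rw [minSmoothness_of_isRCLikeNormedField]
    exact WithTop.coe_le_coe.2 (le_top (a := (2 : ℕ∞))))).eq ξ η

theorem dirDeriv_dirDeriv_dir_smul_add_smul (hf : SmoothOn O f) (hx : x ∈ O) (p q : ℝ) :
    ∂[p • ξ + q • η] (∂[p • ξ + q • η] f) x
      = p ^ 2 • ∂[ξ] (∂[ξ] f) x + (2 * (p * q)) • ∂[η] (∂[ξ] f) x + q ^ 2 • ∂[η] (∂[η] f) x := by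
  have hcomm := dirDeriv_comm (ξ := ξ) (η := η) hf hx
  simp only [dirDeriv_dirDeriv_apply hf hx] at hcomm ⊢
  simp only [map_add, map_smul, add_apply, smul_apply,
    hcomm]
  module

variable {m s : ℕ} {X Z : P → Fin m → ℝ}

theorem SmoothOn.pinner (hX : SmoothOn O X) (hZ : SmoothOn O Z) :
    SmoothOn O (fun x => pinner m s (X x) (Z x)) :=
  ⟨hX.isOpen, ((pinnerForm m s).toContinuousBilinearMap.contDiff.comp_contDiffOn
    hX.contDiffOn).clm_apply hZ.contDiffOn⟩

theorem dirDeriv_pinner (hX : DifferentiableAt ℝ X x) (hZ : DifferentiableAt ℝ Z x) :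
    ∂[ξ] (fun x => pinner m s (X x) (Z x)) x
      = pinner m s (∂[ξ] X x) (Z x) + pinner m s (X x) (∂[ξ] Z x) := by
  have := ((pinnerForm m s).toContinuousBilinearMap.hasFDerivAt_of_bilinear
    hX.hasFDerivAt hZ.hasFDerivAt).fderiv
  unfold dirDeriv
  rw [add_comm]
  exact congrArg (fun L => L ξ) this

theorem dirDeriv_pinner_const (v : Fin m → ℝ) (hX : DifferentiableAt ℝ X x) :
    ∂[ξ] (fun x => pinner m s v (X x)) x = pinner m s v (∂[ξ] X x) := by
  rw [dirDeriv_pinner (differentiableAt_const v) hX, dirDeriv_const, pinner_zero_left, zero_add]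

theorem dirDeriv_pinner_eq (hX : SmoothOn O X) (hZ : SmoothOn O Z) {g : P → ℝ}
    (h : ∀ x ∈ O, TimelikeSurface.pinner m s (X x) (Z x) = g x) (hx : x ∈ O) :
    TimelikeSurface.pinner m s (∂[ξ] X x) (Z x) + TimelikeSurface.pinner m s (X x) (∂[ξ] Z x)
      = ∂[ξ] g x := by
  rw [← dirDeriv_pinner (hX.differentiableAt hx) (hZ.differentiableAt hx)]
  exact dirDeriv_congr hX.isOpen h hx

theorem dirDeriv_pinner_eq_zero (hX : SmoothOn O X) (hZ : SmoothOn O Z) {r : ℝ}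
    (h : ∀ x ∈ O, TimelikeSurface.pinner m s (X x) (Z x) = r) (hx : x ∈ O) :
    TimelikeSurface.pinner m s (∂[ξ] X x) (Z x) + TimelikeSurface.pinner m s (X x) (∂[ξ] Z x)
      = 0 := by
  rw [dirDeriv_pinner_eq hX hZ h hx, dirDeriv_const]

theorem pinner_dirDeriv_eq_zero (hX : SmoothOn O X) {r : ℝ}
    (h : ∀ x ∈ O, TimelikeSurface.pinner m s (X x) (X x) = r) (hx : x ∈ O) :
    TimelikeSurface.pinner m s (X x) (∂[ξ] X x) = 0 := by
  have := dirDeriv_pinner_eq_zero (ξ := ξ) hX hX h hx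
  rw [pinner_comm (∂[ξ] X x)] at this
  linarith

theorem pinner_dirDeriv_dirDeriv (hX : SmoothOn O X) {r : ℝ}
    (h : ∀ x ∈ O, TimelikeSurface.pinner m s (X x) (X x) = r) (hx : x ∈ O) :
    TimelikeSurface.pinner m s (X x) (∂[η] (∂[ξ] X) x)
      = -TimelikeSurface.pinner m s (∂[η] X x) (∂[ξ] X x) := by
  have := dirDeriv_pinner_eq_zero (ξ := η) hX hX.dirDeriv
    (fun _ => pinner_dirDeriv_eq_zero (ξ := ξ) hX h) hx
  linarith

theorem SmoothOn.det {n : ℕ} {A : P → Fin n → Fin n → ℝ} (hO : IsOpen O)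
    (hA : ∀ i, SmoothOn O (fun x => A x i)) : SmoothOn O (fun x => (Matrix.of (A x)).det) := by
  refine ⟨hO, ?_⟩
  simp only [Matrix.det_apply]
  refine ContDiffOn.sum fun σ _ => ?_
  have h : ContDiffOn ℝ ∞ (fun x => ∏ i, A x (σ i) i) O :=
    contDiffOn_prod fun i _ => contDiffOn_pi.1 (hA (σ i)).contDiffOn i
  simpa [Units.smul_def, zsmul_eq_mul] using contDiffOn_const.mul h

theorem SmoothOn.cross {n : ℕ} {v : P → Fin n → Fin (n + 1) → ℝ} (hO : IsOpen O)
    (hv : ∀ i, SmoothOn O (fun x => v x i)) : SmoothOn O (fun x => cross (v x) s) := by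
  refine ⟨hO, contDiffOn_pi.2 fun i => ?_⟩
  have hminor : SmoothOn O (fun x => ((Matrix.of (v x)).submatrix id i.succAbove).det) :=
    SmoothOn.det (A := fun x j k => v x j (i.succAbove k)) hO fun j =>
      ⟨hO, contDiffOn_pi.2 fun k => contDiffOn_pi.1 (hv j).contDiffOn (i.succAbove k)⟩
  exact ((hminor.const_mul _).const_mul _).contDiffOn

end Derivatives

/-! ### Structure equations in asymptotic coordinates -/

/-- The coefficient of the conformal Hopf differential `Y_aa` in the direction of `E`. -/
def hopf (Y E : E2 → Fin 5 → ℝ) (a : E2) (x : E2) : ℝ := ⟪∂[a] (∂[a] Y) x, E x⟫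

/-- Half of the Schwarzian coefficient of `Y_aa`. -/
def schwarz (Y N : E2 → Fin 5 → ℝ) (a : E2) (x : E2) : ℝ := ⟪∂[a] (∂[a] Y) x, N x⟫

/-- A canonical lift `Y` in asymptotic coordinates with coordinate vectors `a` and `b`, completed
to a null basis by the lightlike vector `N` of `V = Span {Y, Y_a, Y_b, Y_ab}` and the unit normal
vector `E` of `V`. -/
structure NullFrame (O : Set E2) (Y N E : E2 → Fin 5 → ℝ) (a b : E2) : Prop where
  smooth_Y : SmoothOn O Y
  smooth_N : SmoothOn O N
  smooth_E : SmoothOn O E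
  basis : ∀ ⦃x⦄, x ∈ O → IsNullBasis (Y x) (N x) (∂[a] Y x) (∂[b] Y x) (E x)
  EYab : ∀ ⦃x⦄, x ∈ O → ⟪E x, ∂[b] (∂[a] Y) x⟫ = 0

namespace NullFrame

variable {O : Set E2} {Y N E : E2 → Fin 5 → ℝ} {a b x : E2}

theorem isOpen (F : NullFrame O Y N E a b) : IsOpen O := F.smooth_Y.isOpen

theorem mono (F : NullFrame O Y N E a b) {O' : Set E2} (hO' : IsOpen O') (h : O' ⊆ O) :
    NullFrame O' Y N E a b where
  smooth_Y := F.smooth_Y.mono hO' h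
  smooth_N := F.smooth_N.mono hO' h
  smooth_E := F.smooth_E.mono hO' h
  basis _ hx := F.basis (h hx)
  EYab _ hx := F.EYab (h hx)

theorem swap (F : NullFrame O Y N E a b) : NullFrame O Y N E b a where
  smooth_Y := F.smooth_Y
  smooth_N := F.smooth_N
  smooth_E := F.smooth_E
  basis _ hx := (F.basis hx).swap
  EYab _ hx := by rw [dirDeriv_comm F.smooth_Y hx, F.EYab hx]

theorem smooth_Ya (F : NullFrame O Y N E a b) : SmoothOn O (∂[a] Y) := F.smooth_Y.dirDeriv

theorem smooth_Yb (F : NullFrame O Y N E a b) : SmoothOn O (∂[b] Y) := F.smooth_Y.dirDeriv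

theorem smooth_hopf (F : NullFrame O Y N E a b) : SmoothOn O (hopf Y E a) :=
  F.smooth_Ya.dirDeriv.pinner F.smooth_E

theorem smooth_schwarz (F : NullFrame O Y N E a b) : SmoothOn O (schwarz Y N a) :=
  F.smooth_Ya.dirDeriv.pinner F.smooth_N

theorem pinner_Y_Yaa (F : NullFrame O Y N E a b) (hx : x ∈ O) :
    ⟪Y x, ∂[a] (∂[a] Y) x⟫ = 0 := by
  have := dirDeriv_pinner_eq_zero (ξ := a) F.smooth_Y F.smooth_Ya (fun _ hz => (F.basis hz).YA) hx
  rw [(F.basis hx).AA] at this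
  linarith

theorem pinner_Y_Yab (F : NullFrame O Y N E a b) (hx : x ∈ O) :
    ⟪Y x, ∂[b] (∂[a] Y) x⟫ = -1 / 2 := by
  have := dirDeriv_pinner_eq_zero (ξ := b) F.smooth_Y F.smooth_Ya (fun _ hz => (F.basis hz).YA) hx
  rw [pinner_comm (∂[b] Y x), (F.basis hx).AB] at this
  linarith

theorem pinner_Ya_Yaa (F : NullFrame O Y N E a b) (hx : x ∈ O) :
    ⟪∂[a] Y x, ∂[a] (∂[a] Y) x⟫ = 0 := by
  have := dirDeriv_pinner_eq_zero (ξ := a) F.smooth_Ya F.smooth_Ya (fun _ hz => (F.basis hz).AA) hx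
  rw [pinner_comm (∂[a] (∂[a] Y) x)] at this
  linarith

theorem pinner_Ya_Yab (F : NullFrame O Y N E a b) (hx : x ∈ O) :
    ⟪∂[a] Y x, ∂[b] (∂[a] Y) x⟫ = 0 := by
  have := dirDeriv_pinner_eq_zero (ξ := b) F.smooth_Ya F.smooth_Ya (fun _ hz => (F.basis hz).AA) hx
  rw [pinner_comm (∂[b] (∂[a] Y) x)] at this
  linarith

theorem pinner_Yb_Yab (F : NullFrame O Y N E a b) (hx : x ∈ O) :
    ⟪∂[b] Y x, ∂[b] (∂[a] Y) x⟫ = 0 := by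
  rw [dirDeriv_comm F.smooth_Y hx, F.swap.pinner_Ya_Yab hx]

theorem pinner_Yb_Yaa (F : NullFrame O Y N E a b) (hx : x ∈ O) :
    ⟪∂[b] Y x, ∂[a] (∂[a] Y) x⟫ = 0 := by
  have := dirDeriv_pinner_eq_zero (ξ := a) F.smooth_Ya F.smooth_Yb (fun _ hz => (F.basis hz).AB) hx
  rw [dirDeriv_comm (ξ := a) (η := b) F.smooth_Y hx, F.pinner_Ya_Yab hx, pinner_comm] at this
  linarith

theorem Yaa_eq (F : NullFrame O Y N E a b) (hx : x ∈ O) :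
    ∂[a] (∂[a] Y) x = (-schwarz Y N a x) • Y x + hopf Y E a x • E x := by
  have h := (F.basis hx).expand (∂[a] (∂[a] Y) x)
  rw [pinner_comm _ (Y x), pinner_comm _ (∂[b] Y x), pinner_comm _ (∂[a] Y x), F.pinner_Y_Yaa hx,
    F.pinner_Yb_Yaa hx, F.pinner_Ya_Yaa hx] at h
  simpa [schwarz, hopf] using h

theorem Yab_eq_pinner (F : NullFrame O Y N E a b) (hx : x ∈ O) :
    ∂[b] (∂[a] Y) x = (-⟪∂[b] (∂[a] Y) x, N x⟫) • Y x + (1 / 2 : ℝ) • N x := by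
  have h := (F.basis hx).expand (∂[b] (∂[a] Y) x)
  rw [pinner_comm _ (Y x), pinner_comm _ (∂[b] Y x), pinner_comm _ (∂[a] Y x),
    pinner_comm _ (E x), F.pinner_Y_Yab hx, F.pinner_Yb_Yab hx, F.pinner_Ya_Yab hx, F.EYab hx] at h
  have e : (-(-1 / 2) : ℝ) = 1 / 2 := by norm_num
  rw [e] at h
  simpa using h

theorem pinner_Yab_N (F : NullFrame O Y N E a b) (hx : x ∈ O) :
    ⟪∂[b] (∂[a] Y) x, N x⟫ = hopf Y E a x * hopf Y E b x := by
  have hYab := dirDeriv_pinner_eq_zero (ξ := b) F.smooth_Ya F.smooth_Ya.dirDeriv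
    (fun _ => F.pinner_Ya_Yab) hx
  have hYaYbb := dirDeriv_pinner_eq_zero (ξ := a) F.smooth_Ya F.smooth_Yb.dirDeriv
    (fun _ => F.swap.pinner_Yb_Yaa) hx
  have hYbba : ∂[a] (∂[b] (∂[b] Y)) x = ∂[b] (∂[b] (∂[a] Y)) x := by
    rw [dirDeriv_comm F.smooth_Yb hx]
    exact dirDeriv_congr F.isOpen (fun z hz => dirDeriv_comm F.smooth_Y hz) hx
  have hYaaYbb : ⟪∂[a] (∂[a] Y) x, ∂[b] (∂[b] Y) x⟫ = hopf Y E a x * hopf Y E b x := by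
    rw [F.Yaa_eq hx, F.swap.Yaa_eq hx]
    simp only [pinner_add_left, pinner_add_right, pinner_smul_left, pinner_smul_right,
      (F.basis hx).YY, (F.basis hx).EE, (F.basis hx).EY, pinner_comm (Y x) (E x)]
    ring
  have hYabYab : ⟪∂[b] (∂[a] Y) x, ∂[b] (∂[a] Y) x⟫ = ⟪∂[b] (∂[a] Y) x, N x⟫ := by
    nth_rewrite 1 [F.Yab_eq_pinner hx]
    rw [pinner_add_left, pinner_smul_left, pinner_smul_left, F.pinner_Y_Yab hx, pinner_comm (N x)]
    ring
  rw [hYbba, hYaaYbb] at hYaYbb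
  linarith

theorem Yab_eq (F : NullFrame O Y N E a b) (hx : x ∈ O) :
    ∂[b] (∂[a] Y) x = (-(hopf Y E a x * hopf Y E b x)) • Y x + (1 / 2 : ℝ) • N x := by
  have := F.Yab_eq_pinner hx
  rwa [F.pinner_Yab_N hx] at this

theorem pinner_Ea_Y (F : NullFrame O Y N E a b) (hx : x ∈ O) : ⟪∂[a] E x, Y x⟫ = 0 := by
  have := dirDeriv_pinner_eq_zero (ξ := a) F.smooth_E F.smooth_Y (fun _ hz => (F.basis hz).EY) hx
  rw [(F.basis hx).EA] at this
  linarith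

theorem pinner_Ea_Ya (F : NullFrame O Y N E a b) (hx : x ∈ O) :
    ⟪∂[a] E x, ∂[a] Y x⟫ = -hopf Y E a x := by
  have := dirDeriv_pinner_eq_zero (ξ := a) F.smooth_E F.smooth_Ya (fun _ hz => (F.basis hz).EA) hx
  rw [pinner_comm (E x)] at this
  unfold hopf
  linarith

theorem pinner_Ea_Yb (F : NullFrame O Y N E a b) (hx : x ∈ O) :
    ⟪∂[a] E x, ∂[b] Y x⟫ = 0 := by
  have := dirDeriv_pinner_eq_zero (ξ := a) F.smooth_E F.smooth_Yb (fun _ hz => (F.basis hz).EB) hx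
  rw [dirDeriv_comm F.smooth_Y hx, F.EYab hx] at this
  linarith

theorem pinner_Ea_E (F : NullFrame O Y N E a b) (hx : x ∈ O) : ⟪∂[a] E x, E x⟫ = 0 := by
  have := dirDeriv_pinner_eq_zero (ξ := a) F.smooth_E F.smooth_E (fun _ hz => (F.basis hz).EE) hx
  rw [pinner_comm (E x)] at this
  linarith

theorem pinner_Ea_N (F : NullFrame O Y N E a b) (hx : x ∈ O) :
    ⟪∂[a] E x, N x⟫ = -2 * ∂[b] (hopf Y E a) x := by
  have hEYab := dirDeriv_pinner_eq_zero (ξ := a) F.smooth_E F.smooth_Ya.dirDeriv F.EYab hx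
  have hhopf := dirDeriv_pinner (s := 2) (ξ := b)
    ((F.smooth_Ya.dirDeriv (ξ := a)).differentiableAt hx) (F.smooth_E.differentiableAt hx)
  have hYaaEb : ⟪∂[a] (∂[a] Y) x, ∂[b] E x⟫ = 0 := by
    rw [F.Yaa_eq hx, pinner_add_left, pinner_smul_left, pinner_smul_left, pinner_comm (Y x),
      pinner_comm (E x), F.swap.pinner_Ea_Y hx, F.swap.pinner_Ea_E hx]
    ring
  have hEaYab : ⟪∂[a] E x, ∂[b] (∂[a] Y) x⟫ = 1 / 2 * ⟪∂[a] E x, N x⟫ := by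
    rw [F.Yab_eq hx, pinner_add_right, pinner_smul_right, pinner_smul_right, F.pinner_Ea_Y hx]
    ring
  rw [dirDeriv_comm F.smooth_Ya hx, pinner_comm _ (E x), hYaaEb] at hhopf
  rw [hEaYab] at hEYab
  unfold hopf
  linarith

theorem Ea_eq (F : NullFrame O Y N E a b) (hx : x ∈ O) :
    ∂[a] E x = (2 * ∂[b] (hopf Y E a) x) • Y x + (-2 * hopf Y E a x) • ∂[b] Y x := by
  have h := (F.basis hx).expand (∂[a] E x)
  rw [F.pinner_Ea_Y hx, F.pinner_Ea_Ya hx, F.pinner_Ea_Yb hx, F.pinner_Ea_E hx,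
    F.pinner_Ea_N hx] at h
  rw [h]
  module

theorem pinner_Na_Y (F : NullFrame O Y N E a b) (hx : x ∈ O) : ⟪∂[a] N x, Y x⟫ = 0 := by
  have := dirDeriv_pinner_eq_zero (ξ := a) F.smooth_Y F.smooth_N (fun _ hz => (F.basis hz).YN) hx
  rw [pinner_comm (∂[a] Y x), (F.basis hx).NA, pinner_comm] at this
  linarith

theorem pinner_Na_Ya (F : NullFrame O Y N E a b) (hx : x ∈ O) :
    ⟪∂[a] N x, ∂[a] Y x⟫ = -schwarz Y N a x := by
  have := dirDeriv_pinner_eq_zero (ξ := a) F.smooth_N F.smooth_Ya (fun _ hz => (F.basis hz).NA) hx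
  rw [pinner_comm (N x)] at this
  unfold schwarz
  linarith

theorem pinner_Na_Yb (F : NullFrame O Y N E a b) (hx : x ∈ O) :
    ⟪∂[a] N x, ∂[b] Y x⟫ = -(hopf Y E a x * hopf Y E b x) := by
  have := dirDeriv_pinner_eq_zero (ξ := a) F.smooth_N F.smooth_Yb (fun _ hz => (F.basis hz).NB) hx
  rw [pinner_comm (N x), dirDeriv_comm F.smooth_Y hx, F.pinner_Yab_N hx] at this
  linarith

theorem pinner_Na_N (F : NullFrame O Y N E a b) (hx : x ∈ O) : ⟪∂[a] N x, N x⟫ = 0 := by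
  have := dirDeriv_pinner_eq_zero (ξ := a) F.smooth_N F.smooth_N (fun _ hz => (F.basis hz).NN) hx
  rw [pinner_comm (N x)] at this
  linarith

theorem pinner_Na_E (F : NullFrame O Y N E a b) (hx : x ∈ O) :
    ⟪∂[a] N x, E x⟫ = 2 * ∂[b] (hopf Y E a) x := by
  have := dirDeriv_pinner_eq_zero (ξ := a) F.smooth_E F.smooth_N (fun _ hz => (F.basis hz).EN) hx
  rw [F.pinner_Ea_N hx, pinner_comm (E x)] at this
  linarith

theorem Na_eq (F : NullFrame O Y N E a b) (hx : x ∈ O) :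
    ∂[a] N x = (-2 * (hopf Y E a x * hopf Y E b x)) • ∂[a] Y x
      + (-2 * schwarz Y N a x) • ∂[b] Y x + (2 * ∂[b] (hopf Y E a) x) • E x := by
  have h := (F.basis hx).expand (∂[a] N x)
  rw [F.pinner_Na_Y hx, F.pinner_Na_Ya hx, F.pinner_Na_Yb hx, F.pinner_Na_E hx,
    F.pinner_Na_N hx] at h
  rw [h]
  module

theorem pinner_Eab_N (F : NullFrame O Y N E a b) (hx : x ∈ O) :
    ⟪∂[b] (∂[a] E) x, N x⟫
      = -2 * ∂[b] (∂[b] (hopf Y E a)) x - 2 * (schwarz Y N b x * hopf Y E a x) := by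
  have hEaN := dirDeriv_pinner_eq (ξ := b) F.smooth_E.dirDeriv F.smooth_N
    (fun _ => F.pinner_Ea_N) hx
  rw [dirDeriv_const_mul (F.smooth_hopf.dirDeriv.differentiableAt hx)] at hEaN
  have hEaNb : ⟪∂[a] E x, ∂[b] N x⟫ = 2 * (schwarz Y N b x * hopf Y E a x) := by
    rw [F.Ea_eq hx, pinner_add_left, pinner_smul_left, pinner_smul_left, pinner_comm (Y x),
      pinner_comm (∂[b] Y x), F.swap.pinner_Na_Y hx, F.swap.pinner_Na_Ya hx]
    ring
  linarith

theorem codazzi (F : NullFrame O Y N E a b) (hx : x ∈ O) :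
    ∂[b] (∂[b] (hopf Y E a)) x + schwarz Y N b x * hopf Y E a x
      = ∂[a] (∂[a] (hopf Y E b)) x + schwarz Y N a x * hopf Y E b x := by
  have hab := F.pinner_Eab_N hx
  rw [dirDeriv_comm F.smooth_E hx, F.swap.pinner_Eab_N hx] at hab
  linarith

theorem dirDeriv_schwarz (F : NullFrame O Y N E a b) (hx : x ∈ O) :
    ∂[b] (schwarz Y N a) x = 2 * (hopf Y E a x * ∂[a] (hopf Y E b) x)
      + ∂[a] (fun z => hopf Y E a z * hopf Y E b z) x := by
  have hYaaN := dirDeriv_pinner (s := 2) (ξ := b)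
    ((F.smooth_Ya.dirDeriv (ξ := a)).differentiableAt hx) (F.smooth_N.differentiableAt hx)
  have hYabN := dirDeriv_pinner_eq (ξ := a) F.smooth_Ya.dirDeriv F.smooth_N
    (fun _ => F.pinner_Yab_N) hx
  have hYaaNb : ⟪∂[a] (∂[a] Y) x, ∂[b] N x⟫ = 2 * (hopf Y E a x * ∂[a] (hopf Y E b) x) := by
    rw [F.Yaa_eq hx, pinner_add_left, pinner_smul_left, pinner_smul_left, pinner_comm (Y x),
      pinner_comm (E x), F.swap.pinner_Na_Y hx, F.swap.pinner_Na_E hx]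
    ring
  have hYabNa : ⟪∂[b] (∂[a] Y) x, ∂[a] N x⟫ = 0 := by
    rw [F.Yab_eq hx, pinner_add_left, pinner_smul_left, pinner_smul_left, pinner_comm (Y x),
      pinner_comm (N x), F.pinner_Na_Y hx, F.pinner_Na_N hx]
    ring
  rw [dirDeriv_comm F.smooth_Ya hx, hYaaNb] at hYaaN
  rw [hYabNa] at hYabN
  unfold schwarz
  linarith

end NullFrame

/-! ### The parallel vector of an isothermic Willmore surface -/

/-- The vector with `⟨c, Y⟩ = k`, `⟨c, E⟩ = 0` that is constant for isothermic Willmore surfaces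
with conformal Hopf differentials `α k E` and `β k E`, where `γ = α β`. -/
def parallelVec (Y N : E2 → Fin 5 → ℝ) (k : E2 → ℝ) (γ : ℝ) (a b x : E2) : Fin 5 → ℝ :=
  (-(2 * ∂[b] (∂[a] k) x + 2 * γ * k x ^ 3)) • Y x + (2 * ∂[b] k x) • ∂[a] Y x
    + (2 * ∂[a] k x) • ∂[b] Y x + (-k x) • N x

theorem parallelVec_swap {O : Set E2} {Y N : E2 → Fin 5 → ℝ} {a b x : E2} {k : E2 → ℝ}
    (hk : SmoothOn O k) (γ : ℝ) (hx : x ∈ O) :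
    parallelVec Y N k γ a b x = parallelVec Y N k γ b a x := by
  unfold parallelVec
  rw [dirDeriv_comm hk hx]
  module

namespace NullFrame

variable {O : Set E2} {Y N E : E2 → Fin 5 → ℝ} {a b x : E2} {k : E2 → ℝ}

theorem pinner_parallelVec_Y (F : NullFrame O Y N E a b) (γ : ℝ) (hx : x ∈ O) :
    ⟪parallelVec Y N k γ a b x, Y x⟫ = k x := by
  have h := F.basis hx
  unfold parallelVec
  rw [pinner_comm]
  simp only [pinner_add_right, pinner_smul_right, h.YY, h.YA, h.YB, h.YN]
  ring

theorem pinner_parallelVec_Ya (F : NullFrame O Y N E a b) (γ : ℝ) (hx : x ∈ O) :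
    ⟪parallelVec Y N k γ a b x, ∂[a] Y x⟫ = ∂[a] k x := by
  have h := F.basis hx
  unfold parallelVec
  simp only [pinner_add_left, pinner_smul_left, h.YA, h.AA, pinner_comm (∂[b] Y x), h.AB, h.NA]
  ring

theorem pinner_parallelVec_N (F : NullFrame O Y N E a b) (γ : ℝ) (hx : x ∈ O) :
    ⟪parallelVec Y N k γ a b x, N x⟫ = 2 * ∂[b] (∂[a] k) x + 2 * γ * k x ^ 3 := by
  have h := F.basis hx
  unfold parallelVec
  simp only [pinner_add_left, pinner_smul_left, h.YN, h.NN, pinner_comm (∂[b] Y x),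
    pinner_comm (∂[a] Y x), h.NA, h.NB]
  ring

theorem pinner_parallelVec_E (F : NullFrame O Y N E a b) (γ : ℝ) (hx : x ∈ O) :
    ⟪parallelVec Y N k γ a b x, E x⟫ = 0 := by
  have h := F.basis hx
  unfold parallelVec
  rw [pinner_comm]
  simp only [pinner_add_right, pinner_smul_right, h.EY, h.EN, h.EA, h.EB]
  ring

end NullFrame

/-- A null frame in which the conformal Hopf differentials are the multiples `α k E` and `β k E`
of one normal field, with constants `α` and `β`. -/
structure IsothermicFrame (O : Set E2) (Y N E : E2 → Fin 5 → ℝ) (a b : E2) (k : E2 → ℝ)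
    (α β : ℝ) : Prop extends NullFrame O Y N E a b where
  smooth_k : SmoothOn O k
  hopf_a : ∀ ⦃x⦄, x ∈ O → hopf Y E a x = α * k x
  hopf_b : ∀ ⦃x⦄, x ∈ O → hopf Y E b x = β * k x

namespace IsothermicFrame

variable {O : Set E2} {Y N E : E2 → Fin 5 → ℝ} {a b x : E2} {k : E2 → ℝ} {α β : ℝ}

theorem swap (F : IsothermicFrame O Y N E a b k α β) : IsothermicFrame O Y N E b a k β α :=
  ⟨F.toNullFrame.swap, F.smooth_k, F.hopf_b, F.hopf_a⟩

theorem dirDeriv_hopf_a (F : IsothermicFrame O Y N E a b k α β) (ξ : E2) (hx : x ∈ O) :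
    ∂[ξ] (hopf Y E a) x = α * ∂[ξ] k x := by
  rw [dirDeriv_congr F.isOpen F.hopf_a hx, dirDeriv_const_mul (F.smooth_k.differentiableAt hx)]

theorem dirDeriv_schwarz_eq (F : IsothermicFrame O Y N E a b k α β) (hx : x ∈ O) :
    ∂[b] (schwarz Y N a) x = 4 * (α * β) * (k x * ∂[a] k x) := by
  rw [F.dirDeriv_schwarz hx, dirDeriv_mul (F.smooth_hopf.differentiableAt hx)
    (F.toNullFrame.swap.smooth_hopf.differentiableAt hx), F.dirDeriv_hopf_a a hx,
    F.swap.dirDeriv_hopf_a a hx, F.hopf_a hx, F.hopf_b hx]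
  ring

theorem dirDeriv_parallelVec_coeff (F : IsothermicFrame O Y N E a b k α β)
    (hW : ∀ x ∈ O, ∂[a] (∂[a] k) x = -(schwarz Y N a x * k x)) (hx : x ∈ O) :
    ∂[a] (fun x => 2 * ∂[b] (∂[a] k) x + 2 * (α * β) * k x ^ 3) x
      = -2 * schwarz Y N a x * ∂[b] k x - 2 * (α * β) * k x ^ 2 * ∂[a] k x := by
  have hk := F.smooth_k
  have hkaab : ∂[a] (∂[b] (∂[a] k)) x
      = -(schwarz Y N a x * ∂[b] k x + 4 * (α * β) * (k x * ∂[a] k x) * k x) := by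
    rw [dirDeriv_comm hk.dirDeriv hx, dirDeriv_congr F.isOpen hW hx, dirDeriv_neg,
      dirDeriv_mul (F.smooth_schwarz.differentiableAt hx) (hk.differentiableAt hx),
      F.dirDeriv_schwarz_eq hx]
  rw [dirDeriv_add ((hk.dirDeriv.dirDeriv.const_mul 2).differentiableAt hx)
    (((hk.pow 3).const_mul _).differentiableAt hx),
    dirDeriv_const_mul (hk.dirDeriv.dirDeriv.differentiableAt hx),
    dirDeriv_const_mul ((hk.pow 3).differentiableAt hx), hkaab,
    dirDeriv_pow (hk.differentiableAt hx)]
  push_cast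
  ring

theorem dirDeriv_parallelVec (F : IsothermicFrame O Y N E a b k α β)
    (hW : ∀ x ∈ O, ∂[a] (∂[a] k) x = -(schwarz Y N a x * k x)) (hx : x ∈ O) :
    ∂[a] (parallelVec Y N k (α * β) a b) x = 0 := by
  have hk := F.smooth_k
  have hcoeff := (((hk.dirDeriv (ξ := a)).dirDeriv (ξ := b)).const_mul 2).add
    ((hk.pow 3).const_mul (2 * (α * β)))
  have hka := (hk.dirDeriv (ξ := a)).const_mul 2
  have hkb := (hk.dirDeriv (ξ := b)).const_mul 2
  have h₁ := hcoeff.neg.smul F.smooth_Y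
  have h₂ := hkb.smul F.smooth_Ya
  have h₃ := hka.smul F.smooth_Yb
  have h₄ := hk.neg.smul F.smooth_N
  unfold parallelVec
  rw [dirDeriv_add (((h₁.add h₂).add h₃).differentiableAt hx) (h₄.differentiableAt hx),
    dirDeriv_add ((h₁.add h₂).differentiableAt hx) (h₃.differentiableAt hx),
    dirDeriv_add (h₁.differentiableAt hx) (h₂.differentiableAt hx),
    dirDeriv_smul (hcoeff.neg.differentiableAt hx) (F.smooth_Y.differentiableAt hx),
    dirDeriv_smul (hkb.differentiableAt hx) (F.smooth_Ya.differentiableAt hx),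
    dirDeriv_smul (hka.differentiableAt hx) (F.smooth_Yb.differentiableAt hx),
    dirDeriv_smul (hk.neg.differentiableAt hx) (F.smooth_N.differentiableAt hx), dirDeriv_neg,
    dirDeriv_neg, dirDeriv_const_mul (hk.dirDeriv.differentiableAt hx),
    dirDeriv_const_mul (hk.dirDeriv.differentiableAt hx), F.dirDeriv_parallelVec_coeff hW hx,
    F.Na_eq hx, F.Yaa_eq hx, dirDeriv_comm F.smooth_Y hx, F.Yab_eq hx, dirDeriv_comm hk hx,
    F.hopf_a hx, F.hopf_b hx, F.dirDeriv_hopf_a b hx, hW x hx]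
  module

section ConstantVector

variable {v : Fin 5 → ℝ}

theorem mul_pinner_Yb (F : IsothermicFrame O Y N E a b k α β) (hα : α ≠ 0)
    (hv : ∀ x ∈ O, ⟪v, E x⟫ = 0) (hx : x ∈ O) :
    k x * ⟪v, ∂[b] Y x⟫ = ∂[b] k x * ⟪v, Y x⟫ := by
  have hEa : ⟪v, ∂[a] E x⟫ = 0 := by
    rw [← dirDeriv_pinner_const v (F.smooth_E.differentiableAt hx)]
    exact dirDeriv_eq_zero F.isOpen hv hx
  rw [F.Ea_eq hx, pinner_add_right, pinner_smul_right, pinner_smul_right,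
    F.dirDeriv_hopf_a b hx, F.hopf_a hx] at hEa
  exact mul_left_cancel₀ hα (by linarith)

theorem mul_pinner_Yab (F : IsothermicFrame O Y N E a b k α β) (hk : ∀ x ∈ O, k x ≠ 0)
    (hα : α ≠ 0) (hβ : β ≠ 0) (hv : ∀ x ∈ O, ⟪v, E x⟫ = 0) (hx : x ∈ O) :
    k x * ⟪v, ∂[b] (∂[a] Y) x⟫ = ∂[b] (∂[a] k) x * ⟪v, Y x⟫ := by
  have hconst := SmoothOn.const F.isOpen v
  have h := dirDeriv_congr (ξ := b) F.isOpen (fun x hx => F.swap.mul_pinner_Yb hβ hv hx) hx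
  rw [dirDeriv_mul (F.smooth_k.differentiableAt hx)
    ((hconst.pinner F.smooth_Ya).differentiableAt hx),
    dirDeriv_mul (F.smooth_k.dirDeriv.differentiableAt hx)
    ((hconst.pinner F.smooth_Y).differentiableAt hx),
    dirDeriv_pinner_const v (F.smooth_Ya.differentiableAt hx),
    dirDeriv_pinner_const v (F.smooth_Y.differentiableAt hx)] at h
  refine mul_left_cancel₀ (hk x hx) ?_
  linear_combination k x * h - ∂[b] k x * F.swap.mul_pinner_Yb hβ hv hx
    + ∂[a] k x * F.mul_pinner_Yb hα hv hx

theorem eq_smul_parallelVec (F : IsothermicFrame O Y N E a b k α β) (hk : ∀ x ∈ O, k x ≠ 0)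
    (hα : α ≠ 0) (hβ : β ≠ 0) (hv : ∀ x ∈ O, ⟪v, E x⟫ = 0) (hx : x ∈ O) :
    v = (⟪v, Y x⟫ / k x) • parallelVec Y N k (α * β) a b x := by
  have hkx := hk x hx
  have hYab := F.mul_pinner_Yab hk hα hβ hv hx
  rw [F.Yab_eq hx, pinner_add_right, pinner_smul_right, pinner_smul_right, F.hopf_a hx,
    F.hopf_b hx] at hYab
  rw [← sub_eq_zero]
  apply (F.basis hx).isBlockFrame.eq_zero <;> rw [pinner_sub_left, pinner_smul_left]
  · rw [F.pinner_parallelVec_Y _ hx]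
    field_simp
    ring
  · rw [F.pinner_parallelVec_N _ hx]
    field_simp
    linear_combination 2 * hYab
  · rw [F.pinner_parallelVec_Ya _ hx]
    field_simp
    linear_combination F.swap.mul_pinner_Yb hβ hv hx
  · rw [parallelVec_swap F.smooth_k _ hx, F.toNullFrame.swap.pinner_parallelVec_Ya _ hx]
    field_simp
    linear_combination F.mul_pinner_Yb hα hv hx
  · rw [F.pinner_parallelVec_E _ hx, hv x hx, mul_zero, sub_zero]

end ConstantVector

end IsothermicFrame

/-! ### The Willmore density -/

/-- The vectors `(a, b)` and `(c, d)` are lightlike for the quadratic form with the coefficients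
`g₁₁`, `g₁₂`, `g₂₂`, and their scalar product is `1/2`. -/
structure IsNullPair (g₁₁ g₁₂ g₂₂ a b c d : ℝ) : Prop where
  fst_null : g₁₁ * a ^ 2 + 2 * g₁₂ * (a * b) + g₂₂ * b ^ 2 = 0
  snd_null : g₁₁ * c ^ 2 + 2 * g₁₂ * (c * d) + g₂₂ * d ^ 2 = 0
  inner_eq : g₁₁ * (a * c) + g₁₂ * (a * d + b * c) + g₂₂ * (b * d) = 1 / 2

theorem exists_isNullPair {g₁₁ g₁₂ g₂₂ : ℝ} (h : g₁₁ * g₂₂ - g₁₂ ^ 2 < 0) :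
    ∃ a b c d : ℝ, IsNullPair g₁₁ g₁₂ g₂₂ a b c d := by
  by_cases hg : g₁₁ = 0
  · have hg₁₂ : g₁₂ ≠ 0 := by
      rintro rfl
      simp [hg] at h
    refine ⟨1, 0, -g₂₂ / (4 * g₁₂ ^ 2), 1 / (2 * g₁₂), ?_, ?_, ?_⟩ <;> rw [hg] <;>
      field_simp <;> ring
  · obtain ⟨r, hr, hr2⟩ : ∃ r : ℝ, r ≠ 0 ∧ r ^ 2 = g₁₂ ^ 2 - g₁₁ * g₂₂ :=
      ⟨√(g₁₂ ^ 2 - g₁₁ * g₂₂), (Real.sqrt_pos.2 (by linarith)).ne', Real.sq_sqrt (by linarith)⟩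
    have hg₂₂ : g₂₂ = (g₁₂ ^ 2 - r ^ 2) / g₁₁ := by
      field_simp
      linarith
    refine ⟨-g₁₂ + r, g₁₁, (-g₁₂ - r) / (-4 * g₁₁ * r ^ 2), g₁₁ / (-4 * g₁₁ * r ^ 2), ?_, ?_, ?_⟩
      <;> rw [hg₂₂] <;> field_simp <;> ring

/-- The density of the Willmore functional with respect to Lebesgue measure, in terms of the
coefficients of the first fundamental form of a lift and of the second fundamental form in the
direction of a unit normal vector. -/
def willmoreDensity (g₁₁ g₁₂ g₂₂ h₁₁ h₁₂ h₂₂ : ℝ) : ℝ :=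
  (h₁₁ * h₂₂ - h₁₂ ^ 2 + (g₂₂ * h₁₁ - 2 * g₁₂ * h₁₂ + g₁₁ * h₂₂) ^ 2
    / (4 * (g₁₂ ^ 2 - g₁₁ * g₂₂))) / √(g₁₂ ^ 2 - g₁₁ * g₂₂)

theorem willmoreDensity_smul (r g₁₁ g₁₂ g₂₂ h₁₁ h₁₂ h₂₂ : ℝ) :
    willmoreDensity g₁₁ g₁₂ g₂₂ (r * h₁₁) (r * h₁₂) (r * h₂₂)
      = r ^ 2 * willmoreDensity g₁₁ g₁₂ g₂₂ h₁₁ h₁₂ h₂₂ := by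
  unfold willmoreDensity
  ring

namespace IsNullPair

variable {g₁₁ g₁₂ g₂₂ a b c d : ℝ}

theorem fst_mul_det_sq (h : IsNullPair g₁₁ g₁₂ g₂₂ a b c d) :
    g₁₁ * (a * d - b * c) ^ 2 = -(b * d) := by
  linear_combination d ^ 2 * h.fst_null - 2 * b * d * h.inner_eq + b ^ 2 * h.snd_null

theorem snd_mul_det_sq (h : IsNullPair g₁₁ g₁₂ g₂₂ a b c d) :
    g₂₂ * (a * d - b * c) ^ 2 = -(a * c) := by
  linear_combination c ^ 2 * h.fst_null - 2 * a * c * h.inner_eq + a ^ 2 * h.snd_null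

theorem mixed_mul_det_sq (h : IsNullPair g₁₁ g₁₂ g₂₂ a b c d) :
    g₁₂ * (a * d - b * c) ^ 2 = 1 / 2 * (a * d + b * c) := by
  linear_combination -c * d * h.fst_null + (a * d + b * c) * h.inner_eq - a * b * h.snd_null

theorem det_ne_zero (h : IsNullPair g₁₁ g₁₂ g₂₂ a b c d) : a * d - b * c ≠ 0 := by
  intro h0
  have hfst := h.fst_mul_det_sq
  have hsnd := h.snd_mul_det_sq
  have hmixed := h.mixed_mul_det_sq
  have hinner := h.inner_eq
  rw [h0] at hfst hsnd hmixed
  rw [show b * d = 0 by linarith, show a * c = 0 by linarith,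
    show a * d + b * c = 0 by linarith] at hinner
  norm_num at hinner

theorem discrim_mul_det_sq (h : IsNullPair g₁₁ g₁₂ g₂₂ a b c d) :
    (g₁₂ ^ 2 - g₁₁ * g₂₂) * (a * d - b * c) ^ 2 = 1 / 4 := by
  refine mul_right_cancel₀ (pow_ne_zero 2 h.det_ne_zero) ?_
  calc (g₁₂ ^ 2 - g₁₁ * g₂₂) * (a * d - b * c) ^ 2 * (a * d - b * c) ^ 2
      = (g₁₂ * (a * d - b * c) ^ 2) ^ 2
        - (g₁₁ * (a * d - b * c) ^ 2) * (g₂₂ * (a * d - b * c) ^ 2) := by ring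
    _ = 1 / 4 * (a * d - b * c) ^ 2 := by
      rw [h.fst_mul_det_sq, h.snd_mul_det_sq, h.mixed_mul_det_sq]
      ring

theorem willmoreDensity_eq (h : IsNullPair g₁₁ g₁₂ g₂₂ a b c d) (h₁₁ h₁₂ h₂₂ : ℝ) :
    willmoreDensity g₁₁ g₁₂ g₂₂ h₁₁ h₁₂ h₂₂
      = 2 * ((h₁₁ * a ^ 2 + 2 * h₁₂ * (a * b) + h₂₂ * b ^ 2)
        * (h₁₁ * c ^ 2 + 2 * h₁₂ * (c * d) + h₂₂ * d ^ 2)) / |a * d - b * c| := by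
  have hP : |a * d - b * c| ≠ 0 := abs_ne_zero.2 h.det_ne_zero
  have hP2 : |a * d - b * c| ^ 2 = (a * d - b * c) ^ 2 := sq_abs _
  have hD : g₁₂ ^ 2 - g₁₁ * g₂₂ = (1 / (2 * |a * d - b * c|)) ^ 2 := by
    rw [div_pow, mul_pow, hP2, eq_div_iff (mul_ne_zero (by norm_num)
      (pow_ne_zero 2 h.det_ne_zero))]
    linear_combination 4 * h.discrim_mul_det_sq
  have htrace : (g₂₂ * h₁₁ - 2 * g₁₂ * h₁₂ + g₁₁ * h₂₂) * |a * d - b * c| ^ 2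
      = -(h₁₁ * (a * c) + h₁₂ * (a * d + b * c) + h₂₂ * (b * d)) := by
    rw [hP2]
    linear_combination h₁₁ * h.snd_mul_det_sq - 2 * h₁₂ * h.mixed_mul_det_sq
      + h₂₂ * h.fst_mul_det_sq
  unfold willmoreDensity
  rw [hD, Real.sqrt_sq (by positivity)]
  field_simp
  linear_combination 4 * (h₁₁ * h₂₂ - h₁₂ ^ 2) * hP2 + 4 *
    ((g₂₂ * h₁₁ - 2 * g₁₂ * h₁₂ + g₁₁ * h₂₂) * |a * d - b * c| ^ 2
      - (h₁₁ * (a * c) + h₁₂ * (a * d + b * c) + h₂₂ * (b * d))) * htrace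

end IsNullPair

section HopfPair

theorem smul_ex_add_smul_ey_zero (p q : ℝ) : (p • ex + q • ey) 0 = p := by simp [ex, ey]

theorem smul_ex_add_smul_ey_one (p q : ℝ) : (p • ex + q • ey) 1 = q := by simp [ex, ey]

variable {O : Set E2} {Z : E2 → Fin 5 → ℝ} {x ξ η : E2} {n : Fin 5 → ℝ}

/-- The vector `n`, normal to the lift `Z` and its derivatives, corrected by a multiple of `Z` so
that it is also normal to `Z_ξη`. -/
def gaussNormal (Z : E2 → Fin 5 → ℝ) (x ξ η : E2) (n : Fin 5 → ℝ) : Fin 5 → ℝ :=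
  n + (2 * ⟪n, ∂[η] (∂[ξ] Z) x⟫) • Z x

theorem isBlockFrame_gaussNormal (hZ : SmoothOn O Z) (hnull : ∀ x ∈ O, ⟪Z x, Z x⟫ = 0)
    (hx : x ∈ O) (hξ : ⟪∂[ξ] Z x, ∂[ξ] Z x⟫ = 0) (hξη : ⟪∂[ξ] Z x, ∂[η] Z x⟫ = 1 / 2)
    (nn : ⟪n, n⟫ = 1) (nZ : ⟪n, Z x⟫ = 0) (nξ : ⟪n, ∂[ξ] Z x⟫ = 0) (nη : ⟪n, ∂[η] Z x⟫ = 0) :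
    IsBlockFrame (Z x) (∂[η] (∂[ξ] Z) x) (∂[ξ] Z x) (∂[η] Z x) (gaussNormal Z x ξ η n) := by
  have hZξη : ⟪Z x, ∂[η] (∂[ξ] Z) x⟫ = -1 / 2 := by
    rw [pinner_dirDeriv_dirDeriv hZ hnull hx, pinner_comm, hξη]
    norm_num
  have hZD : ∀ ζ, ⟪Z x, ∂[ζ] Z x⟫ = 0 := fun ζ => pinner_dirDeriv_eq_zero hZ hnull hx
  constructor <;> norm_num [gaussNormal, pinner_comm (Z x) n, nn, nZ, nξ, nη, hnull x hx, hZD,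
    hZξη, hξ, hξη]
  ring

theorem isHopfPair_gaussNormal (hZ : SmoothOn O Z) (hnull : ∀ x ∈ O, ⟪Z x, Z x⟫ = 0)
    (hx : x ∈ O) (hξ : ⟪∂[ξ] Z x, ∂[ξ] Z x⟫ = 0) (hη : ⟪∂[η] Z x, ∂[η] Z x⟫ = 0)
    (hξη : ⟪∂[ξ] Z x, ∂[η] Z x⟫ = 1 / 2) (nn : ⟪n, n⟫ = 1) (nZ : ⟪n, Z x⟫ = 0)
    (nξ : ⟪n, ∂[ξ] Z x⟫ = 0) (nη : ⟪n, ∂[η] Z x⟫ = 0) :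
    IsHopfPair Z x ξ η (⟪n, ∂[ξ] (∂[ξ] Z) x⟫ • gaussNormal Z x ξ η n)
      (⟪n, ∂[η] (∂[η] Z) x⟫ • gaussNormal Z x ξ η n) := by
  have hframe := isBlockFrame_gaussNormal hZ hnull hx hξ hξη nn nZ nξ nη
  have hnormal : ∀ r : ℝ, ∀ v ∈ gaussSpace Z x ξ η, ⟪r • gaussNormal Z x ξ η n, v⟫ = 0 := by
    intro r v hv
    have h0 : ⟪gaussNormal Z x ξ η n, v⟫ = 0 := by
      refine pinner_eq_zero_of_mem_span (fun w hw => ?_) hv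
      obtain rfl | rfl | rfl | rfl := hw
      exacts [hframe.ea, hframe.ec, hframe.ed, hframe.eb]
    rw [pinner_smul_left, h0, mul_zero]
  have hmem : ∀ ζ, ⟪∂[ζ] Z x, ∂[ζ] Z x⟫ = 0 →
      ∂[ζ] (∂[ζ] Z) x - ⟪n, ∂[ζ] (∂[ζ] Z) x⟫ • gaussNormal Z x ξ η n ∈ gaussSpace Z x ξ η := by
    refine fun ζ hζ => hframe.mem_span ?_
    rw [pinner_sub_right, pinner_smul_right, hframe.ee, gaussNormal, pinner_add_left,
      pinner_smul_left, pinner_dirDeriv_dirDeriv hZ hnull hx, hζ]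
    ring
  exact ⟨hξ, hη, hξη, hnormal _, hnormal _, hmem ξ hξ, hmem η hη⟩

theorem exists_hopfPair_of_unit (hZ : SmoothOn O Z) (hnull : ∀ x ∈ O, ⟪Z x, Z x⟫ = 0)
    (hx : x ∈ O) (hdet : metricDet 2 Z x < 0) (nn : ⟪n, n⟫ = 1) (nZ : ⟪n, Z x⟫ = 0)
    (nu : ⟪n, ∂[ex] Z x⟫ = 0) (nv : ⟪n, ∂[ey] Z x⟫ = 0) :
    ∃ (ξ η : E2) (κ₁ κ₂ : Fin 5 → ℝ), IsHopfPair Z x ξ η κ₁ κ₂ ∧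
      2 * ⟪κ₁, κ₂⟫ / |ξ 0 * η 1 - ξ 1 * η 0|
        = willmoreDensity ⟪∂[ex] Z x, ∂[ex] Z x⟫ ⟪∂[ex] Z x, ∂[ey] Z x⟫ ⟪∂[ey] Z x, ∂[ey] Z x⟫
          ⟪n, ∂[ex] (∂[ex] Z) x⟫ ⟪n, ∂[ey] (∂[ex] Z) x⟫ ⟪n, ∂[ey] (∂[ey] Z) x⟫ := by
  obtain ⟨a, b, c, d, h⟩ := exists_isNullPair hdet
  change IsNullPair ⟪∂[ex] Z x, ∂[ex] Z x⟫ ⟪∂[ex] Z x, ∂[ey] Z x⟫ ⟪∂[ey] Z x, ∂[ey] Z x⟫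
    a b c d at h
  have hvu : ⟪∂[ey] Z x, ∂[ex] Z x⟫ = ⟪∂[ex] Z x, ∂[ey] Z x⟫ := pinner_comm _ _
  have hmetric : ∀ p q r s : ℝ, ⟪∂[p • ex + q • ey] Z x, ∂[r • ex + s • ey] Z x⟫
      = ⟪∂[ex] Z x, ∂[ex] Z x⟫ * (p * r) + ⟪∂[ex] Z x, ∂[ey] Z x⟫ * (p * s + q * r)
        + ⟪∂[ey] Z x, ∂[ey] Z x⟫ * (q * s) := by
    intro p q r s
    simp only [dirDeriv_dir_smul_add_smul, pinner_add_left, pinner_add_right, pinner_smul_left,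
      pinner_smul_right, hvu]
    ring
  have hnormal : ∀ p q : ℝ, ⟪n, ∂[p • ex + q • ey] Z x⟫ = 0 := fun p q => by
    simp [dirDeriv_dir_smul_add_smul, nu, nv]
  have hξ : ⟪∂[a • ex + b • ey] Z x, ∂[a • ex + b • ey] Z x⟫ = 0 := by
    rw [hmetric]; linear_combination h.fst_null
  have hη : ⟪∂[c • ex + d • ey] Z x, ∂[c • ex + d • ey] Z x⟫ = 0 := by
    rw [hmetric]; linear_combination h.snd_null
  have hξη : ⟪∂[a • ex + b • ey] Z x, ∂[c • ex + d • ey] Z x⟫ = 1 / 2 := by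
    rw [hmetric]; exact h.inner_eq
  refine ⟨a • ex + b • ey, c • ex + d • ey, _, _,
    isHopfPair_gaussNormal hZ hnull hx hξ hη hξη nn nZ (hnormal a b) (hnormal c d), ?_⟩
  rw [h.willmoreDensity_eq, pinner_smul_left, pinner_smul_right,
    (isBlockFrame_gaussNormal hZ hnull hx hξ hξη nn nZ (hnormal a b) (hnormal c d)).ee,
    dirDeriv_dirDeriv_dir_smul_add_smul hZ hx, dirDeriv_dirDeriv_dir_smul_add_smul hZ hx]
  simp only [pinner_add_right, pinner_smul_right, smul_ex_add_smul_ey_zero,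
    smul_ex_add_smul_ey_one]
  congr 1
  ring

theorem exists_hopfPair (hZ : SmoothOn O Z) (hnull : ∀ x ∈ O, ⟪Z x, Z x⟫ = 0) (hx : x ∈ O)
    (hdet : metricDet 2 Z x < 0) (nn : 0 < ⟪n, n⟫) (nZ : ⟪n, Z x⟫ = 0)
    (nu : ⟪n, ∂[ex] Z x⟫ = 0) (nv : ⟪n, ∂[ey] Z x⟫ = 0) :
    ∃ (ξ η : E2) (κ₁ κ₂ : Fin 5 → ℝ), IsHopfPair Z x ξ η κ₁ κ₂ ∧
      2 * ⟪κ₁, κ₂⟫ / |ξ 0 * η 1 - ξ 1 * η 0|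
        = willmoreDensity ⟪∂[ex] Z x, ∂[ex] Z x⟫ ⟪∂[ex] Z x, ∂[ey] Z x⟫ ⟪∂[ey] Z x, ∂[ey] Z x⟫
          ⟪n, ∂[ex] (∂[ex] Z) x⟫ ⟪n, ∂[ey] (∂[ex] Z) x⟫ ⟪n, ∂[ey] (∂[ey] Z) x⟫ / ⟪n, n⟫ := by
  have hr : (√⟪n, n⟫)⁻¹ ^ 2 = ⟪n, n⟫⁻¹ := by rw [inv_pow, Real.sq_sqrt nn.le]
  have hunit : ⟪(√⟪n, n⟫)⁻¹ • n, (√⟪n, n⟫)⁻¹ • n⟫ = 1 := by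
    rw [pinner_smul_smul, hr, inv_mul_cancel₀ nn.ne']
  obtain ⟨ξ, η, κ₁, κ₂, hκ, hW⟩ := exists_hopfPair_of_unit hZ hnull hx hdet hunit
    (by simp [nZ]) (by simp [nu]) (by simp [nv])
  refine ⟨ξ, η, κ₁, κ₂, hκ, ?_⟩
  simp only [pinner_smul_left] at hW
  rw [hW, willmoreDensity_smul, hr, div_eq_inv_mul]

end HopfPair

/-! ### Normal variations -/

section Slices

variable {F : Type*} [NormedAddCommGroup F] [NormedSpace ℝ F] {I : Set ℝ} {O : Set E2}
  {Φ : ℝ × E2 → F} {f : E2 → F} {t : ℝ} {x ξ η : E2}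

theorem SmoothOn.comp_snd (hI : IsOpen I) (hf : SmoothOn O f) :
    SmoothOn (I ×ˢ O) (fun p => f p.2) :=
  ⟨hI.prod hf.isOpen, hf.contDiffOn.comp contDiff_snd.contDiffOn fun _ hp => hp.2⟩

theorem SmoothOn.slice (hΦ : SmoothOn (I ×ˢ O) Φ) (hO : IsOpen O) (ht : t ∈ I) :
    SmoothOn O (fun z => Φ (t, z)) :=
  ⟨hO, hΦ.contDiffOn.comp (contDiff_prodMk_right t).contDiffOn fun _ hz => ⟨ht, hz⟩⟩

theorem dirDeriv_slice (hΦ : SmoothOn (I ×ˢ O) Φ) (ht : t ∈ I) (hx : x ∈ O) :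
    ∂[ξ] (fun z => Φ (t, z)) x = ∂[(0, ξ)] Φ (t, x) := by
  have hprod : HasFDerivAt (fun z : E2 => (t, z)) (ContinuousLinearMap.inr ℝ ℝ E2) x :=
    hasFDerivAt_prodMk_right t x
  have hcomp := (hΦ.differentiableAt (x := (t, x)) ⟨ht, hx⟩).hasFDerivAt.comp x hprod
  exact congrArg (fun L => L ξ) hcomp.fderiv

theorem dirDeriv_dirDeriv_slice (hΦ : SmoothOn (I ×ˢ O) Φ) (hO : IsOpen O) (ht : t ∈ I)
    (hx : x ∈ O) :
    ∂[η] (∂[ξ] (fun z => Φ (t, z))) x = ∂[(0, η)] (∂[(0, ξ)] Φ) (t, x) := by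
  rw [dirDeriv_congr hO (fun z hz => dirDeriv_slice hΦ ht hz) hx,
    dirDeriv_slice hΦ.dirDeriv ht hx]

theorem hasDerivAt_slice (hΦ : SmoothOn (I ×ˢ O) Φ) (ht : t ∈ I) (hx : x ∈ O) :
    HasDerivAt (fun s => Φ (s, x)) (∂[(1, 0)] Φ (t, x)) t := by
  have hprod : HasFDerivAt (fun s : ℝ => (s, x)) (ContinuousLinearMap.inl ℝ ℝ E2) t :=
    hasFDerivAt_prodMk_left t x
  have hcomp := ((hΦ.differentiableAt (x := (t, x)) ⟨ht, hx⟩).hasFDerivAt.comp t hprod).hasDerivAt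
  simpa only [Function.comp_def, ContinuousLinearMap.comp_apply, ContinuousLinearMap.inl_apply,
    dirDeriv] using hcomp

theorem hasDerivAt_setIntegral {K : Set E2} {ε : ℝ} (hε : 0 < ε) {w : ℝ × E2 → ℝ}
    (hw : SmoothOn (Set.Ioo (-ε) ε ×ˢ O) w) (hO : IsOpen O) (hK : IsCompact K) (hKO : K ⊆ O) :
    HasDerivAt (fun t => ∫ x in K, w (t, x)) (∫ x in K, ∂[(1, 0)] w (0, x)) 0 := by
  have hsub : Set.Icc (-(ε / 2)) (ε / 2) ⊆ Set.Ioo (-ε) ε := fun t ht =>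
    ⟨by linarith [ht.1], by linarith [ht.2]⟩
  have h0 : (0 : ℝ) ∈ Set.Ioo (-ε) ε := ⟨by linarith, hε⟩
  obtain ⟨C, hC⟩ := (isCompact_Icc.prod hK).exists_bound_of_continuousOn
    ((hw.dirDeriv (ξ := ((1 : ℝ), (0 : E2)))).continuousOn.mono (Set.prod_mono hsub hKO))
  have hcont : ∀ t ∈ Set.Ioo (-ε) ε, ContinuousOn (fun x => w (t, x)) K := fun t ht =>
    (hw.slice hO ht).continuousOn.mono hKO
  refine (hasDerivAt_integral_of_dominated_loc_of_deriv_le (μ := volume.restrict K)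
    (F := fun t x => w (t, x)) (F' := fun t x => ∂[(1, 0)] w (t, x))
    (s := Set.Ioo (-(ε / 2)) (ε / 2)) (bound := fun _ => C)
    (Ioo_mem_nhds (by linarith) (by linarith)) ?_ ?_ ?_ ?_ ?_ ?_).2
  · filter_upwards [Ioo_mem_nhds h0.1 h0.2] with t ht
    exact (hcont t ht).aestronglyMeasurable hK.measurableSet
  · exact (hcont 0 h0).integrableOn_compact hK
  · exact ((hw.dirDeriv.slice hO h0).continuousOn.mono hKO).aestronglyMeasurable hK.measurableSet
  · filter_upwards [ae_restrict_mem hK.measurableSet] with x hx t ht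
    exact hC (t, x) ⟨⟨ht.1.le, ht.2.le⟩, hx⟩
  · exact continuousOn_const.integrableOn_compact hK
  · filter_upwards [ae_restrict_mem hK.measurableSet] with x hx t ht
    exact hasDerivAt_slice hw (hsub ⟨ht.1.le, ht.2.le⟩) (hKO hx)

end Slices

theorem hasDerivAt_willmoreDensity_div {g₁₁ g₁₂ g₂₂ h₁₁ h₁₂ h₂₂ : ℝ → ℝ}
    {g₁₁' g₂₂' h₁₁' h₁₂' h₂₂' t : ℝ} (dg₁₁ : HasDerivAt g₁₁ g₁₁' t) (dg₁₂ : HasDerivAt g₁₂ 0 t)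
    (dg₂₂ : HasDerivAt g₂₂ g₂₂' t) (dh₁₁ : HasDerivAt h₁₁ h₁₁' t) (dh₁₂ : HasDerivAt h₁₂ h₁₂' t)
    (dh₂₂ : HasDerivAt h₂₂ h₂₂' t) (hg₁₁ : g₁₁ t = 0) (hg₁₂ : g₁₂ t = 1 / 2) (hg₂₂ : g₂₂ t = 0)
    (hh₁₂ : h₁₂ t = 0) :
    HasDerivAt (fun s => willmoreDensity (g₁₁ s) (g₁₂ s) (g₂₂ s) (h₁₁ s) (h₁₂ s) (h₂₂ s)
        / (g₁₂ s ^ 2 - g₁₁ s * g₂₂ s))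
      (8 * (h₁₁' * h₂₂ t + h₁₁ t * h₂₂')) t := by
  have dD : HasDerivAt (fun s => g₁₂ s ^ 2 - g₁₁ s * g₂₂ s) 0 t :=
    ((dg₁₂.fun_pow 2).fun_sub (dg₁₁.fun_mul dg₂₂)).congr_deriv (by rw [hg₁₁, hg₂₂]; ring)
  have hD : g₁₂ t ^ 2 - g₁₁ t * g₂₂ t = 1 / 4 := by rw [hg₁₁, hg₁₂]; norm_num
  have hsqrt : √(1 / 4 : ℝ) = 1 / 2 := by
    rw [show (1 / 4 : ℝ) = (1 / 2) ^ 2 by norm_num]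
    exact Real.sqrt_sq (by norm_num)
  have dT := ((dg₂₂.fun_mul dh₁₁).fun_sub ((dg₁₂.const_mul 2).fun_mul dh₁₂)).fun_add
    (dg₁₁.fun_mul dh₂₂)
  have dnum := ((dh₁₁.fun_mul dh₂₂).fun_sub (dh₁₂.fun_pow 2)).fun_add
    ((dT.fun_pow 2).fun_div (dD.const_mul 4) (by rw [hD]; norm_num))
  refine ((dnum.fun_div (dD.sqrt (by rw [hD]; norm_num)) (by rw [hD, hsqrt]; norm_num)).fun_div
    dD (by rw [hD]; norm_num)).congr_deriv ?_
  rw [hD, hsqrt, hg₁₁, hg₂₂, hh₁₂]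
  ring

/-- The normal variation `Y + t f E + t² f² / 2 N`, which stays in the light cone. -/
def variation (Y N E : E2 → Fin 5 → ℝ) (f : E2 → ℝ) (p : ℝ × E2) : Fin 5 → ℝ :=
  Y p.2 + ((p.1 * f p.2) • E p.2 + (p.1 ^ 2 * (f p.2 ^ 2 / 2)) • N p.2)

/-- A normal vector of the variation, whose square is `negDet`. -/
def variationNormal (Y N E : E2 → Fin 5 → ℝ) (f : E2 → ℝ) (a b : E2) (p : ℝ × E2) :
    Fin 5 → ℝ :=
  cross ![variation Y N E f p, N p.2, ∂[(0, a)] (variation Y N E f) p,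
    ∂[(0, b)] (variation Y N E f) p] 2

/-- The metric coefficients of a family of surfaces. -/
def metricCoeff (Z : ℝ × E2 → Fin 5 → ℝ) (ξ η : E2) (p : ℝ × E2) : ℝ :=
  ⟪∂[(0, ξ)] Z p, ∂[(0, η)] Z p⟫

/-- The negative of the determinant of the metric of a family of surfaces. -/
def negDet (Z : ℝ × E2 → Fin 5 → ℝ) (a b : E2) (p : ℝ × E2) : ℝ :=
  metricCoeff Z a b p ^ 2 - metricCoeff Z a a p * metricCoeff Z b b p

/-- The coefficients of the second fundamental form with respect to `variationNormal`. -/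
def secondCoeff (Y N E : E2 → Fin 5 → ℝ) (f : E2 → ℝ) (a b ξ η : E2) (p : ℝ × E2) : ℝ :=
  ⟪variationNormal Y N E f a b p, ∂[(0, η)] (∂[(0, ξ)] (variation Y N E f)) p⟫

/-- The Willmore density of the variation. The division by `negDet` accounts for the length of
`variationNormal`. -/
def variationDensity (Y N E : E2 → Fin 5 → ℝ) (f : E2 → ℝ) (a b : E2) (p : ℝ × E2) : ℝ :=
  willmoreDensity (metricCoeff (variation Y N E f) a a p) (metricCoeff (variation Y N E f) a b p)
      (metricCoeff (variation Y N E f) b b p) (secondCoeff Y N E f a b a a p)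
      (secondCoeff Y N E f a b a b p) (secondCoeff Y N E f a b b b p)
    / negDet (variation Y N E f) a b p

theorem variation_zero (Y N E : E2 → Fin 5 → ℝ) (f : E2 → ℝ) (x : E2) :
    variation Y N E f (0, x) = Y x := by
  simp [variation]

namespace NullFrame

variable {O : Set E2} {Y N E : E2 → Fin 5 → ℝ} {a b x ξ η : E2} {f : E2 → ℝ} {I : Set ℝ} {t : ℝ}

section Smoothness

variable (F : NullFrame O Y N E a b) (hf : SmoothOn O f) (hI : IsOpen I)
include F hf hI

theorem smooth_variation : SmoothOn (I ×ˢ O) (variation Y N E f) := by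
  have ht : SmoothOn (I ×ˢ O) (fun p => p.1) := ⟨hI.prod F.isOpen, contDiff_fst.contDiffOn⟩
  have hf' := SmoothOn.comp_snd hI hf
  have htf : SmoothOn (I ×ˢ O) (fun p => p.1 ^ 2 * (f p.2 ^ 2 / 2)) :=
    ((ht.pow 2).mul ((hf'.pow 2).const_mul (1 / 2))).congr fun p _ => by ring
  exact (SmoothOn.comp_snd hI F.smooth_Y).add
    (((ht.mul hf').smul (SmoothOn.comp_snd hI F.smooth_E)).add
      (htf.smul (SmoothOn.comp_snd hI F.smooth_N)))

theorem smooth_metricCoeff : SmoothOn (I ×ˢ O) (metricCoeff (variation Y N E f) ξ η) :=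
  (F.smooth_variation hf hI).dirDeriv.pinner (F.smooth_variation hf hI).dirDeriv

theorem smooth_negDet : SmoothOn (I ×ˢ O) (negDet (variation Y N E f) a b) :=
  ((F.smooth_metricCoeff hf hI).pow 2).sub
    ((F.smooth_metricCoeff hf hI).mul (F.smooth_metricCoeff hf hI))

theorem smooth_variationNormal : SmoothOn (I ×ˢ O) (variationNormal Y N E f a b) :=
  SmoothOn.cross (hI.prod F.isOpen) <| Fin.forall_fin_succ.2 ⟨F.smooth_variation hf hI,
    Fin.forall_fin_succ.2 ⟨SmoothOn.comp_snd hI F.smooth_N, Fin.forall_fin_two.2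
      ⟨(F.smooth_variation hf hI).dirDeriv, (F.smooth_variation hf hI).dirDeriv⟩⟩⟩

theorem smooth_secondCoeff : SmoothOn (I ×ˢ O) (secondCoeff Y N E f a b ξ η) :=
  (F.smooth_variationNormal hf hI).pinner (F.smooth_variation hf hI).dirDeriv.dirDeriv

theorem smooth_variationDensity (hD : ∀ p ∈ I ×ˢ O, 0 < negDet (variation Y N E f) a b p) :
    SmoothOn (I ×ˢ O) (variationDensity Y N E f a b) := by
  have hg (ξ η : E2) := F.smooth_metricCoeff (ξ := ξ) (η := η) hf hI
  have hh (ξ η : E2) := F.smooth_secondCoeff (ξ := ξ) (η := η) hf hI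
  have hneg := F.smooth_negDet hf hI
  have htrace := (((hg b b).mul (hh a a)).sub (((hg a b).const_mul 2).mul (hh a b))).add
    ((hg a a).mul (hh b b))
  exact (((((hh a a).mul (hh b b)).sub ((hh a b).pow 2)).add ((htrace.pow 2).div
    (hneg.const_mul 4) fun p hp => (mul_pos four_pos (hD p hp)).ne')).div
    (hneg.sqrt fun p hp => (hD p hp).ne') fun p hp => (Real.sqrt_pos.2 (hD p hp)).ne').div
    hneg fun p hp => (hD p hp).ne'

end Smoothness

section LightCone

variable (F : NullFrame O Y N E a b)
include F

theorem pinner_variation_self (hx : x ∈ O) :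
    ⟪variation Y N E f (t, x), variation Y N E f (t, x)⟫ = 0 := by
  have B := F.basis hx
  simp only [variation, pinner_add_left, pinner_add_right, pinner_smul_left, pinner_smul_right,
    B.YY, B.EE, B.EY, B.EN, B.YN, B.NN, pinner_comm (Y x) (E x), pinner_comm (N x) (Y x),
    pinner_comm (N x) (E x)]
  ring

theorem pinner_variation_N (hx : x ∈ O) : ⟪variation Y N E f (t, x), N x⟫ = -1 := by
  have B := F.basis hx
  simp only [variation, pinner_add_left, pinner_smul_left, B.EN, B.YN, B.NN]
  ring

theorem pinner_variation_dirDeriv (hf : SmoothOn O f) (hx : x ∈ O) :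
    ⟪variation Y N E f (t, x), ∂[(0, ξ)] (variation Y N E f) (t, x)⟫ = 0 :=
  pinner_dirDeriv_eq_zero (F.smooth_variation hf isOpen_univ)
    (fun _ hp => F.pinner_variation_self hp.2) ⟨Set.mem_univ t, hx⟩

theorem pinner_variationNormal_self (hf : SmoothOn O f) (hx : x ∈ O) :
    ⟪variationNormal Y N E f a b (t, x), variationNormal Y N E f a b (t, x)⟫
      = negDet (variation Y N E f) a b (t, x) := by
  unfold variationNormal negDet metricCoeff
  rw [pinner_cross_self_four (F.pinner_variation_self hx) (F.pinner_variation_dirDeriv hf hx)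
    (F.pinner_variation_dirDeriv hf hx), F.pinner_variation_N hx]
  ring

end LightCone

section AtZero

variable (F : NullFrame O Y N E a b) (hf : SmoothOn O f) (hx : x ∈ O)
include F hf hx

theorem dirDeriv_variation_zero : ∂[(0, ξ)] (variation Y N E f) (0, x) = ∂[ξ] Y x := by
  rw [← dirDeriv_slice (F.smooth_variation hf isOpen_univ) (Set.mem_univ 0) hx]
  simp only [variation_zero]

theorem dirDeriv_dirDeriv_variation_zero :
    ∂[(0, η)] (∂[(0, ξ)] (variation Y N E f)) (0, x) = ∂[η] (∂[ξ] Y) x := by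
  rw [← dirDeriv_dirDeriv_slice (F.smooth_variation hf isOpen_univ) F.isOpen (Set.mem_univ 0) hx]
  simp only [variation_zero]

theorem dt_variation : ∂[(1, 0)] (variation Y N E f) (0, x) = f x • E x := by
  have hE : HasDerivAt (fun s : ℝ => (s * f x) • E x) ((1 * f x) • E x) 0 :=
    ((hasDerivAt_id (0 : ℝ)).mul_const (f x)).smul_const (E x)
  have hN : HasDerivAt (fun s : ℝ => (s ^ 2 * (f x ^ 2 / 2)) • N x)
      ((((2 : ℕ) : ℝ) * 0 ^ (2 - 1) * (f x ^ 2 / 2)) • N x) 0 :=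
    ((hasDerivAt_pow 2 (0 : ℝ)).mul_const (f x ^ 2 / 2)).smul_const (N x)
  refine (hasDerivAt_slice (F.smooth_variation hf isOpen_univ) (Set.mem_univ 0) hx).unique ?_
  simpa [variation] using (hE.add hN).const_add (Y x)

theorem dt_dirDeriv_variation :
    ∂[(1, 0)] (∂[(0, ξ)] (variation Y N E f)) (0, x) = ∂[ξ] (fun z => f z • E z) x := by
  have hvar := F.smooth_variation hf isOpen_univ
  rw [dirDeriv_comm hvar ⟨Set.mem_univ 0, hx⟩, ← dirDeriv_slice hvar.dirDeriv (Set.mem_univ 0) hx]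
  exact dirDeriv_congr F.isOpen (fun z hz => F.dt_variation hf hz) hx

theorem dt_dirDeriv_dirDeriv_variation :
    ∂[(1, 0)] (∂[(0, η)] (∂[(0, ξ)] (variation Y N E f))) (0, x)
      = ∂[η] (∂[ξ] (fun z => f z • E z)) x := by
  have hvar := F.smooth_variation hf isOpen_univ
  rw [dirDeriv_comm hvar.dirDeriv ⟨Set.mem_univ 0, hx⟩,
    ← dirDeriv_slice hvar.dirDeriv.dirDeriv (Set.mem_univ 0) hx]
  exact dirDeriv_congr F.isOpen (fun z hz => F.dt_dirDeriv_variation hf hz) hx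

theorem pinner_E_dirDeriv_dirDeriv_smul_E :
    ⟪E x, ∂[a] (∂[a] (fun z => f z • E z)) x⟫ = ∂[a] (∂[a] f) x := by
  have hdE : SmoothOn O (∂[a] E) := F.smooth_E.dirDeriv
  have hEaEa : ⟪∂[a] E x, ∂[a] E x⟫ = 0 := by
    nth_rewrite 2 [F.Ea_eq hx]
    rw [pinner_add_right, pinner_smul_right, pinner_smul_right, F.pinner_Ea_Y hx,
      F.pinner_Ea_Yb hx, mul_zero, mul_zero, add_zero]
  have hEEaa : ⟪E x, ∂[a] (∂[a] E) x⟫ = 0 := by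
    rw [pinner_dirDeriv_dirDeriv F.smooth_E (fun _ hz => (F.basis hz).EE) hx, hEaEa, neg_zero]
  have hfirst : ∀ z ∈ O, ∂[a] (fun z => f z • E z) z = f z • ∂[a] E z + ∂[a] f z • E z :=
    fun z hz => dirDeriv_smul (hf.differentiableAt hz) (F.smooth_E.differentiableAt hz)
  rw [dirDeriv_congr F.isOpen hfirst hx,
    dirDeriv_add ((hf.smul hdE).differentiableAt hx)
      ((hf.dirDeriv.smul F.smooth_E).differentiableAt hx),
    dirDeriv_smul (hf.differentiableAt hx) (hdE.differentiableAt hx),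
    dirDeriv_smul (hf.dirDeriv.differentiableAt hx) (F.smooth_E.differentiableAt hx)]
  simp only [pinner_add_right, pinner_smul_right, hEEaa, (F.basis hx).EE,
    pinner_comm (E x) (∂[a] E x), F.pinner_Ea_E hx]
  ring

theorem metricCoeff_zero : metricCoeff (variation Y N E f) ξ η (0, x) = ⟪∂[ξ] Y x, ∂[η] Y x⟫ := by
  unfold metricCoeff
  rw [F.dirDeriv_variation_zero hf hx, F.dirDeriv_variation_zero hf hx]

theorem negDet_zero : negDet (variation Y N E f) a b (0, x) = 1 / 4 := by
  unfold negDet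
  rw [F.metricCoeff_zero hf hx, F.metricCoeff_zero hf hx, (F.basis hx).AB, (F.basis hx).AA]
  norm_num

theorem dt_metricCoeff : ∂[(1, 0)] (metricCoeff (variation Y N E f) a b) (0, x) = 0 := by
  have hd (ξ : ℝ × E2) := ((F.smooth_variation hf isOpen_univ).dirDeriv (ξ := ξ)).differentiableAt
    (x := (0, x)) ⟨Set.mem_univ 0, hx⟩
  have hfE (ξ : E2) : ∂[ξ] (fun z => f z • E z) x = f x • ∂[ξ] E x + ∂[ξ] f x • E x :=
    dirDeriv_smul (hf.differentiableAt hx) (F.smooth_E.differentiableAt hx)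
  unfold metricCoeff
  rw [dirDeriv_pinner (hd _) (hd _), F.dt_dirDeriv_variation hf hx, F.dt_dirDeriv_variation hf hx,
    F.dirDeriv_variation_zero hf hx, F.dirDeriv_variation_zero hf hx, hfE, hfE]
  simp only [pinner_add_left, pinner_smul_left, pinner_comm (∂[a] Y x), (F.basis hx).EA,
    (F.basis hx).EB, F.pinner_Ea_Yb hx, F.swap.pinner_Ea_Yb hx]
  ring

theorem dt_negDet : ∂[(1, 0)] (negDet (variation Y N E f) a b) (0, x) = 0 := by
  have hp : ((0 : ℝ), x) ∈ (Set.univ : Set ℝ) ×ˢ O := ⟨Set.mem_univ 0, hx⟩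
  have hg (ξ η : E2) := F.smooth_metricCoeff (ξ := ξ) (η := η) hf isOpen_univ
  unfold negDet
  rw [dirDeriv_sub (((hg a b).pow 2).differentiableAt hp)
      (((hg a a).mul (hg b b)).differentiableAt hp),
    dirDeriv_pow ((hg a b).differentiableAt hp),
    dirDeriv_mul ((hg a a).differentiableAt hp) ((hg b b).differentiableAt hp),
    F.dt_metricCoeff hf hx, F.metricCoeff_zero hf hx, F.metricCoeff_zero hf hx,
    F.metricCoeff_zero hf hx, (F.basis hx).AA, (F.basis hx).BB]
  ring

theorem variationNormal_zero : variationNormal Y N E f a b (0, x)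
    = ⟪variationNormal Y N E f a b (0, x), E x⟫ • E x := by
  have h := pinner_cross_apply (s := 2) ![variation Y N E f (0, x), N x,
    ∂[(0, a)] (variation Y N E f) (0, x), ∂[(0, b)] (variation Y N E f) (0, x)]
  refine (F.basis hx).isBlockFrame.eq_smul ?_ (h 1) ?_ ?_
  · rw [← variation_zero Y N E f x]
    exact h 0
  · rw [← F.dirDeriv_variation_zero hf hx]
    exact h 2
  · rw [← F.dirDeriv_variation_zero hf hx]
    exact h 3

theorem pinner_variationNormal_E_sq :
    ⟪variationNormal Y N E f a b (0, x), E x⟫ ^ 2 = 1 / 4 := by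
  have h := F.pinner_variationNormal_self (t := 0) hf hx
  rw [F.negDet_zero hf hx, F.variationNormal_zero hf hx, pinner_smul_left, pinner_smul_right,
    (F.basis hx).EE] at h
  linarith

theorem pinner_dt_variationNormal_Y : ⟪∂[(1, 0)] (variationNormal Y N E f a b) (0, x), Y x⟫
    = -(⟪variationNormal Y N E f a b (0, x), E x⟫ * f x) := by
  have h := dirDeriv_pinner_eq_zero (s := 2) (ξ := ((1 : ℝ), (0 : E2)))
    (F.smooth_variationNormal hf isOpen_univ) (F.smooth_variation hf isOpen_univ)
    (fun _ _ => pinner_cross_apply _ 0) (x := (0, x)) ⟨Set.mem_univ 0, hx⟩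
  rw [F.dt_variation hf hx, variation_zero, pinner_smul_right] at h
  linarith

theorem pinner_dt_variationNormal_E :
    ⟪∂[(1, 0)] (variationNormal Y N E f a b) (0, x), E x⟫ = 0 := by
  have hsmooth := F.smooth_variationNormal hf isOpen_univ
  have h := dirDeriv_pinner_eq (ξ := ((1 : ℝ), (0 : E2))) hsmooth hsmooth
    (fun p hp => F.pinner_variationNormal_self (t := p.1) hf hp.2)
    (x := (0, x)) ⟨Set.mem_univ 0, hx⟩
  rw [F.dt_negDet hf hx, pinner_comm (variationNormal _ _ _ _ _ _ _),
    F.variationNormal_zero hf hx, pinner_smul_right] at h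
  have hsq := F.pinner_variationNormal_E_sq hf hx
  refine (mul_eq_zero.1 (by linarith : ⟪variationNormal Y N E f a b (0, x), E x⟫
    * ⟪∂[(1, 0)] (variationNormal Y N E f a b) (0, x), E x⟫ = 0)).resolve_left fun h0 => ?_
  norm_num [h0] at hsq

theorem secondCoeff_zero : secondCoeff Y N E f a b ξ η (0, x)
    = ⟪variationNormal Y N E f a b (0, x), E x⟫ * ⟪E x, ∂[η] (∂[ξ] Y) x⟫ := by
  unfold secondCoeff
  rw [F.dirDeriv_dirDeriv_variation_zero hf hx, F.variationNormal_zero hf hx, pinner_smul_left,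
    pinner_smul_left, (F.basis hx).EE, mul_one]

theorem secondCoeff_self_zero : secondCoeff Y N E f a b ξ ξ (0, x)
    = ⟪variationNormal Y N E f a b (0, x), E x⟫ * hopf Y E ξ x := by
  rw [F.secondCoeff_zero hf hx, pinner_comm (E x), hopf]

theorem dt_secondCoeff : ∂[(1, 0)] (secondCoeff Y N E f a b ξ η) (0, x)
    = ⟪∂[(1, 0)] (variationNormal Y N E f a b) (0, x), ∂[η] (∂[ξ] Y) x⟫
      + ⟪variationNormal Y N E f a b (0, x), E x⟫
        * ⟪E x, ∂[η] (∂[ξ] (fun z => f z • E z)) x⟫ := by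
  have hp : ((0 : ℝ), x) ∈ (Set.univ : Set ℝ) ×ˢ O := ⟨Set.mem_univ 0, hx⟩
  unfold secondCoeff
  rw [dirDeriv_pinner ((F.smooth_variationNormal hf isOpen_univ).differentiableAt hp)
      ((F.smooth_variation hf isOpen_univ).dirDeriv.dirDeriv.differentiableAt hp),
    F.dt_dirDeriv_dirDeriv_variation hf hx, F.dirDeriv_dirDeriv_variation_zero hf hx,
    ← pinner_smul_left _ (E x), ← F.variationNormal_zero hf hx]

theorem dt_secondCoeff_fst : ∂[(1, 0)] (secondCoeff Y N E f a b a a) (0, x)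
    = ⟪variationNormal Y N E f a b (0, x), E x⟫
      * (∂[a] (∂[a] f) x + schwarz Y N a x * f x) := by
  rw [F.dt_secondCoeff hf hx, F.pinner_E_dirDeriv_dirDeriv_smul_E hf hx, F.Yaa_eq hx,
    pinner_add_right, pinner_smul_right, pinner_smul_right, F.pinner_dt_variationNormal_Y hf hx,
    F.pinner_dt_variationNormal_E hf hx]
  ring

theorem dt_secondCoeff_snd : ∂[(1, 0)] (secondCoeff Y N E f a b b b) (0, x)
    = ⟪variationNormal Y N E f a b (0, x), E x⟫
      * (∂[b] (∂[b] f) x + schwarz Y N b x * f x) := by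
  rw [F.dt_secondCoeff hf hx, F.swap.pinner_E_dirDeriv_dirDeriv_smul_E hf hx, F.swap.Yaa_eq hx,
    pinner_add_right, pinner_smul_right, pinner_smul_right, F.pinner_dt_variationNormal_Y hf hx,
    F.pinner_dt_variationNormal_E hf hx]
  ring

theorem hasDerivAt_variationDensity :
    HasDerivAt (fun t => variationDensity Y N E f a b (t, x))
      (2 * (hopf Y E a x * (∂[b] (∂[b] f) x + schwarz Y N b x * f x)
        + hopf Y E b x * (∂[a] (∂[a] f) x + schwarz Y N a x * f x))) 0 := by
  have hg (ξ η : E2) := hasDerivAt_slice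
    (F.smooth_metricCoeff (ξ := ξ) (η := η) hf isOpen_univ) (Set.mem_univ 0) hx
  have hh (ξ η : E2) := hasDerivAt_slice
    (F.smooth_secondCoeff (ξ := ξ) (η := η) hf isOpen_univ) (Set.mem_univ 0) hx
  have hgab := hg a b
  rw [F.dt_metricCoeff hf hx] at hgab
  refine (hasDerivAt_willmoreDensity_div (hg a a) hgab (hg b b) (hh a a) (hh a b) (hh b b)
    ?_ ?_ ?_ ?_).congr_deriv ?_
  · rw [F.metricCoeff_zero hf hx, (F.basis hx).AA]
  · rw [F.metricCoeff_zero hf hx, (F.basis hx).AB]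
  · rw [F.metricCoeff_zero hf hx, (F.basis hx).BB]
  · rw [F.secondCoeff_zero hf hx, F.EYab hx, mul_zero]
  · rw [F.dt_secondCoeff_fst hf hx, F.dt_secondCoeff_snd hf hx, F.secondCoeff_self_zero hf hx,
      F.secondCoeff_self_zero hf hx]
    linear_combination 8 * (hopf Y E a x * (∂[b] (∂[b] f) x + schwarz Y N b x * f x)
      + hopf Y E b x * (∂[a] (∂[a] f) x + schwarz Y N a x * f x))
      * F.pinner_variationNormal_E_sq hf hx

end AtZero

end NullFrame

/-! ### The Willmore equation -/

section TestFunctions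

variable {O : Set E2} {f k q : E2 → ℝ}

theorem integrable_mul_of_tsupport (hf : Continuous f) (hc : HasCompactSupport f)
    (hs : tsupport f ⊆ O) (hk : ContinuousOn k O) : Integrable (fun x => k x * f x) := by
  have h : IntegrableOn (fun x => k x * f x) (tsupport f) :=
    ((hk.mono hs).mul hf.continuousOn).integrableOn_compact hc
  exact (integrableOn_iff_integrable_of_support_subset fun x hx =>
    subset_tsupport f (right_ne_zero_of_mul hx)).1 h

theorem tsupport_dirDeriv_subset (f : E2 → ℝ) (ξ : E2) : tsupport (∂[ξ] f) ⊆ tsupport f :=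
  tsupport_fderiv_apply_subset ℝ ξ

theorem hasCompactSupport_dirDeriv (hc : HasCompactSupport f) (ξ : E2) :
    HasCompactSupport (∂[ξ] f) :=
  hc.of_isClosed_subset (isClosed_tsupport _) (tsupport_dirDeriv_subset f ξ)

theorem contDiff_dirDeriv (hf : ContDiff ℝ ∞ f) (ξ : E2) : ContDiff ℝ ∞ (∂[ξ] f) :=
  (hf.fderiv_right (by simp)).clm_apply contDiff_const

theorem integral_mul_dirDeriv (hf : ContDiff ℝ ∞ f) (hc : HasCompactSupport f)
    (hs : tsupport f ⊆ O) (hk : SmoothOn O k) (ξ : E2) :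
    ∫ x, k x * ∂[ξ] f x = -∫ x, ∂[ξ] k x * f x :=
  integral_mul_fderiv_eq_neg_fderiv_mul_of_integrable
    (integrable_mul_of_tsupport hf.continuous hc hs hk.dirDeriv.continuousOn)
    (integrable_mul_of_tsupport (contDiff_dirDeriv hf ξ).continuous
      (hasCompactSupport_dirDeriv hc ξ) ((tsupport_dirDeriv_subset f ξ).trans hs) hk.continuousOn)
    (integrable_mul_of_tsupport hf.continuous hc hs hk.continuousOn)
    (fun _ hx => hk.differentiableAt (hs hx)) (fun x _ => hf.differentiable (by simp) x)

theorem integrable_mul_dirDeriv_dirDeriv_add (hf : ContDiff ℝ ∞ f) (hc : HasCompactSupport f)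
    (hs : tsupport f ⊆ O) (hk : ContinuousOn k O) (hq : ContinuousOn q O) (ξ : E2) :
    Integrable (fun x => k x * (∂[ξ] (∂[ξ] f) x + q x * f x)) := by
  have hsub := (tsupport_dirDeriv_subset (∂[ξ] f) ξ).trans (tsupport_dirDeriv_subset f ξ)
  refine ((integrable_mul_of_tsupport (contDiff_dirDeriv (contDiff_dirDeriv hf ξ) ξ).continuous
    (hasCompactSupport_dirDeriv (hasCompactSupport_dirDeriv hc ξ) ξ) (hsub.trans hs) hk).add
    (integrable_mul_of_tsupport hf.continuous hc hs (hk.mul hq))).congr (ae_of_all _ fun x => ?_)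
  simp only [Pi.add_apply, Pi.mul_apply]
  ring

theorem integral_mul_dirDeriv_dirDeriv_add (hf : ContDiff ℝ ∞ f) (hc : HasCompactSupport f)
    (hs : tsupport f ⊆ O) (hk : SmoothOn O k) (hq : ContinuousOn q O) (ξ : E2) :
    ∫ x, k x * (∂[ξ] (∂[ξ] f) x + q x * f x) = ∫ x, (∂[ξ] (∂[ξ] k) x + q x * k x) * f x := by
  have hsub := tsupport_dirDeriv_subset f ξ
  have hparts : ∫ x, k x * ∂[ξ] (∂[ξ] f) x = ∫ x, ∂[ξ] (∂[ξ] k) x * f x := by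
    rw [integral_mul_dirDeriv (contDiff_dirDeriv hf ξ) (hasCompactSupport_dirDeriv hc ξ)
      (hsub.trans hs) hk, integral_mul_dirDeriv hf hc hs hk.dirDeriv, neg_neg]
  have hkq : Integrable (fun x => (q x * k x) * f x) :=
    integrable_mul_of_tsupport hf.continuous hc hs (hq.mul hk.continuousOn)
  have hkf : Integrable (fun x => k x * ∂[ξ] (∂[ξ] f) x) := by
    simpa using integrable_mul_dirDeriv_dirDeriv_add hf hc hs hk.continuousOn
      (continuousOn_const (c := (0 : ℝ))) ξ
  calc ∫ x, k x * (∂[ξ] (∂[ξ] f) x + q x * f x)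
      = ∫ x, (k x * ∂[ξ] (∂[ξ] f) x + (q x * k x) * f x) := by congr! 2 with x; ring
    _ = ∫ x, (∂[ξ] (∂[ξ] k) x * f x + (q x * k x) * f x) := by
      rw [integral_add hkf hkq, hparts, integral_add
        (integrable_mul_of_tsupport hf.continuous hc hs hk.dirDeriv.dirDeriv.continuousOn) hkq]
    _ = ∫ x, (∂[ξ] (∂[ξ] k) x + q x * k x) * f x := by congr! 2 with x; ring

theorem eq_zero_of_integral_mul_eq_zero (hO : IsOpen O) (hk : ContinuousOn k O)
    (h : ∀ g : E2 → ℝ, ContDiff ℝ ∞ g → HasCompactSupport g → tsupport g ⊆ O →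
      ∫ x, k x * g x = 0) : ∀ x ∈ O, k x = 0 := by
  have hae := hO.ae_eq_zero_of_integral_contDiff_smul_eq_zero (μ := volume) (f := k)
    (hk.locallyIntegrableOn hO.measurableSet) fun g hg hc hs => by
      simpa [mul_comm] using h g hg hc hs
  intro x hx
  by_contra hne
  have hopen : IsOpen (O ∩ k ⁻¹' {0}ᶜ) := hk.isOpen_inter_preimage hO isOpen_compl_singleton
  refine (hopen.measure_pos volume ⟨x, hx, hne⟩).ne' (measure_mono_null ?_ hae)
  rintro z ⟨hz, hz0⟩ hzz
  exact hz0 (hzz hz)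

end TestFunctions

namespace NullFrame

variable {O : Set E2} {Y N E : E2 → Fin 5 → ℝ} {a b x : E2} {f : E2 → ℝ}

theorem negDet_of_notMem (F : NullFrame O Y N E a b) (hf : SmoothOn O f) (t : ℝ) (hx : x ∈ O)
    (hxf : x ∉ tsupport f) : negDet (variation Y N E f) a b (t, x) = 1 / 4 := by
  have hO' : IsOpen (O ∩ (tsupport f)ᶜ) := F.isOpen.inter (isClosed_tsupport f).isOpen_compl
  have h (ξ) : ∂[(0, ξ)] (variation Y N E f) (t, x) = ∂[ξ] Y x := by
    rw [← dirDeriv_slice (F.smooth_variation hf isOpen_univ) (Set.mem_univ t) hx]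
    refine dirDeriv_congr hO' (fun z hz => ?_) ⟨hx, hxf⟩
    simp [variation, image_eq_zero_of_notMem_tsupport hz.2]
  unfold negDet metricCoeff
  rw [h, h, (F.basis hx).AA, (F.basis hx).AB]
  norm_num

theorem exists_negDet_pos (F : NullFrame O Y N E a b) (hf : SmoothOn O f)
    (hc : HasCompactSupport f) (hs : tsupport f ⊆ O) :
    ∃ ε > 0, ∀ p ∈ Set.Ioo (-ε) ε ×ˢ O, 0 < negDet (variation Y N E f) a b p := by
  have hD : SmoothOn (Set.univ ×ˢ O) (negDet (variation Y N E f) a b) :=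
    F.smooth_negDet hf isOpen_univ
  have hopen := hD.continuousOn.isOpen_inter_preimage hD.isOpen (isOpen_Ioi (a := (0 : ℝ)))
  obtain ⟨u, v, hu, -, h0, hv, huv⟩ := generalized_tube_lemma
    (isCompact_singleton (x := (0 : ℝ))) hc hopen (by
      rintro ⟨t, z⟩ ⟨rfl, hz⟩
      refine ⟨⟨Set.mem_univ _, hs hz⟩, ?_⟩
      change 0 < negDet (variation Y N E f) a b (0, z)
      rw [F.negDet_zero hf (hs hz)]
      norm_num)
  obtain ⟨ε, hε, hball⟩ := Metric.isOpen_iff.1 hu 0 (h0 rfl)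
  rw [Real.ball_eq_Ioo, zero_sub, zero_add] at hball
  refine ⟨ε, hε, fun ⟨t, z⟩ hp => ?_⟩
  by_cases hz : z ∈ tsupport f
  · exact (huv (a := (t, z)) ⟨hball hp.1, hv hz⟩).2
  · rw [F.negDet_of_notMem hf t hp.2 hz]
    norm_num

end NullFrame

section Lift

variable {M : Type*} [TopologicalSpace M] {y : M → Q31} {e : OpenPartialHomeomorph M E2}
  {O : Set E2} {Y : E2 → Fin 5 → ℝ} {x : E2}

theorem IsLift.smoothOn (h : IsLift y e O Y) (hO : IsOpen O) : SmoothOn O Y := ⟨hO, h.1⟩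

theorem IsLift.ne_zero (h : IsLift y e O Y) (hx : x ∈ O) : Y x ≠ 0 := (h.2 x hx).1

theorem IsLift.coe_eq (h : IsLift y e O Y) (hx : x ∈ O) :
    (y (e.symm x)).1 = Projectivization.mk ℝ (Y x) (h.ne_zero hx) := (h.2 x hx).2

theorem IsLift.null (h : IsLift y e O Y) (hx : x ∈ O) : ⟪Y x, Y x⟫ = 0 := by
  refine (y (e.symm x)).2 (Y x) ?_
  rw [h.coe_eq hx, Projectivization.submodule_mk]
  exact Submodule.mem_span_singleton_self _

end Lift

/-- `Z` is a smooth family of nonzero null vector fields which is `Y` at time `0`, and which is `Y`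
at all times outside of `K`. -/
structure IsNullVariation (O : Set E2) (Y : E2 → Fin 5 → ℝ) (K : Set E2)
    (Z : ℝ × E2 → Fin 5 → ℝ) : Prop where
  smooth : SmoothOn (Set.univ ×ˢ O) Z
  ne_zero : ∀ t, ∀ x ∈ O, Z (t, x) ≠ 0
  null : ∀ t, ∀ x ∈ O, ⟪Z (t, x), Z (t, x)⟫ = 0
  eq_zero : ∀ x ∈ O, Z (0, x) = Y x
  eq_of_notMem : ∀ t, ∀ x ∈ O, x ∉ K → Z (t, x) = Y x

theorem NullFrame.isNullVariation {O : Set E2} {Y N E : E2 → Fin 5 → ℝ} {a b : E2} {f : E2 → ℝ}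
    (F : NullFrame O Y N E a b) (hf : SmoothOn O f) :
    IsNullVariation O Y (tsupport f) (variation Y N E f) where
  smooth := F.smooth_variation hf isOpen_univ
  ne_zero t x hx h0 := by
    have h := F.pinner_variation_N (f := f) (t := t) hx
    rw [h0, pinner_zero_left] at h
    norm_num at h
  null _ _ hx := F.pinner_variation_self hx
  eq_zero x _ := variation_zero Y N E f x
  eq_of_notMem t x _ hxf := by simp [variation, image_eq_zero_of_notMem_tsupport hxf]

section ChartVariation

open Classical in
/-- The family of maps which is given in the chart `e` by `Z`, and which is `y` outside of `e`. The
last two conditions only serve to make the first case well defined. -/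
def chartVariation {M : Type*} [TopologicalSpace M] (y : M → Q31) (e : OpenPartialHomeomorph M E2)
    (Z : ℝ × E2 → Fin 5 → ℝ) (t : ℝ) (p : M) : Q31 :=
  if h : p ∈ e.source ∧ Z (t, e p) ≠ 0 ∧ ⟪Z (t, e p), Z (t, e p)⟫ = 0 then
    Q31.mk (Z (t, e p)) h.2.1 h.2.2
  else y p

variable {M : Type*} [TopologicalSpace M] {y : M → Q31} {e : OpenPartialHomeomorph M E2}
  {Y : E2 → Fin 5 → ℝ} {K : Set E2} {Z : ℝ × E2 → Fin 5 → ℝ} {ε : ℝ}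

theorem IsNullVariation.isLift (V : IsNullVariation e.target Y K Z) (t : ℝ) :
    IsLift (chartVariation y e Z t) e e.target (fun x => Z (t, x)) := by
  refine ⟨(V.smooth.slice e.open_target (Set.mem_univ t)).contDiffOn, fun x hx =>
    ⟨V.ne_zero t x hx, ?_⟩⟩
  have hex : e (e.symm x) = x := e.right_inv hx
  have h : e.symm x ∈ e.source ∧ Z (t, e (e.symm x)) ≠ 0
      ∧ ⟪Z (t, e (e.symm x)), Z (t, e (e.symm x))⟫ = 0 := by
    rw [hex]
    exact ⟨e.map_target hx, V.ne_zero t x hx, V.null t x hx⟩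
  rw [chartVariation, dif_pos h]
  simp only [Q31.mk, hex]

theorem chartVariation_eq (hY : IsLift y e e.target Y) {t : ℝ} {p : M}
    (h : p ∈ e.source → Z (t, e p) = Y (e p)) : chartVariation y e Z t p = y p := by
  unfold chartVariation
  split_ifs with hp
  · apply Subtype.ext
    have hlift := hY.coe_eq (e.map_source hp.1)
    rw [e.left_inv hp.1] at hlift
    rw [hlift]
    simp only [Q31.mk, h hp.1]
  · rfl

theorem IsNullVariation.chartVariation_of_notMem (V : IsNullVariation e.target Y K Z)
    (hY : IsLift y e e.target Y) (t : ℝ) {p : M} (hp : p ∉ e.symm '' K) :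
    chartVariation y e Z t p = y p :=
  chartVariation_eq hY fun hpe => V.eq_of_notMem t _ (e.map_source hpe) fun hK =>
    hp ⟨e p, hK, e.left_inv hpe⟩

theorem image_symm_image {e : OpenPartialHomeomorph M E2} (hK : K ⊆ e.target) :
    e '' (e.symm '' K) = K := by
  rw [Set.image_image]
  exact (Set.image_congr fun x hx => e.right_inv (hK hx)).trans (Set.image_id' _)

variable [ChartedSpace E2 M]

theorem exists_restr (he : e ∈ IsManifold.maximalAtlas (𝓡 2) ∞ M) {U : Set M} (hU : IsOpen U)
    {p : M} (hp : p ∈ e.source) (hpU : p ∈ U) :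
    ∃ e' ∈ IsManifold.maximalAtlas (𝓡 2) ∞ M, p ∈ e'.source ∧ e'.source ⊆ e.source ∩ U ∧
      e'.target ⊆ e.target ∧ (∀ x, e' x = e x) ∧ ∀ x, e'.symm x = e.symm x := by
  have hsource : (e.restr U).source = e.source ∩ U := by rw [e.restr_source, hU.interior_eq]
  refine ⟨e.restr U, restr_mem_maximalAtlas (contDiffGroupoid ∞ (𝓡 2)) he hU,
    hsource ▸ ⟨hp, hpU⟩, hsource.subset, fun x hx => ?_, fun _ => rfl, fun _ => rfl⟩
  rw [← (e.restr U).right_inv hx]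
  exact e.map_source (hsource.subset ((e.restr U).map_target hx)).1

theorem hasWillmoreEnergy_of_chart (he : e ∈ IsManifold.maximalAtlas (𝓡 2) ∞ M)
    (hK : IsCompact K) (hKe : K ⊆ e.target) {w : E2 → ℝ} (hw : ContinuousOn w K)
    (h : ∀ x ∈ K, IsWillmoreDensityAt y e x (w x)) :
    HasWillmoreEnergy y (e.symm '' K) (∫ x in K, w x) := by
  have himage := image_symm_image hKe
  refine ⟨1, fun _ => e, fun _ => e.symm '' K, fun _ => w, fun _ => ⟨he, ?_, ?_, ?_, ?_⟩,
    fun i j hij => (hij (Subsingleton.elim i j)).elim, Set.iUnion_const _, by simp [himage]⟩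
  · rintro _ ⟨x, hx, rfl⟩
    exact e.map_target (hKe hx)
  · rw [himage]
    exact hK.measurableSet
  · rwa [himage]
  · rw [himage]
    exact hw.integrableOn_compact hK

variable [T2Space M]

theorem IsNullVariation.exists_lift_of_notMem (V : IsNullVariation e.target Y K Z)
    (hy : IsTimelike y) (hY : IsLift y e e.target Y) (hK : IsCompact K) (hKe : K ⊆ e.target)
    {p : M} (hp : p ∉ e.source) :
    ∃ e' ∈ IsManifold.maximalAtlas (𝓡 2) ∞ M, p ∈ e'.source ∧ ∃ Y' : E2 → Fin 5 → ℝ,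
      (∀ t, IsLift (chartVariation y e Z t) e' e'.target Y') ∧
        ∀ x ∈ e'.target, metricDet 2 Y' x < 0 := by
  obtain ⟨e₁, he₁, hp₁, Y', hY', hdet⟩ := hy p
  have hclosed : IsClosed (e.symm '' K) :=
    (hK.image_of_continuousOn (e.continuousOn_symm.mono hKe)).isClosed
  obtain ⟨e', he', hpe, hsource, htarget, -, hsymm⟩ :=
      exists_restr he₁ hclosed.isOpen_compl hp₁ <| by
    rintro ⟨x, hx, rfl⟩
    exact hp (e.map_target (hKe hx))
  refine ⟨e', he', hpe, Y', fun t => ⟨hY'.1.mono htarget, fun x hx => ?_⟩,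
    fun x hx => hdet x (htarget hx)⟩
  rw [V.chartVariation_of_notMem hY t (hsource (e'.map_target hx)).2, hsymm]
  exact hY'.2 x (htarget hx)

theorem IsNullVariation.isTimelikeVariation (V : IsNullVariation e.target Y K Z)
    (he : e ∈ IsManifold.maximalAtlas (𝓡 2) ∞ M) (hy : IsTimelike y)
    (hY : IsLift y e e.target Y) (hK : IsCompact K) (hKe : K ⊆ e.target)
    (hdet : ∀ t ∈ Set.Ioo (-ε) ε, ∀ x ∈ e.target, metricDet 2 (fun x => Z (t, x)) x < 0) :
    IsTimelikeVariation y (e.symm '' K) ε (chartVariation y e Z) := by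
  refine ⟨funext fun p => chartVariation_eq hY fun hp => V.eq_zero _ (e.map_source hp),
    fun t ht p => ?_, fun t _ p hp => V.chartVariation_of_notMem hY t hp, fun t₀ _ p => ?_⟩
  · by_cases hp : p ∈ e.source
    · exact ⟨e, he, hp, _, V.isLift t, hdet t ht⟩
    · obtain ⟨e', he', hpe, Y', hlift, hdet'⟩ := V.exists_lift_of_notMem hy hY hK hKe hp
      exact ⟨e', he', hpe, Y', hlift t, hdet'⟩
  · by_cases hp : p ∈ e.source
    · exact ⟨e, he, hp, Set.univ, Z, isOpen_univ, Set.mem_univ _, V.smooth.contDiffOn,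
        fun t _ => (V.isLift t).2⟩
    · obtain ⟨e', he', hpe, Y', hlift, -⟩ := V.exists_lift_of_notMem hy hY hK hKe hp
      exact ⟨e', he', hpe, Set.univ, fun q => Y' q.2, isOpen_univ, Set.mem_univ _,
        (hlift 0).1.comp contDiff_snd.contDiffOn fun _ hq => hq.2, fun t _ => (hlift t).2⟩

end ChartVariation

section Willmore

variable {M : Type*} [TopologicalSpace M] {y : M → Q31}
  {e : OpenPartialHomeomorph M E2} {Y N E : E2 → Fin 5 → ℝ} {f : E2 → ℝ} {x : E2} {t : ℝ}

theorem NullFrame.metricDet_variation (F : NullFrame e.target Y N E ex ey)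
    (hf : SmoothOn e.target f) (t : ℝ) (hx : x ∈ e.target) :
    metricDet 2 (fun x => variation Y N E f (t, x)) x
      = -negDet (variation Y N E f) ex ey (t, x) := by
  have h (ξ) := dirDeriv_slice (ξ := ξ) (F.smooth_variation hf isOpen_univ) (Set.mem_univ t) hx
  change ⟪∂[ex] _ x, ∂[ex] _ x⟫ * ⟪∂[ey] _ x, ∂[ey] _ x⟫ - ⟪∂[ex] _ x, ∂[ey] _ x⟫ ^ 2 = _
  rw [h, h]
  unfold negDet metricCoeff
  ring

theorem NullFrame.isWillmoreDensityAt (F : NullFrame e.target Y N E ex ey)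
    (hf : SmoothOn e.target f) (hx : x ∈ e.target)
    (hD : 0 < negDet (variation Y N E f) ex ey (t, x)) :
    IsWillmoreDensityAt (chartVariation y e (variation Y N E f) t) e x
      (variationDensity Y N E f ex ey (t, x)) := by
  have V := F.isNullVariation hf
  have hd (ξ) := dirDeriv_slice (ξ := ξ) V.smooth (Set.mem_univ t) hx
  have hdd (ξ η) := dirDeriv_dirDeriv_slice (ξ := ξ) (η := η) V.smooth e.open_target
    (Set.mem_univ t) hx
  have hn := F.pinner_variationNormal_self (a := ex) (b := ey) (t := t) hf hx
  have hcross := pinner_cross_apply (s := 2) ![variation Y N E f (t, x), N x,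
    ∂[(0, ex)] (variation Y N E f) (t, x), ∂[(0, ey)] (variation Y N E f) (t, x)]
  obtain ⟨ξ, η, κ₁, κ₂, hκ, hw⟩ := exists_hopfPair
    (V.smooth.slice e.open_target (Set.mem_univ t)) (V.null t) hx
    (by rw [F.metricDet_variation hf t hx]; exact neg_lt_zero.2 hD)
    (n := variationNormal Y N E f ex ey (t, x)) (hn ▸ hD) (hcross 0)
    (by rw [hd]; exact hcross 2) (by rw [hd]; exact hcross 3)
  refine ⟨e.target, e.open_target, hx, subset_rfl, _, V.isLift t, ξ, η, κ₁, κ₂, hκ, ?_⟩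
  rw [hw, hd, hd, hdd, hdd, hdd, hn]
  rfl

variable [ChartedSpace E2 M] [T2Space M]

theorem IsWillmore.integral_firstVariation_eq_zero (hW : IsWillmore y)
    (he : e ∈ IsManifold.maximalAtlas (𝓡 2) ∞ M) (hY : IsLift y e e.target Y)
    (F : NullFrame e.target Y N E ex ey) (hf : SmoothOn e.target f) (hc : HasCompactSupport f)
    (hs : tsupport f ⊆ e.target) :
    ∫ x in tsupport f,
      2 * (hopf Y E ex x * (∂[ey] (∂[ey] f) x + schwarz Y N ey x * f x)
        + hopf Y E ey x * (∂[ex] (∂[ex] f) x + schwarz Y N ex x * f x)) = 0 := by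
  obtain ⟨ε, hε, hD⟩ := F.exists_negDet_pos hf hc hs
  have hw := F.smooth_variationDensity hf isOpen_Ioo hD
  have hvar := (F.isNullVariation hf).isTimelikeVariation (ε := ε) he hW.1 hY hc hs
    fun t ht x hx => by
      rw [F.metricDet_variation hf t hx]
      exact neg_lt_zero.2 (hD (t, x) ⟨ht, hx⟩)
  have henergy : ∀ t ∈ Set.Ioo (-ε) ε, HasWillmoreEnergy
      (chartVariation y e (variation Y N E f) t) (e.symm '' tsupport f)
      (∫ x in tsupport f, variationDensity Y N E f ex ey (t, x)) := fun t ht =>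
    hasWillmoreEnergy_of_chart he hc hs
      ((hw.slice e.open_target ht).continuousOn.mono hs) fun x hx =>
      F.isWillmoreDensityAt hf (hs hx) (hD (t, x) ⟨ht, hs hx⟩)
  have hcritical := hW.2 _ ε _ (hc.image_of_continuousOn (e.continuousOn_symm.mono hs)) hε hvar _
    (Filter.eventually_of_mem (Ioo_mem_nhds (neg_lt_zero.2 hε) hε) henergy)
  rw [← (hasDerivAt_setIntegral hε hw e.open_target hc hs).unique hcritical]
  refine setIntegral_congr_fun (isClosed_tsupport f).measurableSet fun x hx => ?_
  exact (F.hasDerivAt_variationDensity hf (hs hx)).unique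
    (hasDerivAt_slice hw ⟨neg_lt_zero.2 hε, hε⟩ (hs hx))

theorem IsWillmore.dirDeriv_dirDeriv_hopf_add (hW : IsWillmore y)
    (he : e ∈ IsManifold.maximalAtlas (𝓡 2) ∞ M) (hY : IsLift y e e.target Y)
    (F : NullFrame e.target Y N E ex ey) (x : E2) (hx : x ∈ e.target) :
    (∂[ey] (∂[ey] (hopf Y E ex)) x + schwarz Y N ey x * hopf Y E ex x)
      + (∂[ex] (∂[ex] (hopf Y E ey)) x + schwarz Y N ex x * hopf Y E ey x) = 0 := by
  have hk₁ : SmoothOn e.target (hopf Y E ex) := F.smooth_hopf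
  have hk₂ : SmoothOn e.target (hopf Y E ey) := F.swap.smooth_hopf
  have hs₁ : SmoothOn e.target (schwarz Y N ex) := F.smooth_schwarz
  have hs₂ : SmoothOn e.target (schwarz Y N ey) := F.swap.smooth_schwarz
  have hg₁ := ((hk₁.dirDeriv (ξ := ey)).dirDeriv (ξ := ey)).add (hs₂.mul hk₁)
  have hg₂ := ((hk₂.dirDeriv (ξ := ex)).dirDeriv (ξ := ex)).add (hs₁.mul hk₂)
  refine eq_zero_of_integral_mul_eq_zero e.open_target (hg₁.add hg₂).continuousOn
    (fun f hf hc hs => ?_) x hx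
  have hsupp : ∀ x ∉ tsupport f, f x = 0 ∧ ∀ ξ, ∂[ξ] (∂[ξ] f) x = 0 := fun x hx =>
    ⟨image_eq_zero_of_notMem_tsupport hx, fun ξ => image_eq_zero_of_notMem_tsupport fun h =>
      hx (tsupport_dirDeriv_subset f ξ (tsupport_dirDeriv_subset _ ξ h))⟩
  have hvar := hW.integral_firstVariation_eq_zero he hY F ⟨e.open_target, hf.contDiffOn⟩ hc hs
  rw [setIntegral_eq_integral_of_forall_compl_eq_zero (fun x hx => by simp [hsupp x hx]),
    integral_const_mul, integral_add
      (integrable_mul_dirDeriv_dirDeriv_add hf hc hs hk₁.continuousOn hs₂.continuousOn ey)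
      (integrable_mul_dirDeriv_dirDeriv_add hf hc hs hk₂.continuousOn hs₁.continuousOn ex),
    integral_mul_dirDeriv_dirDeriv_add hf hc hs hk₁ hs₂.continuousOn,
    integral_mul_dirDeriv_dirDeriv_add hf hc hs hk₂ hs₁.continuousOn,
    ← integral_add (integrable_mul_of_tsupport hf.continuous hc hs hg₁.continuousOn)
      (integrable_mul_of_tsupport hf.continuous hc hs hg₂.continuousOn)] at hvar
  rw [← (mul_eq_zero.1 hvar).resolve_left two_ne_zero]
  congr! 2 with z
  ring

theorem IsWillmore.willmore_equation (hW : IsWillmore y)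
    (he : e ∈ IsManifold.maximalAtlas (𝓡 2) ∞ M) (hY : IsLift y e e.target Y)
    (F : NullFrame e.target Y N E ex ey) (hx : x ∈ e.target) :
    ∂[ey] (∂[ey] (hopf Y E ex)) x + schwarz Y N ey x * hopf Y E ex x = 0
      ∧ ∂[ex] (∂[ex] (hopf Y E ey)) x + schwarz Y N ex x * hopf Y E ey x = 0 := by
  have hsum := hW.dirDeriv_dirDeriv_hopf_add he hY F x hx
  have hcodazzi := F.codazzi hx
  constructor <;> linarith

end Willmore

/-! ### Isothermic Willmore surfaces -/

theorem isNullBasis_of_pinner {Y C A B : Fin 5 → ℝ} (YY : ⟪Y, Y⟫ = 0) (AA : ⟪A, A⟫ = 0)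
    (BB : ⟪B, B⟫ = 0) (AB : ⟪A, B⟫ = 1 / 2) (YA : ⟪Y, A⟫ = 0) (YB : ⟪Y, B⟫ = 0)
    (YC : ⟪Y, C⟫ = -1 / 2) (CA : ⟪C, A⟫ = 0) (CB : ⟪C, B⟫ = 0) :
    IsNullBasis Y ((2 : ℝ) • C + (2 * ⟪C, C⟫) • Y) A B ((4 : ℝ) • cross ![Y, C, A, B] 2) where
  YY := YY
  NN := by
    simp only [pinner_add_left, pinner_add_right, pinner_smul_left, pinner_smul_right, YY, YC,
      pinner_comm C Y]
    ring
  YN := by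
    simp only [pinner_add_right, pinner_smul_right, YY, YC]
    ring
  YA := YA
  YB := YB
  NA := by simp only [pinner_add_left, pinner_smul_left, YA, CA, mul_zero, add_zero]
  NB := by simp only [pinner_add_left, pinner_smul_left, YB, CB, mul_zero, add_zero]
  AA := AA
  BB := BB
  AB := AB
  EE := by
    rw [pinner_smul_left, pinner_smul_right, pinner_cross_self_four YY YA YB, YC, AA, BB, AB]
    norm_num
  EY := (pinner_smul_left ..).trans (mul_eq_zero_of_right _ (pinner_cross_apply ![Y, C, A, B] 0))
  EN := by
    have hY : ⟪cross ![Y, C, A, B] 2, Y⟫ = 0 := pinner_cross_apply ![Y, C, A, B] 0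
    have hC : ⟪cross ![Y, C, A, B] 2, C⟫ = 0 := pinner_cross_apply ![Y, C, A, B] 1
    rw [pinner_smul_left, pinner_add_right, pinner_smul_right, pinner_smul_right, hY, hC]
    ring
  EA := (pinner_smul_left ..).trans (mul_eq_zero_of_right _ (pinner_cross_apply ![Y, C, A, B] 2))
  EB := (pinner_smul_left ..).trans (mul_eq_zero_of_right _ (pinner_cross_apply ![Y, C, A, B] 3))

/-- A smooth lift to the light cone that is canonical in the asymptotic directions `a` and `b`. -/
structure IsCanonicalLift (O : Set E2) (Y : E2 → Fin 5 → ℝ) (a b : E2) : Prop where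
  smooth_Y : SmoothOn O Y
  YY : ∀ ⦃x⦄, x ∈ O → ⟪Y x, Y x⟫ = 0
  AA : ∀ ⦃x⦄, x ∈ O → ⟪∂[a] Y x, ∂[a] Y x⟫ = 0
  BB : ∀ ⦃x⦄, x ∈ O → ⟪∂[b] Y x, ∂[b] Y x⟫ = 0
  AB : ∀ ⦃x⦄, x ∈ O → ⟪∂[a] Y x, ∂[b] Y x⟫ = 1 / 2

theorem IsCanonicalLift.isNullBasis {O : Set E2} {Y : E2 → Fin 5 → ℝ} {a b x : E2}
    (h : IsCanonicalLift O Y a b) (hx : x ∈ O) :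
    IsNullBasis (Y x)
      ((2 : ℝ) • ∂[b] (∂[a] Y) x + (2 * ⟪∂[b] (∂[a] Y) x, ∂[b] (∂[a] Y) x⟫) • Y x)
      (∂[a] Y x) (∂[b] Y x)
      ((4 : ℝ) • cross ![Y x, ∂[b] (∂[a] Y) x, ∂[a] Y x, ∂[b] Y x] 2) := by
  refine isNullBasis_of_pinner (h.YY hx) (h.AA hx) (h.BB hx) (h.AB hx)
    (pinner_dirDeriv_eq_zero h.smooth_Y h.YY hx) (pinner_dirDeriv_eq_zero h.smooth_Y h.YY hx)
    ?_ ?_ ?_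
  · rw [pinner_dirDeriv_dirDeriv h.smooth_Y h.YY hx, pinner_comm, h.AB hx, neg_div]
  · rw [pinner_comm]
    exact pinner_dirDeriv_eq_zero h.smooth_Y.dirDeriv h.AA hx
  · rw [dirDeriv_comm h.smooth_Y hx, pinner_comm]
    exact pinner_dirDeriv_eq_zero h.smooth_Y.dirDeriv h.BB hx

theorem IsCanonicalLift.exists_nullFrame {O : Set E2} {Y : E2 → Fin 5 → ℝ} {a b : E2}
    (h : IsCanonicalLift O Y a b) : ∃ N E, NullFrame O Y N E a b := by
  have hY := h.smooth_Y
  have hYa := hY.dirDeriv (ξ := a)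
  have hYb := hY.dirDeriv (ξ := b)
  have hYab := hYa.dirDeriv (ξ := b)
  refine ⟨_, _, hY, (hYab.const_smul 2).add (((hYab.pinner hYab).const_mul 2).smul hY),
    (SmoothOn.cross (v := fun x => ![Y x, ∂[b] (∂[a] Y) x, ∂[a] Y x, ∂[b] Y x]) hY.isOpen
      (Fin.forall_fin_succ.2 ⟨hY, Fin.forall_fin_succ.2 ⟨hYab, Fin.forall_fin_two.2
        ⟨hYa, hYb⟩⟩⟩)).const_smul 4, fun _ hx => h.isNullBasis hx, fun x _ => ?_⟩
  exact (pinner_smul_left ..).trans (mul_eq_zero_of_right _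
    (pinner_cross_apply ![Y x, ∂[b] (∂[a] Y) x, ∂[a] Y x, ∂[b] Y x] 1))

namespace NullFrame

variable {O : Set E2} {Y N E : E2 → Fin 5 → ℝ} {a b x : E2} {v κ₁ κ₂ : Fin 5 → ℝ}

theorem pinner_E_of_mem_gaussSpace (F : NullFrame O Y N E a b) (hx : x ∈ O)
    (hv : v ∈ gaussSpace Y x a b) : ⟪E x, v⟫ = 0 := by
  have h := F.basis hx
  refine pinner_eq_zero_of_mem_span ?_ hv
  rintro w (rfl | rfl | rfl | rfl)
  exacts [h.EY, h.EA, h.EB, F.EYab hx]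

theorem hopf_eq (F : NullFrame O Y N E a b) (hx : x ∈ O) (h : IsHopfPair Y x a b κ₁ κ₂) :
    hopf Y E a x = ⟪κ₁, E x⟫ ∧ hopf Y E b x = ⟪κ₂, E x⟫ := by
  obtain ⟨-, -, -, -, -, h₁, h₂⟩ := h
  have h₁ := F.pinner_E_of_mem_gaussSpace hx h₁
  have h₂ := F.pinner_E_of_mem_gaussSpace hx h₂
  rw [pinner_comm, pinner_sub_left, sub_eq_zero] at h₁ h₂
  exact ⟨h₁, h₂⟩

theorem eq_zero_of_pinner_gaussSpace (F : NullFrame O Y N E a b) (hx : x ∈ O)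
    (hv : ∀ w ∈ gaussSpace Y x a b, ⟪v, w⟫ = 0) (hE : ⟪v, E x⟫ = 0) : v = 0 := by
  have hspan : ∀ w ∈ ({Y x, ∂[a] Y x, ∂[b] Y x, ∂[b] (∂[a] Y) x} : Set (Fin 5 → ℝ)), ⟪v, w⟫ = 0 :=
    fun w hw => hv w (Submodule.subset_span hw)
  have hY : ⟪v, Y x⟫ = 0 := hspan _ (by simp)
  have hYab : ⟪v, ∂[b] (∂[a] Y) x⟫ = 0 := hspan _ (by simp)
  rw [F.Yab_eq hx, pinner_add_right, pinner_smul_right, pinner_smul_right, hY] at hYab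
  exact (F.basis hx).isBlockFrame.eq_zero hY (by linarith) (hspan _ (by simp))
    (hspan _ (by simp)) hE

end NullFrame

theorem eq_smul_ex_add_smul_ey (ξ : E2) : ξ = ξ 0 • ex + ξ 1 • ey := by
  ext i
  fin_cases i <;> simp [ex, ey]

theorem eq_of_dirDeriv_eq_zero {G : Type*} [NormedAddCommGroup G] [NormedSpace ℝ G] {O : Set E2}
    {f : E2 → G} (hf : SmoothOn O f) (hO : IsPreconnected O) (hu : ∀ x ∈ O, ∂[ex] f x = 0)
    (hv : ∀ x ∈ O, ∂[ey] f x = 0) {x z : E2} (hx : x ∈ O) (hz : z ∈ O) : f x = f z := by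
  refine hf.isOpen.is_const_of_fderiv_eq_zero hO
    (fun w hw => (hf.differentiableAt hw).differentiableWithinAt) (fun w hw => ?_) hx hz
  ext1 ξ
  change ∂[ξ] f w = 0
  rw [eq_smul_ex_add_smul_ey ξ, dirDeriv_dir_smul_add_smul, hu w hw, hv w hw, smul_zero, smul_zero,
    add_zero]

namespace IsothermicFrame

variable {O : Set E2} {Y N E : E2 → Fin 5 → ℝ} {a b x : E2} {k : E2 → ℝ} {α β : ℝ}

theorem mono (F : IsothermicFrame O Y N E a b k α β) {O' : Set E2} (hO' : IsOpen O')
    (h : O' ⊆ O) : IsothermicFrame O' Y N E a b k α β :=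
  ⟨F.toNullFrame.mono hO' h, F.smooth_k.mono hO' h, fun _ hx => F.hopf_a (h hx),
    fun _ hx => F.hopf_b (h hx)⟩

theorem smooth_parallelVec (F : IsothermicFrame O Y N E a b k α β) (γ : ℝ) :
    SmoothOn O (parallelVec Y N k γ a b) := by
  have hk := F.smooth_k
  have hcoeff := ((hk.dirDeriv (ξ := a)).dirDeriv (ξ := b)).const_mul 2 |>.add
    ((hk.pow 3).const_mul (2 * γ))
  exact (((hcoeff.neg.smul F.smooth_Y).add ((hk.dirDeriv.const_mul 2).smul F.smooth_Ya)).add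
    ((hk.dirDeriv.const_mul 2).smul F.smooth_Yb)).add (hk.neg.smul F.smooth_N)

theorem dirDeriv_dirDeriv_k (F : IsothermicFrame O Y N E a b k α β) (hα : α ≠ 0)
    (hW : ∂[b] (∂[b] (hopf Y E a)) x + schwarz Y N b x * hopf Y E a x = 0) (hx : x ∈ O) :
    ∂[b] (∂[b] k) x = -(schwarz Y N b x * k x) := by
  rw [dirDeriv_congr F.isOpen (fun z hz => F.dirDeriv_hopf_a b hz) hx,
    dirDeriv_const_mul (F.smooth_k.dirDeriv.differentiableAt hx), F.hopf_a hx] at hW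
  exact mul_left_cancel₀ hα (by linarith)

theorem parallelVec_eq (F : IsothermicFrame O Y N E ex ey k α β) (hα : α ≠ 0) (hβ : β ≠ 0)
    (hO : IsPreconnected O)
    (hW : ∀ x ∈ O, ∂[ey] (∂[ey] (hopf Y E ex)) x + schwarz Y N ey x * hopf Y E ex x = 0
      ∧ ∂[ex] (∂[ex] (hopf Y E ey)) x + schwarz Y N ex x * hopf Y E ey x = 0)
    {x z : E2} (hx : x ∈ O) (hz : z ∈ O) :
    parallelVec Y N k (α * β) ex ey x = parallelVec Y N k (α * β) ex ey z := by
  refine eq_of_dirDeriv_eq_zero (F.smooth_parallelVec _) hO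
    (fun w hw => F.dirDeriv_parallelVec
      (fun w hw => F.swap.dirDeriv_dirDeriv_k hβ (hW w hw).2 hw) hw) (fun w hw => ?_) hx hz
  rw [dirDeriv_congr F.isOpen (fun w hw => parallelVec_swap F.smooth_k _ hw) hw, mul_comm α β]
  exact F.swap.dirDeriv_parallelVec (fun w hw => F.dirDeriv_dirDeriv_k hα (hW w hw).1 hw) hw

end IsothermicFrame

section Manifold

variable {M : Type*} [TopologicalSpace M] [ChartedSpace E2 M]

theorem IsSignedIsothermic.exists_isothermicFrame {y : M → Q31} {σ : ℝ}
    (hS : IsSignedIsothermic σ y) (p : M) :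
    ∃ e ∈ IsManifold.maximalAtlas (𝓡 2) ∞ M, p ∈ e.source ∧ ∃ Y N E k, IsLift y e e.target Y ∧
      IsothermicFrame e.target Y N E ex ey k σ 1 ∧ ∀ x ∈ e.target, k x ≠ 0 := by
  obtain ⟨-, hU, hS⟩ := hS
  obtain ⟨e, he, hp, Y, hY, hκ⟩ := hS p
  have hcan : IsCanonicalLift e.target Y ex ey :=
    { smooth_Y := hY.smoothOn e.open_target
      YY := fun _ hx => hY.null hx
      AA := fun x hx => by obtain ⟨_, _, h, _⟩ := hκ x hx; exact h.1
      BB := fun x hx => by obtain ⟨_, _, h, _⟩ := hκ x hx; exact h.2.1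
      AB := fun x hx => by obtain ⟨_, _, h, _⟩ := hκ x hx; exact h.2.2.1 }
  obtain ⟨N, E, F⟩ := hcan.exists_nullFrame
  refine ⟨e, he, hp, Y, N, E, hopf Y E ey, hY, ⟨F, F.swap.smooth_hopf, fun x hx => ?_,
    fun x _ => (one_mul _).symm⟩, fun x hx hk => ?_⟩ <;> obtain ⟨κ₁, κ₂, h, rfl⟩ := hκ x hx
  · rw [(F.hopf_eq hx h).1, (F.hopf_eq hx h).2, pinner_smul_left]
  · have hκ₂ : κ₂ = 0 :=
      F.eq_zero_of_pinner_gaussSpace hx h.2.2.2.2.1 ((F.hopf_eq hx h).2.symm.trans hk)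
    rw [hκ₂, smul_zero] at h
    exact hU (e.symm x) ⟨e, he, e.map_target hx, Y, hY, ex, ey, by rwa [e.right_inv hx]⟩

/-- A coordinate neighbourhood of `p` with a canonical lift of an isothermic Willmore surface and
its parallel vector `c`. -/
structure ParallelChart (y : M → Q31) (p : M) (e : OpenPartialHomeomorph M E2) (O : Set E2)
    (Y N E : E2 → Fin 5 → ℝ) (k : E2 → ℝ) (σ : ℝ) (c : Fin 5 → ℝ) : Prop
    extends IsothermicFrame O Y N E ex ey k σ 1 where
  atlas : e ∈ IsManifold.maximalAtlas (𝓡 2) ∞ M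
  mem_source : p ∈ e.source
  mem : e p ∈ O
  lift : IsLift y e O Y
  k_ne_zero : ∀ x ∈ O, k x ≠ 0
  σ_ne_zero : σ ≠ 0
  parallelVec_eq : ∀ x ∈ O, parallelVec Y N k (σ * 1) ex ey x = c

namespace ParallelChart

variable {y : M → Q31} {p : M} {e : OpenPartialHomeomorph M E2} {O : Set E2}
  {Y N E : E2 → Fin 5 → ℝ} {k : E2 → ℝ} {σ : ℝ} {c : Fin 5 → ℝ} {x : E2}

theorem pinner_E (D : ParallelChart y p e O Y N E k σ c) (hx : x ∈ O) : ⟪c, E x⟫ = 0 := by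
  rw [← D.parallelVec_eq x hx, D.pinner_parallelVec_E _ hx]

theorem pinner_Y (D : ParallelChart y p e O Y N E k σ c) (hx : x ∈ O) : ⟪c, Y x⟫ = k x := by
  rw [← D.parallelVec_eq x hx, D.pinner_parallelVec_Y _ hx]

theorem ne_zero (D : ParallelChart y p e O Y N E k σ c) : c ≠ 0 := by
  rintro rfl
  exact D.k_ne_zero _ D.mem ((D.pinner_Y D.mem).symm.trans (pinner_zero_left _))

end ParallelChart

theorem exists_parallelChart [T2Space M] {y : M → Q31} (hI : IsIsothermic y) (hW : IsWillmore y)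
    (p : M) : ∃ e O Y N E k σ c, ParallelChart y p e O Y N E k σ c := by
  obtain ⟨σ, hσ, hS⟩ : ∃ σ : ℝ, σ ≠ 0 ∧ IsSignedIsothermic σ y := by
    rcases hI with h | h
    exacts [⟨1, by norm_num, h⟩, ⟨-1, by norm_num, h⟩]
  obtain ⟨e, he, hp, Y, N, E, k, hY, F, hk⟩ := hS.exists_isothermicFrame p
  obtain ⟨ε, hε, hball⟩ := Metric.isOpen_iff.1 e.open_target (e p) (e.map_source hp)
  have F' := F.mono Metric.isOpen_ball hball
  exact ⟨e, Metric.ball (e p) ε, Y, N, E, k, σ, parallelVec Y N k (σ * 1) ex ey (e p),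
    { toIsothermicFrame := F'
      atlas := he
      mem_source := hp
      mem := Metric.mem_ball_self hε
      lift := ⟨hY.1.mono hball, fun x hx => hY.2 x (hball hx)⟩
      k_ne_zero := fun x hx => hk x (hball hx)
      σ_ne_zero := hσ
      parallelVec_eq := fun x hx => F'.parallelVec_eq hσ one_ne_zero
        (convex_ball (e p) ε).isPreconnected
        (fun z hz => hW.willmore_equation he hY F.toNullFrame (hball hz)) hx
        (Metric.mem_ball_self hε) }⟩

end Manifold

/-! ### Change of lift and coordinates -/

section Composition

variable {P Q F : Type*} [NormedAddCommGroup P] [NormedSpace ℝ P] [NormedAddCommGroup Q]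
  [NormedSpace ℝ Q] [NormedAddCommGroup F] [NormedSpace ℝ F]
  {O : Set Q} {O' : Set P} {f : Q → F} {φ : P → Q} {x : P}

theorem SmoothOn.comp (hf : SmoothOn O f) (hφ : SmoothOn O' φ) (h : Set.MapsTo φ O' O) :
    SmoothOn O' (fun x => f (φ x)) :=
  ⟨hφ.isOpen, hf.contDiffOn.comp hφ.contDiffOn h⟩

theorem dirDeriv_comp (hf : DifferentiableAt ℝ f (φ x)) (hφ : DifferentiableAt ℝ φ x) (ξ : P) :
    ∂[ξ] (fun x => f (φ x)) x = ∂[∂[ξ] φ x] f (φ x) :=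
  DFunLike.congr_fun (hf.hasFDerivAt.comp x hφ.hasFDerivAt).fderiv ξ

theorem dirDeriv_dirDeriv_comp (hf : SmoothOn O f) (hφ : SmoothOn O' φ) (h : Set.MapsTo φ O' O)
    (hx : x ∈ O') (ξ η : P) :
    ∂[η] (∂[ξ] (fun x => f (φ x))) x
      = ∂[∂[η] φ x] (∂[∂[ξ] φ x] f) (φ x) + ∂[∂[η] (∂[ξ] φ) x] f (φ x) := by
  have hDf : DifferentiableAt ℝ (fderiv ℝ f) (φ x) :=
    ((hf.contDiffAt (h hx)).fderiv_right (m := ∞) (by simp)).differentiableAt (by simp)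
  rw [dirDeriv_congr hφ.isOpen (fun z hz => dirDeriv_comp (hf.differentiableAt (h hz))
    (hφ.differentiableAt hz) ξ) hx, dirDeriv_dirDeriv_apply hf (h hx)]
  exact DFunLike.congr_fun ((hDf.hasFDerivAt.comp x (hφ.differentiableAt hx).hasFDerivAt).clm_apply
    (hφ.dirDeriv.differentiableAt hx).hasFDerivAt).fderiv η |>.trans (add_comm _ _)

end Composition

/-- The area of the parallelogram spanned by `p` and `q`. -/
def area (p q : E2) : ℝ := p 0 * q 1 - p 1 * q 0

theorem area_smul_add_smul (p q a b : E2) :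
    area (p 0 • a + p 1 • b) (q 0 • a + q 1 • b) = area p q * area a b := by
  simp only [area, PiLp.add_apply, PiLp.smul_apply, smul_eq_mul]
  ring

theorem area_ex_ey : area ex ey = 1 := by simp [area, ex, ey]

theorem area_dirDeriv_ne_zero {O O' : Set E2} {φ ψ : E2 → E2} {x : E2} (hψ : SmoothOn O ψ)
    (hφ : SmoothOn O' φ) (h : Set.MapsTo φ O' O) (hinv : ∀ x ∈ O', ψ (φ x) = x) (hx : x ∈ O') :
    area (∂[ex] φ x) (∂[ey] φ x) ≠ 0 := by
  have hcomp : ∀ ξ, (∂[ξ] φ x) 0 • ∂[ex] ψ (φ x) + (∂[ξ] φ x) 1 • ∂[ey] ψ (φ x) = ξ := fun ξ => by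
    rw [← dirDeriv_dir_smul_add_smul, ← eq_smul_ex_add_smul_ey,
      ← dirDeriv_comp (hψ.differentiableAt (h hx)) (hφ.differentiableAt hx),
      dirDeriv_congr (g := fun x => x) hφ.isOpen hinv hx]
    exact DFunLike.congr_fun fderiv_fun_id ξ
  refine left_ne_zero_of_mul (b := area (∂[ex] ψ (φ x)) (∂[ey] ψ (φ x))) ?_
  rw [← area_smul_add_smul, hcomp, hcomp, area_ex_ey]
  exact one_ne_zero

/-- The polarization `g(q, q) B(p, p) - 2 g(p, q) B(p, q) + g(p, p) B(q, q)` of the determinant of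
a symmetric form in the frame `(p, q)`. Its vanishing means that `B` is trace free with respect
to `g`. -/
def mixedDet (g B : LinearMap.BilinForm ℝ E2) (p q : E2) : ℝ :=
  g q q * B p p - 2 * g p q * B q p + g p p * B q q

theorem mixedDet_eq {g B : LinearMap.BilinForm ℝ E2} (hg : g.IsSymm) (hB : B.IsSymm) (p q : E2) :
    mixedDet g B p q = area p q ^ 2 * mixedDet g B ex ey := by
  have hg' : g ey ex = g ex ey := hg.eq _ _
  have hB' : B ex ey = B ey ex := hB.eq _ _
  rw [mixedDet, eq_smul_ex_add_smul_ey p, eq_smul_ex_add_smul_ey q, area_smul_add_smul, area_ex_ey]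
  simp only [map_add, map_smul, LinearMap.add_apply, LinearMap.smul_apply, smul_eq_mul, hg', hB']
  rw [mixedDet, area]
  ring

/-- The metric induced by `Z`. -/
def firstForm (Z : E2 → Fin 5 → ℝ) (x : E2) : LinearMap.BilinForm ℝ E2 :=
  (pinnerForm 5 2).compl₁₂ (fderiv ℝ Z x) (fderiv ℝ Z x)

/-- The component of the second derivative of `Z` in the direction of `v`. -/
def secondForm (Z : E2 → Fin 5 → ℝ) (x : E2) (v : Fin 5 → ℝ) : LinearMap.BilinForm ℝ E2 :=
  LinearMap.mk₂ ℝ (fun ξ η => ⟪v, fderiv ℝ (fderiv ℝ Z) x ξ η⟫)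
    (fun _ _ _ => by simp only [map_add, add_apply, pinner_add_right])
    (fun _ _ _ => by
      simp only [map_smul, smul_apply, pinner_smul_right, smul_eq_mul])
    (fun _ _ _ => by simp only [map_add, pinner_add_right])
    (fun _ _ _ => by simp only [map_smul, pinner_smul_right, smul_eq_mul])

section

variable {O : Set E2} {Z : E2 → Fin 5 → ℝ} {x : E2}

theorem firstForm_apply (Z : E2 → Fin 5 → ℝ) (x ξ η : E2) :
    firstForm Z x ξ η = ⟪∂[ξ] Z x, ∂[η] Z x⟫ := rfl

theorem secondForm_apply (hZ : SmoothOn O Z) (hx : x ∈ O) (v : Fin 5 → ℝ) (ξ η : E2) :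
    secondForm Z x v ξ η = ⟪v, ∂[ξ] (∂[η] Z) x⟫ := by
  rw [dirDeriv_dirDeriv_apply hZ hx]
  rfl

theorem firstForm_isSymm (Z : E2 → Fin 5 → ℝ) (x : E2) : (firstForm Z x).IsSymm :=
  ⟨fun _ _ => pinner_comm _ _⟩

theorem secondForm_isSymm (hZ : SmoothOn O Z) (hx : x ∈ O) (v : Fin 5 → ℝ) :
    (secondForm Z x v).IsSymm :=
  ⟨fun ξ η => by
    rw [secondForm_apply hZ hx, secondForm_apply hZ hx, dirDeriv_comm hZ hx]⟩

theorem mixedDet_firstForm_self (Z : E2 → Fin 5 → ℝ) (x : E2) :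
    mixedDet (firstForm Z x) (firstForm Z x) ex ey = 2 * metricDet 2 Z x := by
  simp only [mixedDet, firstForm_apply, pinner_comm (∂[ey] Z x) (∂[ex] Z x)]
  change _ = 2 * (⟪∂[ex] Z x, ∂[ex] Z x⟫ * ⟪∂[ey] Z x, ∂[ey] Z x⟫ - ⟪∂[ex] Z x, ∂[ey] Z x⟫ ^ 2)
  ring

end

/-- `v` is orthogonal to the bundle `V` of the lift `Z` at `x`: it is orthogonal to `Z` and its
derivatives, and the second fundamental form of `Z` in the direction of `v` is trace free. -/
structure IsGaussNormal (Z : E2 → Fin 5 → ℝ) (x : E2) (v : Fin 5 → ℝ) : Prop where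
  zero : ⟪v, Z x⟫ = 0
  deriv : ∀ ξ, ⟪v, ∂[ξ] Z x⟫ = 0
  trace : mixedDet (firstForm Z x) (secondForm Z x v) ex ey = 0

/-- The null lift `Z'` on `O'` is a multiple of the null lift `Z` on `O` after the change of
coordinates `φ`. -/
structure IsLiftChange (O O' : Set E2) (φ : E2 → E2) (r : E2 → ℝ) (Z Z' : E2 → Fin 5 → ℝ) :
    Prop where
  smooth_Z : SmoothOn O Z
  null : ∀ x ∈ O, ⟪Z x, Z x⟫ = 0
  smooth_φ : SmoothOn O' φ
  mapsTo : Set.MapsTo φ O' O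
  smooth_r : SmoothOn O' r
  eq : ∀ x ∈ O', Z' x = r x • Z (φ x)

namespace IsLiftChange

variable {O O' : Set E2} {φ : E2 → E2} {r : E2 → ℝ} {Z Z' : E2 → Fin 5 → ℝ} {x : E2}
  {v : Fin 5 → ℝ}

theorem smooth (h : IsLiftChange O O' φ r Z Z') : SmoothOn O' Z' :=
  (h.smooth_r.smul (h.smooth_Z.comp h.smooth_φ h.mapsTo)).congr h.eq

theorem dirDeriv_eq (h : IsLiftChange O O' φ r Z Z') (hx : x ∈ O') (ξ : E2) :
    ∂[ξ] Z' x = r x • ∂[∂[ξ] φ x] Z (φ x) + ∂[ξ] r x • Z (φ x) := by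
  rw [dirDeriv_congr h.smooth_φ.isOpen h.eq hx, dirDeriv_smul (h.smooth_r.differentiableAt hx)
    ((h.smooth_Z.comp h.smooth_φ h.mapsTo).differentiableAt hx),
    dirDeriv_comp (h.smooth_Z.differentiableAt (h.mapsTo hx)) (h.smooth_φ.differentiableAt hx)]

theorem firstForm_eq (h : IsLiftChange O O' φ r Z Z') (hx : x ∈ O') (ξ η : E2) :
    firstForm Z' x ξ η = r x ^ 2 * firstForm Z (φ x) (∂[ξ] φ x) (∂[η] φ x) := by
  have hZ : ∀ ζ, ⟪Z (φ x), ∂[ζ] Z (φ x)⟫ = 0 := fun ζ =>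
    pinner_dirDeriv_eq_zero h.smooth_Z h.null (h.mapsTo hx)
  rw [firstForm_apply, firstForm_apply, h.dirDeriv_eq hx, h.dirDeriv_eq hx]
  simp only [pinner_add_left, pinner_add_right, pinner_smul_left, pinner_smul_right, hZ,
    pinner_comm _ (Z (φ x)), h.null _ (h.mapsTo hx)]
  ring

theorem secondForm_eq (h : IsLiftChange O O' φ r Z Z') (hx : x ∈ O')
    (hv : IsGaussNormal Z (φ x) v) (ξ η : E2) :
    secondForm Z' x v ξ η = r x * secondForm Z (φ x) v (∂[ξ] φ x) (∂[η] φ x) := by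
  -- The scalar function `u = ⟪v, Z⟫` and its differential vanish at `φ x`, so only the second
  -- derivative of `u` survives in the second derivative of `⟪v, Z'⟫ = r * (u ∘ φ)`.
  have hφx := h.mapsTo hx
  have hu : SmoothOn O (fun z => ⟪v, Z z⟫) := (SmoothOn.const h.smooth_Z.isOpen v).pinner h.smooth_Z
  have hu' := hu.comp h.smooth_φ h.mapsTo
  have hdu : ∀ ζ, ∂[ζ] (fun z => ⟪v, Z z⟫) (φ x) = 0 := fun ζ => by
    rw [dirDeriv_pinner_const v (h.smooth_Z.differentiableAt hφx), hv.deriv]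
  have hddu : ∀ ζ θ, ∂[ζ] (∂[θ] (fun z => ⟪v, Z z⟫)) (φ x) = ⟪v, ∂[ζ] (∂[θ] Z) (φ x)⟫ :=
    fun ζ θ => by
    rw [dirDeriv_congr h.smooth_Z.isOpen (fun z hz => dirDeriv_pinner_const v
      (h.smooth_Z.differentiableAt hz)) hφx,
      dirDeriv_pinner_const v (h.smooth_Z.dirDeriv.differentiableAt hφx)]
  have hpull : ∀ z ∈ O', ⟪v, ∂[η] Z' z⟫
      = r z * ∂[η] (fun z => ⟪v, Z (φ z)⟫) z + ∂[η] r z * ⟪v, Z (φ z)⟫ := fun z hz => by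
    rw [← dirDeriv_pinner_const v (h.smooth.differentiableAt hz),
      dirDeriv_congr h.smooth_φ.isOpen (g := fun z => r z * ⟪v, Z (φ z)⟫)
        (fun w hw => by rw [h.eq w hw, pinner_smul_right]) hz,
      dirDeriv_mul (h.smooth_r.differentiableAt hz) (hu'.differentiableAt hz)]
  have hdu' : ∀ ζ, ∂[ζ] (fun z => ⟪v, Z (φ z)⟫) x = 0 := fun ζ => by
    rw [dirDeriv_comp (hu.differentiableAt hφx) (h.smooth_φ.differentiableAt hx), hdu]
  rw [secondForm_apply h.smooth hx, secondForm_apply h.smooth_Z hφx,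
    ← dirDeriv_pinner_const v (h.smooth.dirDeriv.differentiableAt hx),
    dirDeriv_congr h.smooth_φ.isOpen hpull hx,
    dirDeriv_add ((h.smooth_r.mul hu'.dirDeriv).differentiableAt hx)
      ((h.smooth_r.dirDeriv.mul hu').differentiableAt hx),
    dirDeriv_mul (h.smooth_r.differentiableAt hx) (hu'.dirDeriv.differentiableAt hx),
    dirDeriv_mul (h.smooth_r.dirDeriv.differentiableAt hx) (hu'.differentiableAt hx),
    dirDeriv_dirDeriv_comp hu h.smooth_φ h.mapsTo hx, hddu, hdu, hdu', hdu', hv.zero]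
  ring

theorem isGaussNormal (h : IsLiftChange O O' φ r Z Z') (hx : x ∈ O')
    (hv : IsGaussNormal Z (φ x) v) : IsGaussNormal Z' x v where
  zero := by rw [h.eq x hx, pinner_smul_right, hv.zero, mul_zero]
  deriv ξ := by
    rw [h.dirDeriv_eq hx, pinner_add_right, pinner_smul_right, pinner_smul_right, hv.deriv,
      hv.zero, mul_zero, mul_zero, add_zero]
  trace := by
    have hscale : mixedDet (firstForm Z' x) (secondForm Z' x v) ex ey = r x ^ 3 *
        mixedDet (firstForm Z (φ x)) (secondForm Z (φ x) v) (∂[ex] φ x) (∂[ey] φ x) := by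
      simp only [mixedDet, h.firstForm_eq hx, h.secondForm_eq hx hv]
      ring
    rw [hscale, mixedDet_eq (firstForm_isSymm ..) (secondForm_isSymm h.smooth_Z (h.mapsTo hx) v),
      hv.trace, mul_zero, mul_zero]

theorem metricDet_eq (h : IsLiftChange O O' φ r Z Z') (hx : x ∈ O') :
    metricDet 2 Z' x
      = (r x ^ 2 * area (∂[ex] φ x) (∂[ey] φ x)) ^ 2 * metricDet 2 Z (φ x) := by
  have hscale : mixedDet (firstForm Z' x) (firstForm Z' x) ex ey = r x ^ 4 *
      mixedDet (firstForm Z (φ x)) (firstForm Z (φ x)) (∂[ex] φ x) (∂[ey] φ x) := by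
    simp only [mixedDet, h.firstForm_eq hx]
    ring
  rw [mixedDet_eq (firstForm_isSymm Z _) (firstForm_isSymm Z _), mixedDet_firstForm_self,
    mixedDet_firstForm_self] at hscale
  linear_combination hscale / 2

end IsLiftChange

/-! ### The globally constant vector -/

section Overlap

variable {M : Type*} [TopologicalSpace M]

/-- The part of the target of `e₁` that the transition map to `e₂` maps into `O₂`. -/
def overlap (e₁ e₂ : OpenPartialHomeomorph M E2) (O₂ : Set E2) : Set E2 :=
  (e₁.target ∩ e₁.symm ⁻¹' e₂.source) ∩ (fun x => e₂ (e₁.symm x)) ⁻¹' O₂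

theorem mem_overlap {e₁ e₂ : OpenPartialHomeomorph M E2} {O₂ : Set E2} {m : M}
    (h₁ : m ∈ e₁.source) (h₂ : m ∈ e₂.source) (h : e₂ m ∈ O₂) : e₁ m ∈ overlap e₁ e₂ O₂ := by
  refine ⟨⟨e₁.map_source h₁, ?_⟩, ?_⟩ <;> rwa [Set.mem_preimage, e₁.left_inv h₁]

theorem exists_smul_of_isLift {y : M → Q31} {e₁ e₂ : OpenPartialHomeomorph M E2} {O₁ O₂ : Set E2}
    {Y₁ Y₂ : E2 → Fin 5 → ℝ} (h₁ : IsLift y e₁ O₁ Y₁) (h₂ : IsLift y e₂ O₂ Y₂) {x : E2}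
    (hx : x ∈ O₁) (hx' : x ∈ overlap e₁ e₂ O₂) : ∃ a : ℝ, Y₁ x = a • Y₂ (e₂ (e₁.symm x)) := by
  obtain ⟨_, hY₁⟩ := h₁.2 x hx
  obtain ⟨_, hY₂⟩ := h₂.2 _ hx'.2
  rw [e₂.left_inv hx'.1.2, hY₁, Projectivization.mk_eq_mk_iff'] at hY₂
  exact hY₂.imp fun _ => Eq.symm

variable [ChartedSpace E2 M] {e₁ e₂ : OpenPartialHomeomorph M E2} {O₁ O₂ : Set E2}

theorem smoothOn_transition (h₁ : e₁ ∈ IsManifold.maximalAtlas (𝓡 2) ∞ M)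
    (h₂ : e₂ ∈ IsManifold.maximalAtlas (𝓡 2) ∞ M) :
    SmoothOn (e₁.target ∩ e₁.symm ⁻¹' e₂.source) (fun x => e₂ (e₁.symm x)) := by
  refine ⟨e₁.isOpen_inter_preimage_symm e₂.open_source, ?_⟩
  rw [← contMDiffOn_iff_contDiffOn]
  exact (contMDiffOn_of_mem_maximalAtlas h₂).comp
    ((contMDiffOn_symm_of_mem_maximalAtlas h₁).mono Set.inter_subset_left) fun x hx => hx.2

theorem smoothOn_overlap (h₁ : e₁ ∈ IsManifold.maximalAtlas (𝓡 2) ∞ M)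
    (h₂ : e₂ ∈ IsManifold.maximalAtlas (𝓡 2) ∞ M) (hO : IsOpen O₂) :
    SmoothOn (overlap e₁ e₂ O₂) (fun x => e₂ (e₁.symm x)) := by
  have h := smoothOn_transition h₁ h₂
  exact h.mono (h.continuousOn.isOpen_inter_preimage h.isOpen hO) Set.inter_subset_left

theorem area_transition_ne_zero (h₁ : e₁ ∈ IsManifold.maximalAtlas (𝓡 2) ∞ M)
    (h₂ : e₂ ∈ IsManifold.maximalAtlas (𝓡 2) ∞ M) (hO : IsOpen O₂) {x : E2}
    (hx : x ∈ overlap e₁ e₂ O₂) :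
    area (∂[ex] (fun z => e₂ (e₁.symm z)) x) (∂[ey] (fun z => e₂ (e₁.symm z)) x) ≠ 0 := by
  refine area_dirDeriv_ne_zero (smoothOn_transition h₂ h₁) (smoothOn_overlap h₁ h₂ hO)
    (fun z hz => ⟨e₂.map_source hz.1.2, ?_⟩) (fun z hz => ?_) hx
  · rw [Set.mem_preimage, e₂.left_inv hz.1.2]
    exact e₁.map_target hz.1.1
  · rw [e₂.left_inv hz.1.2, e₁.right_inv hz.1.1]

end Overlap

namespace NullFrame

variable {M : Type*} [TopologicalSpace M] {O : Set E2} {Y N E : E2 → Fin 5 → ℝ} {x : E2}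

theorem metricDet_neg (F : NullFrame O Y N E ex ey) (hx : x ∈ O) : metricDet 2 Y x < 0 := by
  change ⟪∂[ex] Y x, ∂[ex] Y x⟫ * ⟪∂[ey] Y x, ∂[ey] Y x⟫ - ⟪∂[ex] Y x, ∂[ey] Y x⟫ ^ 2 < 0
  rw [(F.basis hx).AA, (F.basis hx).AB]
  norm_num

theorem mixedDet_eq (F : NullFrame O Y N E ex ey) (hx : x ∈ O) (v : Fin 5 → ℝ) :
    mixedDet (firstForm Y x) (secondForm Y x v) ex ey = -⟪v, ∂[ey] (∂[ex] Y) x⟫ := by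
  have h := F.basis hx
  simp only [mixedDet, firstForm_apply, secondForm_apply F.smooth_Y hx, h.AA, h.BB, h.AB]
  ring

theorem isGaussNormal (F : NullFrame O Y N E ex ey) (hx : x ∈ O) : IsGaussNormal Y x (E x) where
  zero := (F.basis hx).EY
  deriv ξ := by
    rw [eq_smul_ex_add_smul_ey ξ, dirDeriv_dir_smul_add_smul, pinner_add_right, pinner_smul_right,
      pinner_smul_right, (F.basis hx).EA, (F.basis hx).EB, mul_zero, mul_zero, add_zero]
  trace := by rw [F.mixedDet_eq hx, F.EYab hx, neg_zero]

theorem eq_smul_of_isGaussNormal (F : NullFrame O Y N E ex ey) (hx : x ∈ O) {v : Fin 5 → ℝ}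
    (hv : IsGaussNormal Y x v) : v = ⟪v, E x⟫ • E x := by
  have hab := hv.trace
  rw [F.mixedDet_eq hx, F.Yab_eq hx, pinner_add_right, pinner_smul_right, pinner_smul_right,
    hv.zero] at hab
  exact (F.basis hx).isBlockFrame.eq_smul hv.zero (by linarith) (hv.deriv ex) (hv.deriv ey)

theorem isLiftChange [ChartedSpace E2 M] {y : M → Q31} {e₁ e₂ : OpenPartialHomeomorph M E2}
    {O₁ O₂ : Set E2} {Y₁ Y₂ N₂ E₂ : E2 → Fin 5 → ℝ} (F : NullFrame O₂ Y₂ N₂ E₂ ex ey)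
    (h₁ : e₁ ∈ IsManifold.maximalAtlas (𝓡 2) ∞ M) (h₂ : e₂ ∈ IsManifold.maximalAtlas (𝓡 2) ∞ M)
    (hO₁ : IsOpen O₁) (hY₁ : IsLift y e₁ O₁ Y₁) (hY₂ : IsLift y e₂ O₂ Y₂) :
    IsLiftChange O₂ (O₁ ∩ overlap e₁ e₂ O₂) (fun x => e₂ (e₁.symm x))
      (fun x => -⟪Y₁ x, N₂ (e₂ (e₁.symm x))⟫) Y₂ Y₁ := by
  have hφ := smoothOn_overlap h₁ h₂ F.isOpen
  have hO : IsOpen (O₁ ∩ overlap e₁ e₂ O₂) := hO₁.inter hφ.isOpen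
  have hφ' := hφ.mono hO Set.inter_subset_right
  have hmaps : Set.MapsTo (fun x => e₂ (e₁.symm x)) (O₁ ∩ overlap e₁ e₂ O₂) O₂ :=
    fun x hx => hx.2.2
  refine ⟨F.smooth_Y, fun x hx => (F.basis hx).YY, hφ', hmaps,
    (((hY₁.smoothOn hO₁).mono hO Set.inter_subset_left).pinner (F.smooth_N.comp hφ' hmaps)).neg,
    fun x hx => ?_⟩
  obtain ⟨a, ha⟩ := exists_smul_of_isLift hY₁ hY₂ hx.1 hx.2
  rw [ha, pinner_smul_left, (F.basis (hmaps hx)).YN, mul_neg_one, neg_neg]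

end NullFrame

section Manifold

variable {M : Type*} [TopologicalSpace M] [ChartedSpace E2 M]

namespace ParallelChart

variable {y : M → Q31} {p q : M} {e₁ e₂ : OpenPartialHomeomorph M E2} {O₁ O₂ : Set E2}
  {Y₁ N₁ E₁ Y₂ N₂ E₂ : E2 → Fin 5 → ℝ} {k₁ k₂ : E2 → ℝ} {σ₁ σ₂ : ℝ} {c₁ c₂ : Fin 5 → ℝ}

theorem pinner_E_overlap (D₁ : ParallelChart y p e₁ O₁ Y₁ N₁ E₁ k₁ σ₁ c₁)
    (D₂ : ParallelChart y q e₂ O₂ Y₂ N₂ E₂ k₂ σ₂ c₂) {m : M} (h₁ : m ∈ e₁.source)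
    (h₂ : m ∈ e₂.source) (m₁ : e₁ m ∈ O₁) (m₂ : e₂ m ∈ O₂) : ⟪c₁, E₂ (e₂ m)⟫ = 0 := by
  have hnormal : IsGaussNormal Y₂ (e₂ (e₁.symm (e₁ m))) (E₂ (e₂ m)) := by
    rw [e₁.left_inv h₁]
    exact D₂.isGaussNormal m₂
  have hnormal' := (D₂.isLiftChange D₁.atlas D₂.atlas D₁.isOpen D₁.lift D₂.lift).isGaussNormal
    ⟨m₁, mem_overlap h₁ h₂ m₂⟩ hnormal
  rw [D₁.eq_smul_of_isGaussNormal m₁ hnormal', pinner_smul_right, D₁.pinner_E m₁, mul_zero]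

theorem exists_smul (D₁ : ParallelChart y p e₁ O₁ Y₁ N₁ E₁ k₁ σ₁ c₁)
    (D₂ : ParallelChart y q e₂ O₂ Y₂ N₂ E₂ k₂ σ₂ c₂) (h₁ : q ∈ e₁.source) (m₁ : e₁ q ∈ O₁) :
    ∃ a : ℝ, c₁ = a • c₂ := by
  have hφ := smoothOn_overlap D₂.atlas D₁.atlas D₁.isOpen
  have F := D₂.toIsothermicFrame.mono (D₂.isOpen.inter hφ.isOpen)
    (Set.inter_subset_left (t := overlap e₂ e₁ O₁))
  have hE : ∀ x ∈ O₂ ∩ overlap e₂ e₁ O₁, ⟪c₁, E₂ x⟫ = 0 := fun x hx => by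
    have h := D₁.pinner_E_overlap D₂ (m := e₂.symm x) hx.2.1.2 (e₂.map_target hx.2.1.1) hx.2.2
      (by rw [e₂.right_inv hx.2.1.1]; exact hx.1)
    rwa [e₂.right_inv hx.2.1.1] at h
  have h := F.eq_smul_parallelVec (fun x hx => D₂.k_ne_zero x hx.1) D₂.σ_ne_zero one_ne_zero hE
    ⟨D₂.mem, mem_overlap D₂.mem_source h₁ m₁⟩
  rw [D₂.parallelVec_eq _ D₂.mem] at h
  exact ⟨_, h⟩

end ParallelChart

theorem isLocallyConstant_span_parallelVec {y : M → Q31} {e : M → OpenPartialHomeomorph M E2}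
    {O : M → Set E2} {Y N E : M → E2 → Fin 5 → ℝ} {k : M → E2 → ℝ} {σ : M → ℝ}
    {c : M → Fin 5 → ℝ}
    (D : ∀ p, ParallelChart y p (e p) (O p) (Y p) (N p) (E p) (k p) (σ p) (c p)) :
    IsLocallyConstant fun p => Submodule.span ℝ {c p} := by
  refine (IsLocallyConstant.iff_exists_open _).2 fun p => ⟨(e p).source ∩ e p ⁻¹' O p,
    (e p).isOpen_inter_preimage (D p).isOpen, ⟨(D p).mem_source, (D p).mem⟩, fun q hq => ?_⟩
  obtain ⟨a, ha⟩ := (D p).exists_smul (D q) hq.1 hq.2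
  have ha₀ : a ≠ 0 := by
    rintro rfl
    exact (D p).ne_zero (by rw [ha, zero_smul])
  change Submodule.span ℝ {c q} = Submodule.span ℝ {c p}
  rw [ha, Submodule.span_singleton_smul_eq (IsUnit.mk0 a ha₀)]

/-- A coordinate neighbourhood of `p` with a canonical lift of `y` whose bundle `V` contains the
constant vector `c`. -/
structure AdaptedChart (y : M → Q31) (c : Fin 5 → ℝ) (p : M) (e : OpenPartialHomeomorph M E2)
    (O : Set E2) (Y N E : E2 → Fin 5 → ℝ) : Prop extends NullFrame O Y N E ex ey where
  atlas : e ∈ IsManifold.maximalAtlas (𝓡 2) ∞ M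
  mem_source : p ∈ e.source
  mem : e p ∈ O
  lift : IsLift y e O Y
  pinner_E : ∀ x ∈ O, ⟪c, E x⟫ = 0
  pinner_Y : ∀ x ∈ O, ⟪c, Y x⟫ ≠ 0

/-- `c` is a constant section of the bundle `V` of `y` and is nowhere orthogonal to the lifts
of `y`. -/
def HasParallelVector (y : M → Q31) (c : Fin 5 → ℝ) : Prop :=
  ∀ p, ∃ e O Y N E, AdaptedChart y c p e O Y N E

theorem exists_hasParallelVector [T2Space M] [ConnectedSpace M] {y : M → Q31} (hI : IsIsothermic y)
    (hW : IsWillmore y) :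
    ∃ c : Fin 5 → ℝ, c ≠ 0 ∧ HasParallelVector y c := by
  choose e O Y N E k σ c D using exists_parallelChart hI hW
  obtain ⟨p₀⟩ : Nonempty M := inferInstance
  refine ⟨c p₀, (D p₀).ne_zero, fun p => ?_⟩
  have hmem : c p₀ ∈ Submodule.span ℝ {c p} := by
    rw [← (isLocallyConstant_span_parallelVec D).apply_eq_of_preconnectedSpace p₀ p]
    exact Submodule.mem_span_singleton_self _
  obtain ⟨a, ha⟩ := Submodule.mem_span_singleton.1 hmem
  have ha₀ : a ≠ 0 := by
    rintro rfl
    exact (D p₀).ne_zero (by rw [← ha, zero_smul])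
  refine ⟨e p, O p, Y p, N p, E p, ⟨(D p).toNullFrame, (D p).atlas, (D p).mem_source, (D p).mem,
    (D p).lift, fun x hx => ?_, fun x hx => ?_⟩⟩
  · rw [← ha, pinner_smul_left, (D p).pinner_E hx, mul_zero]
  · rw [← ha, pinner_smul_left, (D p).pinner_Y hx]
    exact mul_ne_zero ha₀ ((D p).k_ne_zero x hx)

end Manifold

/-! ### The orthogonal group -/

theorem pinner_five (v w : Fin 5 → ℝ) :
    ⟪v, w⟫ = v 0 * w 0 + v 1 * w 1 + v 2 * w 2 - v 3 * w 3 - v 4 * w 4 := by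
  simp [pinner, Fin.sum_univ_five, sub_eq_add_neg]

theorem isReflective_pinnerForm {m s : ℕ} {u : Fin m → ℝ} (hu : pinner m s u u ≠ 0) :
    (pinnerForm m s).IsReflective u :=
  ⟨IsRegular.of_ne_zero hu, fun _ => (IsUnit.mk0 _ hu).dvd⟩

namespace O32

/-- The composition of two transformations: first `T`, then `S`. -/
def trans (T S : O32) : O32 where
  toEquiv := T.toEquiv.trans S.toEquiv
  pinner_map v w := by simp only [LinearEquiv.trans_apply, S.pinner_map, T.pinner_map]

/-- The reflection in the hyperplane orthogonal to `u`. -/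
def reflection (u : Fin 5 → ℝ) (hu : ⟪u, u⟫ ≠ 0) : O32 where
  toEquiv := Module.reflection ((isReflective_pinnerForm hu).coroot_apply_self (pinnerForm 5 2))
  pinner_map := (isReflective_pinnerForm hu).isOrthogonal_reflection (pinnerForm 5 2) ⟨pinner_comm⟩

theorem reflection_apply {u : Fin 5 → ℝ} (hu : ⟪u, u⟫ ≠ 0) (w : Fin 5 → ℝ) :
    (reflection u hu).toEquiv w = w - (2 * ⟪u, w⟫ / ⟪u, u⟫) • u := by
  have hcoroot := (isReflective_pinnerForm hu).apply_self_mul_coroot_apply (pinnerForm 5 2) (y := w)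
  rw [pinnerForm_apply, pinnerForm_apply] at hcoroot
  rw [← hcoroot, mul_div_cancel_left₀ _ hu]
  exact Module.reflection_apply w ((isReflective_pinnerForm hu).coroot_apply_self _)

variable {a b : Fin 5 → ℝ}

theorem exists_map_eq (h : ⟪a, a⟫ = ⟪b, b⟫) (hab : ⟪a - b, a - b⟫ ≠ 0) :
    ∃ T : O32, T.toEquiv a = b := by
  have hsub : ⟪a - b, a - b⟫ = 2 * ⟪a - b, a⟫ := by
    simp only [pinner_sub_left, pinner_sub_right, pinner_comm b a, h]
    ring
  refine ⟨reflection (a - b) hab, ?_⟩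
  rw [reflection_apply, ← hsub, div_self hab, one_smul, sub_sub_cancel]

theorem exists_map_eq_of_null (ha : ⟪a, a⟫ = 0) (hb : ⟪b, b⟫ = 0) (hab : ⟪a, b⟫ ≠ 0) :
    ∃ T : O32, T.toEquiv a = b := by
  refine exists_map_eq (ha.trans hb.symm) ?_
  simp only [pinner_sub_left, pinner_sub_right, pinner_comm b a, ha, hb]
  contrapose! hab
  linarith

theorem exists_map_eq_smul_of_ne (h : ⟪a, a⟫ = ⟪b, b⟫) (ha : ⟪a, a⟫ ≠ 0) :
    ∃ (T : O32) (r : ℝ), r ≠ 0 ∧ T.toEquiv a = r • b := by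
  by_cases hsub : ⟪a - b, a - b⟫ = 0
  · -- `⟨a - b, a - b⟩ + ⟨a + b, a + b⟩ = 4 ⟨a, a⟩`, so `a` can be reflected to `-b`.
    have hadd : ⟪a - -b, a - -b⟫ ≠ 0 := by
      simp only [pinner_sub_left, pinner_sub_right, pinner_neg_left, pinner_neg_right,
        pinner_comm b a] at hsub ⊢
      contrapose! ha
      linarith
    obtain ⟨T, hT⟩ := exists_map_eq (by rw [pinner_neg_left, pinner_neg_right, neg_neg, h]) hadd
    exact ⟨T, -1, by norm_num, by rw [hT, neg_one_smul]⟩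
  · obtain ⟨T, hT⟩ := exists_map_eq h hsub
    exact ⟨T, 1, one_ne_zero, by rw [hT, one_smul]⟩

theorem exists_map_eq_smul_of_sign (h : 0 < ⟪a, a⟫ * ⟪b, b⟫) :
    ∃ (T : O32) (r : ℝ), r ≠ 0 ∧ T.toEquiv a = r • b := by
  have ha : ⟪a, a⟫ ≠ 0 := left_ne_zero_of_mul h.ne'
  have hb : ⟪b, b⟫ ≠ 0 := right_ne_zero_of_mul h.ne'
  have hq : 0 < ⟪a, a⟫ / ⟪b, b⟫ := by
    rw [← mul_div_mul_right _ _ hb]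
    exact div_pos h (mul_self_pos.2 hb)
  have hlength : ⟪a, a⟫ = ⟪√(⟪a, a⟫ / ⟪b, b⟫) • b, √(⟪a, a⟫ / ⟪b, b⟫) • b⟫ := by
    rw [pinner_smul_smul, Real.sq_sqrt hq.le, div_mul_cancel₀ _ hb]
  obtain ⟨T, r, hr, hT⟩ := exists_map_eq_smul_of_ne hlength ha
  exact ⟨T, r * √(⟪a, a⟫ / ⟪b, b⟫), mul_ne_zero hr (Real.sqrt_pos.2 hq).ne', by
    rw [hT, smul_smul]⟩

theorem exists_pinner_ne_zero_of_null (ha : ⟪a, a⟫ = 0) (ha₀ : a ≠ 0) (h : a 0 = a 4) :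
    ∃ d, ⟪d, d⟫ = 0 ∧ ⟪a, d⟫ ≠ 0 ∧ ⟪d, ![-1, 0, 0, 0, -1]⟫ ≠ 0 := by
  by_contra! hd
  have horth : ∀ ε : ℝ, ε ^ 2 = 1 → a 0 = ε * a 3 := fun ε hε => by
    have hnull : ⟪![1, 0, 0, ε, 0], ![1, 0, 0, ε, 0]⟫ = 0 := by
      simp [pinner_five, ← sq, hε]
    by_contra hne
    have hzero := hd _ hnull (by
      simp only [pinner_five, Matrix.cons_val]
      contrapose! hne
      linarith)
    simp [pinner_five] at hzero
  have hplus := horth 1 (by norm_num)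
  have hminus := horth (-1) (by norm_num)
  have h0 : a 0 = 0 := by linarith
  have h3 : a 3 = 0 := by linarith
  rw [pinner_five, ← h, h0, h3] at ha
  have h1 : a 1 = 0 := by nlinarith [sq_nonneg (a 1), sq_nonneg (a 2)]
  have h2 : a 2 = 0 := by nlinarith [sq_nonneg (a 1), sq_nonneg (a 2)]
  refine ha₀ (funext fun i => ?_)
  fin_cases i
  exacts [h0, h1, h2, h3, h.symm.trans h0]

theorem exists_map_eq_null (ha : ⟪a, a⟫ = 0) (ha₀ : a ≠ 0) :
    ∃ T : O32, T.toEquiv a = ![-1, 0, 0, 0, -1] := by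
  have hb : ⟪![-1, 0, 0, 0, -1], ![-1, 0, 0, 0, -1]⟫ = 0 := by simp [pinner_five]
  by_cases hab : ⟪a, ![-1, 0, 0, 0, -1]⟫ = 0
  · have h : a 0 = a 4 := by
      simp only [pinner_five, Matrix.cons_val] at hab
      linarith
    obtain ⟨d, hd, had, hdb⟩ := exists_pinner_ne_zero_of_null ha ha₀ h
    obtain ⟨T, hT⟩ := exists_map_eq_of_null ha hd had
    obtain ⟨S, hS⟩ := exists_map_eq_of_null hd hb hdb
    exact ⟨T.trans S, (congrArg S.toEquiv hT).trans hS⟩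
  · exact exists_map_eq_of_null ha hb hab

end O32

section Transport

variable (T : O32) {O : Set E2} {Y N E : E2 → Fin 5 → ℝ}

theorem IsNullBasis.map {Y N A B E : Fin 5 → ℝ} (h : IsNullBasis Y N A B E) :
    IsNullBasis (T.toEquiv Y) (T.toEquiv N) (T.toEquiv A) (T.toEquiv B) (T.toEquiv E) := by
  constructor <;> rw [T.pinner_map]
  exacts [h.YY, h.NN, h.YN, h.YA, h.YB, h.NA, h.NB, h.AA, h.BB, h.AB, h.EE, h.EY, h.EN, h.EA, h.EB]

theorem SmoothOn.map (hY : SmoothOn O Y) : SmoothOn O (fun x => T.toEquiv (Y x)) :=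
  hY.clm T.toEquiv.toContinuousLinearEquiv.toContinuousLinearMap

theorem dirDeriv_map (hY : SmoothOn O Y) {x : E2} (hx : x ∈ O) (ξ : E2) :
    ∂[ξ] (fun x => T.toEquiv (Y x)) x = T.toEquiv (∂[ξ] Y x) :=
  dirDeriv_clm T.toEquiv.toContinuousLinearEquiv.toContinuousLinearMap (hY.differentiableAt hx)

theorem NullFrame.map {a b : E2} (F : NullFrame O Y N E a b) :
    NullFrame O (fun x => T.toEquiv (Y x)) (fun x => T.toEquiv (N x)) (fun x => T.toEquiv (E x))
      a b where
  smooth_Y := F.smooth_Y.map T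
  smooth_N := F.smooth_N.map T
  smooth_E := F.smooth_E.map T
  basis x hx := by
    rw [dirDeriv_map T F.smooth_Y hx, dirDeriv_map T F.smooth_Y hx]
    exact (F.basis hx).map T
  EYab x hx := by
    rw [dirDeriv_congr F.isOpen (fun z hz => dirDeriv_map T F.smooth_Y hz a) hx,
      dirDeriv_map T F.smooth_Ya hx, T.pinner_map, F.EYab hx]

variable {M : Type*} [TopologicalSpace M] {y : M → Q31} {e : OpenPartialHomeomorph M E2}
  {c c' : Fin 5 → ℝ}

theorem IsLift.act (hO : IsOpen O) (hY : IsLift y e O Y) :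
    IsLift (fun p => T.act (y p)) e O (fun x => T.toEquiv (Y x)) := by
  refine ⟨((hY.smoothOn hO).map T).contDiffOn, fun x hx =>
    ⟨T.toEquiv.map_ne_zero_iff.2 (hY.ne_zero hx), ?_⟩⟩
  change Projectivization.map T.toEquiv.toLinearMap T.toEquiv.injective (y (e.symm x)).1 = _
  rw [hY.coe_eq hx, Projectivization.map_mk]
  rfl

variable [ChartedSpace E2 M]

theorem HasParallelVector.act (h : HasParallelVector y c) {r : ℝ} (hr : r ≠ 0)
    (hT : T.toEquiv c = r • c') : HasParallelVector (fun p => T.act (y p)) c' := by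
  have hpinner : ∀ w, ⟪c', T.toEquiv w⟫ = r⁻¹ * ⟪c, w⟫ := fun w => by
    rw [← T.pinner_map c w, hT, pinner_smul_left, inv_mul_cancel_left₀ hr]
  intro p
  obtain ⟨e, O, Y, N, E, D⟩ := h p
  refine ⟨e, O, _, _, _, D.toNullFrame.map T, D.atlas, D.mem_source, D.mem, D.lift.act T D.isOpen,
    fun x hx => ?_, fun x hx => ?_⟩
  · rw [hpinner, D.pinner_E x hx, mul_zero]
  · rw [hpinner]
    exact mul_ne_zero (inv_ne_zero hr) (D.pinner_Y x hx)

end Transport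

/-! ### Minimal surfaces in the space forms -/

namespace Q31

variable {c : Fin 5 → ℝ} {q : Q31}

/-- The representative `v` of `q` with `⟨c, v⟩ = 1`; it is `0` if `q` is orthogonal to `c`. -/
def normalize (c : Fin 5 → ℝ) (q : Q31) : Fin 5 → ℝ := ⟪c, q.1.rep⟫⁻¹ • q.1.rep

theorem normalize_eq {v : Fin 5 → ℝ} {hv : v ≠ 0} (h : q.1 = Projectivization.mk ℝ v hv) :
    q.normalize c = ⟪c, v⟫⁻¹ • v := by
  obtain ⟨a, ha⟩ := Projectivization.exists_smul_eq_mk_rep ℝ v hv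
  rw [normalize, h, ← ha, Units.smul_def, pinner_smul_right, smul_smul, mul_inv_rev, mul_assoc,
    inv_mul_cancel₀ a.ne_zero, mul_one]

theorem pinner_normalize_self (c : Fin 5 → ℝ) (q : Q31) :
    ⟪q.normalize c, q.normalize c⟫ = 0 := by
  have hrep : ⟪q.1.rep, q.1.rep⟫ = 0 := q.2 _ (by
    rw [Projectivization.submodule_eq]
    exact Submodule.mem_span_singleton_self _)
  rw [normalize, pinner_smul_smul, hrep, mul_zero]

theorem eq_mk_of_eq_normalize {v : Fin 5 → ℝ} (h : v = q.normalize c) (hv : v ≠ 0)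
    (hnull : ⟪v, v⟫ = 0) : q = Q31.mk v hv hnull := by
  refine Subtype.ext ?_
  change q.1 = Projectivization.mk ℝ v hv
  rw [← q.1.mk_rep, Projectivization.mk_eq_mk_iff']
  have hc : ⟪c, q.1.rep⟫ ≠ 0 := fun h₀ => hv (by rw [h, normalize, h₀, inv_zero, zero_smul])
  exact ⟨⟪c, q.1.rep⟫, by rw [h, normalize, smul_inv_smul₀ hc]⟩

end Q31

/-- `W` is, near `x`, a timelike surface in the section of the light cone by `⟨c, ·⟩ = 1`, and `E`
is a unit vector that is orthogonal to `c` and to the bundle `V` of `W` at `x`. -/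
structure NormalizedLift (c : Fin 5 → ℝ) (W : E2 → Fin 5 → ℝ) (O : Set E2) (x : E2)
    (E : Fin 5 → ℝ) : Prop where
  smooth : SmoothOn O W
  mem : x ∈ O
  null : ∀ z ∈ O, ⟪W z, W z⟫ = 0
  pinner_W : ∀ z ∈ O, ⟪c, W z⟫ = 1
  metricDet_neg : metricDet 2 W x < 0
  EE : ⟪E, E⟫ = 1
  cE : ⟪c, E⟫ = 0
  normal : IsGaussNormal W x E

/-- The hyperplane section `{V | ⟨c, V⟩ = 1}` of the light cone is mapped by `π` to the space form
in `ℝ^m_s` with tangent spaces `T`: `π` is isometric on the tangent vectors of the section, and the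
tangent vectors of the space form come from vectors orthogonal to `c` and `V`. -/
structure IsSpaceForm (m s : ℕ) (c : Fin 5 → ℝ) (π : (Fin 5 → ℝ) →L[ℝ] (Fin m → ℝ))
    (T : (Fin m → ℝ) → Set (Fin m → ℝ)) : Prop where
  isometry : ∀ v w, ⟪c, v⟫ = 0 → ⟪c, w⟫ = 0 → pinner m s (π v) (π w) = ⟪v, w⟫
  exists_eq : ∀ V ν, ⟪c, V⟫ = 1 → ν ∈ T (π V) →
    ∃ n, ⟪n, c⟫ = 0 ∧ ⟪n, V⟫ = 0 ∧ ∀ w, ⟪c, w⟫ = 0 → pinner m s ν (π w) = ⟪n, w⟫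

namespace NormalizedLift

variable {c : Fin 5 → ℝ} {W : E2 → Fin 5 → ℝ} {O : Set E2} {x z : E2} {E : Fin 5 → ℝ}

theorem pinner_dirDeriv (h : NormalizedLift c W O x E) (hz : z ∈ O) (ξ : E2) :
    ⟪c, ∂[ξ] W z⟫ = 0 := by
  rw [← dirDeriv_pinner_const c (h.smooth.differentiableAt hz),
    dirDeriv_eq_zero h.smooth.isOpen h.pinner_W hz]

theorem pinner_dirDeriv_dirDeriv (h : NormalizedLift c W O x E) (ξ η : E2) :
    ⟪c, ∂[η] (∂[ξ] W) x⟫ = 0 := by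
  rw [← dirDeriv_pinner_const c (h.smooth.dirDeriv.differentiableAt h.mem),
    dirDeriv_eq_zero h.smooth.isOpen (fun z hz => h.pinner_dirDeriv hz ξ) h.mem]

theorem isBlockFrame (h : NormalizedLift c W O x E) :
    IsBlockFrame (W x) c (∂[ex] W x) (∂[ey] W x) E where
  aa := h.null x h.mem
  ab := by rw [pinner_comm, h.pinner_W x h.mem]; exact one_ne_zero
  ac := pinner_dirDeriv_eq_zero h.smooth h.null h.mem
  ad := pinner_dirDeriv_eq_zero h.smooth h.null h.mem
  cd := h.metricDet_neg.ne
  ee := h.EE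
  ea := h.normal.zero
  eb := (pinner_comm E c).trans h.cE
  ec := h.normal.deriv ex
  ed := h.normal.deriv ey

variable {m s : ℕ} {π : (Fin 5 → ℝ) →L[ℝ] (Fin m → ℝ)} {T : (Fin m → ℝ) → Set (Fin m → ℝ)}
  {ν : Fin m → ℝ}

theorem dirDeriv_proj (h : NormalizedLift c W O x E) (π : (Fin 5 → ℝ) →L[ℝ] (Fin m → ℝ))
    (hz : z ∈ O) (ξ : E2) : ∂[ξ] (fun z => π (W z)) z = π (∂[ξ] W z) :=
  dirDeriv_clm π (h.smooth.differentiableAt hz)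

theorem dirDeriv_dirDeriv_proj (h : NormalizedLift c W O x E)
    (π : (Fin 5 → ℝ) →L[ℝ] (Fin m → ℝ)) (ξ η : E2) :
    ∂[η] (∂[ξ] (fun z => π (W z))) x = π (∂[η] (∂[ξ] W) x) := by
  rw [dirDeriv_congr h.smooth.isOpen (fun z hz => h.dirDeriv_proj π hz ξ) h.mem,
    dirDeriv_clm π (h.smooth.dirDeriv.differentiableAt h.mem)]

theorem pinner_dirDeriv_proj (h : NormalizedLift c W O x E) (hπ : IsSpaceForm m s c π T)
    (ξ η : E2) : pinner m s (∂[ξ] (fun z => π (W z)) x) (∂[η] (fun z => π (W z)) x)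
      = ⟪∂[ξ] W x, ∂[η] W x⟫ := by
  rw [h.dirDeriv_proj π h.mem, h.dirDeriv_proj π h.mem,
    hπ.isometry _ _ (h.pinner_dirDeriv h.mem ξ) (h.pinner_dirDeriv h.mem η)]

theorem metricDet_proj (h : NormalizedLift c W O x E) (hπ : IsSpaceForm m s c π T) :
    metricDet s (fun z => π (W z)) x = metricDet 2 W x :=
  congrArg₂ (· - ·)
    (congrArg₂ (· * ·) (h.pinner_dirDeriv_proj hπ ex ex) (h.pinner_dirDeriv_proj hπ ey ey))
    (congrArg (· ^ 2) (h.pinner_dirDeriv_proj hπ ex ey))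

theorem exists_pinner_proj_eq (h : NormalizedLift c W O x E) (hπ : IsSpaceForm m s c π T)
    (hν : ν ∈ T (π (W x))) (hνx : pinner m s ν (∂[ex] (fun z => π (W z)) x) = 0)
    (hνy : pinner m s ν (∂[ey] (fun z => π (W z)) x) = 0) :
    ∃ r : ℝ, ∀ w, ⟪c, w⟫ = 0 → pinner m s ν (π w) = r * ⟪E, w⟫ := by
  obtain ⟨n, hnc, hnW, hn⟩ := hπ.exists_eq (W x) ν (h.pinner_W x h.mem) hν
  rw [h.dirDeriv_proj π h.mem, hn _ (h.pinner_dirDeriv h.mem _)] at hνx hνy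
  refine ⟨⟪n, E⟫, fun w hw => ?_⟩
  rw [hn w hw, ← pinner_smul_left, ← h.isBlockFrame.eq_smul hnW hnc hνx hνy]

theorem meanCurvature_eq_zero (h : NormalizedLift c W O x E) (hπ : IsSpaceForm m s c π T)
    (hν : ν ∈ T (π (W x))) (hνx : pinner m s ν (∂[ex] (fun z => π (W z)) x) = 0)
    (hνy : pinner m s ν (∂[ey] (fun z => π (W z)) x) = 0) :
    meanCurvature s (fun z => π (W z)) x ν = 0 := by
  obtain ⟨r, hr⟩ := h.exists_pinner_proj_eq hπ hν hνx hνy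
  have hsecond : ∀ ξ η, pinner m s (∂[η] (∂[ξ] (fun z => π (W z))) x) ν
      = r * secondForm W x E η ξ := fun ξ η => by
    rw [h.dirDeriv_dirDeriv_proj, pinner_comm, hr _ (h.pinner_dirDeriv_dirDeriv ξ η),
      secondForm_apply h.smooth h.mem]
  have hnum : pinner m s (∂[ey] (fun z => π (W z)) x) (∂[ey] (fun z => π (W z)) x)
        * pinner m s (∂[ex] (∂[ex] (fun z => π (W z))) x) ν
      - 2 * pinner m s (∂[ex] (fun z => π (W z)) x) (∂[ey] (fun z => π (W z)) x)
        * pinner m s (∂[ey] (∂[ex] (fun z => π (W z))) x) ν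
      + pinner m s (∂[ex] (fun z => π (W z)) x) (∂[ex] (fun z => π (W z)) x)
        * pinner m s (∂[ey] (∂[ey] (fun z => π (W z))) x) ν
      = r * mixedDet (firstForm W x) (secondForm W x E) ex ey := by
    simp only [h.pinner_dirDeriv_proj hπ, hsecond, mixedDet, firstForm_apply]
    ring
  rw [h.normal.trace, mul_zero] at hnum
  exact (congrArg (· / (2 * metricDet s (fun z => π (W z)) x)) hnum).trans (zero_div _)

end NormalizedLift

section Main

variable {M : Type*} [TopologicalSpace M] [ChartedSpace E2 M] {y : M → Q31} {c : Fin 5 → ℝ}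
  {e : OpenPartialHomeomorph M E2}

theorem AdaptedChart.isLiftChange_normalize {p : M} {e' : OpenPartialHomeomorph M E2} {O : Set E2}
    {Y N E : E2 → Fin 5 → ℝ} (D : AdaptedChart y c p e' O Y N E)
    (he : e ∈ IsManifold.maximalAtlas (𝓡 2) ∞ M) :
    IsLiftChange O (overlap e e' O) (fun z => e' (e.symm z)) (fun z => ⟪c, Y (e' (e.symm z))⟫⁻¹)
      Y (fun z => (y (e.symm z)).normalize c) := by
  have hφ := smoothOn_overlap he D.atlas D.isOpen
  have hmaps : Set.MapsTo (fun z => e' (e.symm z)) (overlap e e' O) O := fun z hz => hz.2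
  have hpinner := SmoothOn.pinner (s := 2) (SmoothOn.const hφ.isOpen c) (D.smooth_Y.comp hφ hmaps)
  refine ⟨D.smooth_Y, fun x hx => (D.basis hx).YY, hφ, hmaps,
    ⟨hφ.isOpen, hpinner.contDiffOn.inv fun z hz => D.pinner_Y _ (hmaps hz)⟩, fun z hz => ?_⟩
  have hmk := D.lift.coe_eq (hmaps hz)
  rw [e'.left_inv hz.1.2] at hmk
  exact Q31.normalize_eq hmk

namespace HasParallelVector

theorem pinner_normalize (h : HasParallelVector y c) (p : M) : ⟪c, (y p).normalize c⟫ = 1 := by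
  obtain ⟨e, O, Y, N, E, D⟩ := h p
  have hmk := D.lift.coe_eq D.mem
  rw [e.left_inv D.mem_source] at hmk
  rw [Q31.normalize_eq hmk, pinner_smul_right, inv_mul_cancel₀ (D.pinner_Y _ D.mem)]

theorem exists_normalizedLift (h : HasParallelVector y c)
    (he : e ∈ IsManifold.maximalAtlas (𝓡 2) ∞ M) {x : E2} (hx : x ∈ e.target) :
    ∃ O E, NormalizedLift c (fun z => (y (e.symm z)).normalize c) O x E := by
  obtain ⟨e', O, Y, N, E, D⟩ := h (e.symm x)
  have hchange := D.isLiftChange_normalize he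
  have hx' : x ∈ overlap e e' O := ⟨⟨hx, D.mem_source⟩, D.mem⟩
  refine ⟨overlap e e' O, E (e' (e.symm x)),
    { smooth := hchange.smooth
      mem := hx'
      null := fun z _ => Q31.pinner_normalize_self c _
      pinner_W := fun z _ => h.pinner_normalize _
      metricDet_neg := ?_
      EE := (D.basis D.mem).EE
      cE := D.pinner_E _ D.mem
      normal := hchange.isGaussNormal hx' (D.isGaussNormal D.mem) }⟩
  rw [hchange.metricDet_eq hx']
  have hr := inv_ne_zero (D.pinner_Y _ D.mem)
  have harea := area_transition_ne_zero he D.atlas D.isOpen hx'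
  exact mul_neg_of_pos_of_neg (sq_pos_of_ne_zero (mul_ne_zero (pow_ne_zero 2 hr) harea))
    (D.metricDet_neg D.mem)

variable {m s : ℕ} {π : (Fin 5 → ℝ) →L[ℝ] (Fin m → ℝ)} {T : (Fin m → ℝ) → Set (Fin m → ℝ)}
  [IsManifold (𝓡 2) ∞ M]

theorem contMDiff_proj_normalize (h : HasParallelVector y c)
    (π : (Fin 5 → ℝ) →L[ℝ] (Fin m → ℝ)) :
    ContMDiff (𝓡 2) 𝓘(ℝ, Fin m → ℝ) ∞ (fun p => π ((y p).normalize c)) := by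
  intro p
  have he := IsManifold.chart_mem_maximalAtlas (I := 𝓡 2) (n := ∞) p
  have hp := mem_chart_source E2 p
  obtain ⟨O, E, hL⟩ := h.exists_normalizedLift he ((chartAt E2 p).map_source hp)
  have hchart : ContMDiffAt (𝓡 2) (𝓡 2) ∞ (chartAt E2 p) p :=
    (contMDiffOn_of_mem_maximalAtlas he).contMDiffAt (chart_source_mem_nhds E2 p)
  refine (ContMDiffAt.comp p ((hL.smooth.clm π).contDiffAt hL.mem).contMDiffAt hchart
    ).congr_of_eventuallyEq ?_
  filter_upwards [chart_source_mem_nhds E2 p] with q hq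
  exact congrArg (fun q => π ((y q).normalize c)) ((chartAt E2 p).left_inv hq).symm

theorem isTimelikeMinimal (h : HasParallelVector y c) (hπ : IsSpaceForm m s c π T) :
    IsTimelikeMinimal s T (fun p => π ((y p).normalize c)) := by
  refine ⟨h.contMDiff_proj_normalize π, fun e he x hx => ?_⟩
  obtain ⟨O, E, hL⟩ := h.exists_normalizedLift he hx
  exact ⟨(hL.metricDet_proj hπ).trans_lt hL.metricDet_neg,
    fun ν hν _ hνx hνy => hL.meanCurvature_eq_zero hπ hν hνx hνy⟩

end HasParallelVector

end Main

/-- The projection `ℝ⁵ → ℝᵐ` to the coordinates in the range of `f`. -/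
def coordProj {m : ℕ} (f : Fin m → Fin 5) : (Fin 5 → ℝ) →L[ℝ] (Fin m → ℝ) :=
  ContinuousLinearMap.pi fun i => ContinuousLinearMap.proj (f i)

theorem coordProj_apply {m : ℕ} (f : Fin m → Fin 5) (v : Fin 5 → ℝ) (i : Fin m) :
    coordProj f v i = v (f i) := rfl

theorem pinner_three_one (v w : Fin 3 → ℝ) :
    pinner 3 1 v w = v 0 * w 0 + v 1 * w 1 - v 2 * w 2 := by
  simp [pinner, Fin.sum_univ_three, sub_eq_add_neg]

theorem pinner_four_one (v w : Fin 4 → ℝ) :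
    pinner 4 1 v w = v 0 * w 0 + v 1 * w 1 + v 2 * w 2 - v 3 * w 3 := by
  simp [pinner, Fin.sum_univ_four, sub_eq_add_neg]

theorem pinner_four_two (v w : Fin 4 → ℝ) :
    pinner 4 2 v w = v 0 * w 0 + v 1 * w 1 - v 2 * w 2 - v 3 * w 3 := by
  simp [pinner, Fin.sum_univ_four, sub_eq_add_neg]

theorem isSpaceForm_R : IsSpaceForm 3 1 ![-1, 0, 0, 0, -1] (coordProj ![1, 2, 3])
    (fun _ => Set.univ) where
  isometry v w hv hw := by
    simp only [pinner_five, pinner_three_one, coordProj_apply, Matrix.cons_val] at *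
    linear_combination w 0 * hv + v 4 * hw
  exists_eq V ν hV _ := by
    -- The two equal entries lie along `c`, which is null and so orthogonal to all `w ⟂ c`.
    set t := ν 0 * V 1 + ν 1 * V 2 - ν 2 * V 3 with ht
    refine ⟨![t, ν 0, ν 1, ν 2, t], ?_, ?_, fun w hw => ?_⟩ <;>
      simp only [pinner_five, pinner_three_one, coordProj_apply, Matrix.cons_val] at *
    · ring
    · linear_combination -t * hV - ht
    · linear_combination t * hw

theorem isSpaceForm_S : IsSpaceForm 4 1 ![0, 0, 0, 0, -1] (coordProj ![0, 1, 2, 3])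
    (fun a => {ν | pinner 4 1 a ν = 0}) where
  isometry v w hv hw := by
    simp only [pinner_five, pinner_four_one, coordProj_apply, Matrix.cons_val] at *
    linear_combination v 4 * hw
  exists_eq V ν _ hν := by
    refine ⟨![ν 0, ν 1, ν 2, ν 3, 0], ?_, ?_, fun w _ => ?_⟩ <;>
      simp only [Set.mem_ofPred_eq, pinner_five, pinner_four_one, coordProj_apply,
        Matrix.cons_val] at *
    · ring
    · linear_combination hν
    · ring

theorem isSpaceForm_H : IsSpaceForm 4 2 ![1, 0, 0, 0, 0] (coordProj ![1, 2, 3, 4])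
    (fun a => {ν | pinner 4 2 a ν = 0}) where
  isometry v w hv hw := by
    simp only [pinner_five, pinner_four_two, coordProj_apply, Matrix.cons_val] at *
    linear_combination -v 0 * hw
  exists_eq V ν _ hν := by
    refine ⟨![0, ν 0, ν 1, ν 2, ν 3], ?_, ?_, fun w _ => ?_⟩ <;>
      simp only [Set.mem_ofPred_eq, pinner_five, pinner_four_two, coordProj_apply,
        Matrix.cons_val] at *
    · ring
    · linear_combination hν
    · ring

namespace HasParallelVector

variable {M : Type*} [TopologicalSpace M] [ChartedSpace E2 M] [IsManifold (𝓡 2) ∞ M] {y : M → Q31}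

theorem exists_isMinimalR (h : HasParallelVector y ![-1, 0, 0, 0, -1]) :
    ∃ x : M → R31, IsMinimalR x ∧ ∀ p, y p = phiR (x p) := by
  refine ⟨_, h.isTimelikeMinimal isSpaceForm_R,
    fun p => Q31.eq_mk_of_eq_normalize (c := ![-1, 0, 0, 0, -1]) ?_ _ _⟩
  have hnull := Q31.pinner_normalize_self ![-1, 0, 0, 0, -1] (y p)
  have hone := h.pinner_normalize p
  set V := (y p).normalize ![-1, 0, 0, 0, -1]
  simp only [pinner_five, Matrix.cons_val] at hnull hone
  have hπ : pinner 3 1 (coordProj ![1, 2, 3] V) (coordProj ![1, 2, 3] V) = V 0 + V 4 := by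
    simp only [pinner_three_one, coordProj_apply, Matrix.cons_val]
    linear_combination hnull + (V 0 + V 4) * hone
  rw [hπ]
  funext i
  fin_cases i
  · change (-1 + (V 0 + V 4)) / 2 = V 0
    linear_combination hone / 2
  · rfl
  · rfl
  · rfl
  · change (1 + (V 0 + V 4)) / 2 = V 4
    linear_combination -hone / 2

theorem exists_isMinimalS (h : HasParallelVector y ![0, 0, 0, 0, -1]) :
    ∃ x : M → S31, IsMinimalS x ∧ ∀ p, y p = phiS (x p) := by
  have hone : ∀ p, (y p).normalize ![0, 0, 0, 0, -1] 4 = 1 := fun p => by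
    simpa [pinner_five] using h.pinner_normalize p
  refine ⟨fun p => ⟨coordProj ![0, 1, 2, 3] ((y p).normalize ![0, 0, 0, 0, -1]), ?_⟩,
    h.isTimelikeMinimal isSpaceForm_S,
    fun p => Q31.eq_mk_of_eq_normalize (c := ![0, 0, 0, 0, -1]) ?_ _ _⟩
  · change pinner 4 1 _ _ = 1
    have hnull := Q31.pinner_normalize_self ![0, 0, 0, 0, -1] (y p)
    rw [pinner_five, hone] at hnull
    simp only [pinner_four_one, coordProj_apply, Matrix.cons_val]
    linear_combination hnull
  · funext i
    fin_cases i
    exacts [rfl, rfl, rfl, rfl, (hone p).symm]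

theorem exists_isMinimalH (h : HasParallelVector y ![1, 0, 0, 0, 0]) :
    ∃ x : M → H31, IsMinimalH x ∧ ∀ p, y p = phiH (x p) := by
  have hone : ∀ p, (y p).normalize ![1, 0, 0, 0, 0] 0 = 1 := fun p => by
    simpa [pinner_five] using h.pinner_normalize p
  refine ⟨fun p => ⟨coordProj ![1, 2, 3, 4] ((y p).normalize ![1, 0, 0, 0, 0]), ?_⟩,
    h.isTimelikeMinimal isSpaceForm_H,
    fun p => Q31.eq_mk_of_eq_normalize (c := ![1, 0, 0, 0, 0]) ?_ _ _⟩
  · change pinner 4 2 _ _ = -1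
    have hnull := Q31.pinner_normalize_self ![1, 0, 0, 0, 0] (y p)
    rw [pinner_five, hone] at hnull
    simp only [pinner_four_two, coordProj_apply, Matrix.cons_val]
    linear_combination hnull
  · funext i
    fin_cases i
    exacts [(hone p).symm, rfl, rfl, rfl, rfl]

end HasParallelVector

end TimelikeSurface

end

theorem theoremB {M : Type*} [TopologicalSpace M] [T2Space M] [ConnectedSpace M]
    [ChartedSpace TimelikeSurface.E2 M] [IsManifold (𝓡 2) ∞ M]
    (y : M → TimelikeSurface.Q31)
    (hI : TimelikeSurface.IsIsothermic y) (hW : TimelikeSurface.IsWillmore y) :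
    ∃ T : TimelikeSurface.O32,
      (∃ x : M → TimelikeSurface.R31, TimelikeSurface.IsMinimalR x ∧
        ∀ p, T.act (y p) = TimelikeSurface.phiR (x p)) ∨
      (∃ x : M → TimelikeSurface.S31, TimelikeSurface.IsMinimalS x ∧
        ∀ p, T.act (y p) = TimelikeSurface.phiS (x p)) ∨
      (∃ x : M → TimelikeSurface.H31, TimelikeSurface.IsMinimalH x ∧
        ∀ p, T.act (y p) = TimelikeSurface.phiH (x p)) := by
  obtain ⟨c, hc₀, h⟩ := TimelikeSurface.exists_hasParallelVector hI hW
  rcases lt_trichotomy (TimelikeSurface.pinner 5 2 c c) 0 with hc | hc | hc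
  · obtain ⟨T, r, hr, hT⟩ := TimelikeSurface.O32.exists_map_eq_smul_of_sign (a := c)
      (b := ![0, 0, 0, 0, -1]) (by simpa [TimelikeSurface.pinner_five] using hc)
    exact ⟨T, Or.inr (Or.inl (h.act T hr hT).exists_isMinimalS)⟩
  · obtain ⟨T, hT⟩ := TimelikeSurface.O32.exists_map_eq_null hc hc₀
    have hT₁ : T.toEquiv c = (1 : ℝ) • ![-1, 0, 0, 0, -1] := by rw [hT, one_smul]
    exact ⟨T, Or.inl (h.act T one_ne_zero hT₁).exists_isMinimalR⟩
  · obtain ⟨T, r, hr, hT⟩ := TimelikeSurface.O32.exists_map_eq_smul_of_sign (a := c)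
      (b := ![1, 0, 0, 0, 0]) (by simpa [TimelikeSurface.pinner_five] using hc)
    exact ⟨T, Or.inr (Or.inr (h.act T hr hT).exists_isMinimalH)⟩
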